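/- Let $A$ be a finite-dimensional algebra over a field $K$; modules are finite-dimensional right modules and $D=\operatorname{Hom}_K(-,K)$. Let $e\in A$ be an idempotent such that $eA$ is a minimal faithful projective-injective right $A$-module. Assume that $A$ is gendo-symmetric, that is, $A$ has dominant dimension at least $2$ and $D(Ae)\cong eA$ as $(eAe,A)$-bimodules. An $A$-module $M$ is Gorenstein projective if $\operatorname{Ext}^i_A(M,A)=0=\operatorname{Ext}^i_A(\operatorname{Tr}M,A)$ for all $i\ge 1$, and Gorenstein injective if $D(M)$ is Gorenstein projective. Let $\mathrm{Gpi}(A)$ be the full subcategory of modules that are both. For a module $X$ put $X^\perp=\{M\mid \operatorname{Ext}^i(X,M)=0\ \forall i\ge 1\}$ and ${}^\perp X=\{M\mid \operatorname{Ext}^i(M,X)=0\ \forall i\ge 1\}$. The algebra $A$ is nearly Gorenstein if the Gorenstein projective modules are exactly those in ${}^\perp A$ and the Gorenstein injective modules are exactly those in $D(A)^\perp$. Regard $Ae$ as a right $eAe$-module, and form ${}^\perp(Ae)$ and $(Ae)^\perp$ in the category of right $eAe$-modules. For a right $eAe$-module $X$ let $G_1(X)=X\otimes_{eAe}eA$ and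 $G_2(X)=\operatorname{Hom}_{eAe}(Ae,X)$, which are right $A$-modules, and let $$\mathcal W=\{X\in{}^\perp(Ae)\cap(Ae)^\perp\mid G_1(X)\cong G_2(X)\}.$$ (1) If $A$ is not selfinjective, then the functor $M\mapsto Me$ restricts to an equivalence of categories $(-)e\colon \mathrm{Gpi}(A)\to\mathcal W$. (2) If $A$ is nearly Gorenstein, then the functor $M\mapsto Me$ restricts to an equivalence of categories $(-)e\colon\mathrm{Gpi}(A)\to(Ae)^\perp$, and $(Ae)^\perp={}^\perp(Ae)={}^\perp(Ae)\cap(Ae)^\perp$. -/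

import Mathlib

open CategoryTheory MulOpposite
open scoped TensorProduct

universe u

namespace GendoSym

noncomputable section

/-! Right modules over a ring `A` are modules over `Aᵐᵒᵖ`, with `m * a` written `op a • m`. -/

/-! ### Subcategories of finitely generated modules -/

section General

variable {R : Type u} [Ring R]

/-- The finitely generated modules `M` with `Ext^i(M, X) = 0` for all `i ≥ 1`. -/
def leftPerp (X : ModuleCat.{u} R) : ObjectProperty (ModuleCat.{u} R) :=
  fun M => Module.Finite R M ∧ ∀ i : ℕ, 1 ≤ i → Subsingleton (Abelian.Ext M X i)

/-- The finitely generated modules `M` with `Ext^i(X, M) = 0` for all `i ≥ 1`. -/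
def rightPerp (X : ModuleCat.{u} R) : ObjectProperty (ModuleCat.{u} R) :=
  fun M => Module.Finite R M ∧ ∀ i : ℕ, 1 ≤ i → Subsingleton (Abelian.Ext X M i)

/-- `f : M → I` is an injective envelope. -/
structure IsInjectiveEnvelope {M I : ModuleCat.{u} R} (f : M →ₗ[R] I) : Prop where
  injective_obj : Module.Injective R I
  injective_map : Function.Injective f
  essential : ∀ N : Submodule R I, N ⊓ LinearMap.range f = ⊥ → N = ⊥

/-- The first `n` terms `I_0, …, I_{n-1}` of a minimal injective resolution of `M` are
projective. -/
def DomDimGE : ℕ → ModuleCat.{u} R → Prop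
  | 0, _ => True
  | n + 1, M => ∃ (I : ModuleCat.{u} R) (f : M →ₗ[R] I), IsInjectiveEnvelope f ∧
      Module.Projective R I ∧ DomDimGE n (ModuleCat.of R (I ⧸ LinearMap.range f))

/-- The dominant dimension of a module. -/
def domDim (M : ModuleCat.{u} R) : ℕ∞ :=
  ⨆ n ∈ {n : ℕ | DomDimGE n M}, (n : ℕ∞)

/-- `X` is a direct summand of `M`. -/
def IsSummand (X M : ModuleCat.{u} R) : Prop :=
  ∃ (i : X →ₗ[R] M) (p : M →ₗ[R] X), p ∘ₗ i = LinearMap.id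

/-- `X` is a minimal faithful projective-injective module: it is finitely generated, projective,
injective and faithful, and it is a direct summand of every finitely generated faithful module. -/
structure IsMinimalFaithfulProjInj (X : ModuleCat.{u} R) : Prop where
  finite : Module.Finite R X
  projective : Module.Projective R X
  injective : Module.Injective R X
  faithful : FaithfulSMul R X
  minimal : ∀ M : ModuleCat.{u} R, Module.Finite R M → FaithfulSMul R M → IsSummand X M

/-- The functor `F` maps `P` into `Q`, and the induced functor between the full subcategories
on `P` and on `Q` is an equivalence of categories. -/
def RestrictsToEquivalence {C D : Type*} [Category* C] [Category* D] (F : C ⥤ D)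
    (P : ObjectProperty C) (Q : ObjectProperty D) : Prop :=
  ∃ h : ∀ M : P.FullSubcategory, Q ((P.ι ⋙ F).obj M), (Q.lift (P.ι ⋙ F) h).IsEquivalence

end General

/-! ### Gorenstein projective modules

The next two definitions are used for the two cases `(R, S) = (Aᵐᵒᵖ, A)` (right modules) and
`(R, S) = (A, Aᵐᵒᵖ)` (left modules), with `T = A` the regular bimodule. -/

section Gorenstein

variable (R S T : Type u) [Ring R] [Ring S] [AddCommGroup T] [Module R T] [Module S T]
  [SMulCommClass R S T]

/-- `Hom_R(f, T) : Hom_R(N, T) → Hom_R(M, T)`, a homomorphism of `S`-modules. -/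
def homDual {M N : ModuleCat.{u} R} (f : M →ₗ[R] N) : (N →ₗ[R] T) →ₗ[S] (M →ₗ[R] T) where
  toFun g := g ∘ₗ f
  map_add' _ _ := rfl
  map_smul' _ _ := rfl

/-- `N` is a transpose of `M`: the cokernel of `Hom(P₀, A) → Hom(P₁, A)`, where
`P₁ → P₀ → M → 0` is a presentation by finitely generated projective modules. It is determined
by `M` up to projective direct summands. -/
def IsTranspose (M : ModuleCat.{u} R) (N : ModuleCat.{u} S) : Prop :=
  ∃ (P₁ P₀ : ModuleCat.{u} R) (f : P₁ →ₗ[R] P₀) (g : P₀ →ₗ[R] M),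
    Module.Finite R P₁ ∧ Module.Projective R P₁ ∧ Module.Finite R P₀ ∧ Module.Projective R P₀ ∧
    Function.Exact f g ∧ Function.Surjective g ∧
    Nonempty (N ≅ ModuleCat.of S ((P₁ →ₗ[R] T) ⧸ LinearMap.range (homDual R S T f)))

/-- `Ext^i(M, A) = 0 = Ext^i(Tr M, A)` for all `i ≥ 1`. -/
def gorensteinProjective : ObjectProperty (ModuleCat.{u} R) :=
  fun M => leftPerp (ModuleCat.of R T) M ∧
    ∃ N : ModuleCat.{u} S, IsTranspose R S T M N ∧ leftPerp (ModuleCat.of S T) N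

end Gorenstein

section Algebra

variable (K A : Type u) [Field K] [Ring A] [Algebra K A]

/-- The Gorenstein projective right `A`-modules. -/
abbrev Gp : ObjectProperty (ModuleCat.{u} Aᵐᵒᵖ) := gorensteinProjective Aᵐᵒᵖ A A

/-! ### The duality `D = Hom_K(-, K)` -/

open scoped ModuleCat in
/-- `D(M) = Hom_K(M, K)` for a left module `M`, a right module by `(f * a)(m) = f (a * m)`. -/
def dualOfLeft (M : ModuleCat.{u} A) : ModuleCat.{u} Aᵐᵒᵖ :=
  letI : Module Aᵐᵒᵖ (M →ₗ[K] K) :=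
    { smul := fun a f => f ∘ₗ Algebra.lsmul K K M a.unop
      one_smul := fun f => by ext m; exact congrArg f (one_smul A m)
      mul_smul := fun a b f => by ext m; exact congrArg f (mul_smul b.unop a.unop m)
      smul_zero := fun _ => rfl
      smul_add := fun _ _ _ => rfl
      add_smul := fun a b f => by
        ext m
        exact (congrArg f (add_smul a.unop b.unop m)).trans (map_add f _ _)
      zero_smul := fun f => by
        ext m
        exact (congrArg f (zero_smul A m)).trans (map_zero f) }
  ModuleCat.of Aᵐᵒᵖ (M →ₗ[K] K)

open scoped ModuleCat in
/-- `D(M) = Hom_K(M, K)` for a right module `M`, a left module by `(a * f)(m) = f (m * a)`. -/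
def dualOfRight (M : ModuleCat.{u} Aᵐᵒᵖ) : ModuleCat.{u} A :=
  letI : Module A (M →ₗ[K] K) :=
    { smul := fun a f => f ∘ₗ Algebra.lsmul K K M (op a)
      one_smul := fun f => by ext m; exact congrArg f (one_smul Aᵐᵒᵖ m)
      mul_smul := fun a b f => by ext m; exact congrArg f (mul_smul (op b) (op a) m)
      smul_zero := fun _ => rfl
      smul_add := fun _ _ _ => rfl
      add_smul := fun a b f => by
        ext m
        exact (congrArg f (add_smul (op a) (op b) m)).trans (map_add f _ _)
      zero_smul := fun f => by
        ext m
        exact (congrArg f (zero_smul Aᵐᵒᵖ m)).trans (map_zero f) }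
  ModuleCat.of A (M →ₗ[K] K)

/-- The Gorenstein injective right `A`-modules: those `M` (finitely generated) for which the left
module `D(M)` is Gorenstein projective. -/
def Gi : ObjectProperty (ModuleCat.{u} Aᵐᵒᵖ) :=
  fun M => Module.Finite Aᵐᵒᵖ M ∧ gorensteinProjective A Aᵐᵒᵖ A (dualOfRight K A M)

/-- The Gorenstein projective-injective right `A`-modules. -/
def Gpi : ObjectProperty (ModuleCat.{u} Aᵐᵒᵖ) := Gp A ⊓ Gi K A

/-- `Gp(A) = ⊥A` and `Gi(A) = D(A)⊥`. -/
structure IsNearlyGorenstein : Prop where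
  left : Gp A = leftPerp (ModuleCat.of Aᵐᵒᵖ A)
  right : Gi K A = rightPerp (dualOfLeft K A (ModuleCat.of A A))

/-- The regular right module is injective. -/
def IsSelfinjective : Prop := Module.Injective Aᵐᵒᵖ A

end Algebra

/-! ### The corner `eAe` and its bimodules -/

section Corner

variable {A : Type u} [Ring A] {e : A} (he : IsIdempotentElem e)

/-- The right module `eA = {x | e * x = x}`. -/
def eA (_ : IsIdempotentElem e) : Submodule Aᵐᵒᵖ A where
  carrier := {x | e * x = x}
  add_mem' {x y} hx hy := by
    change e * (x + y) = x + y
    rw [mul_add, show e * x = x from hx, show e * y = y from hy]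
  zero_mem' := mul_zero e
  smul_mem' a x hx := by
    change e * (x * a.unop) = x * a.unop
    rw [← mul_assoc, show e * x = x from hx]

/-- The left module `Ae = {x | x * e = x}`. -/
def Ae (_ : IsIdempotentElem e) : Submodule A A where
  carrier := {x | x * e = x}
  add_mem' {x y} hx hy := by
    change (x + y) * e = x + y
    rw [add_mul, show x * e = x from hx, show y * e = y from hy]
  zero_mem' := zero_mul e
  smul_mem' a x hx := by
    change a * x * e = a * x
    rw [mul_assoc, show x * e = x from hx]

theorem corner_left (b : he.Corner) : e * b.1 = b.1 :=
  ((Subsemigroup.mem_corner_iff he).mp b.2).1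

theorem corner_right (b : he.Corner) : b.1 * e = b.1 :=
  ((Subsemigroup.mem_corner_iff he).mp b.2).2

/-- `eA` is a left `eAe`-module by multiplication. -/
instance : Module he.Corner (eA he) where
  smul b y := ⟨b.1 * y.1, by
    change e * (b.1 * y.1) = b.1 * y.1
    rw [← mul_assoc, corner_left]⟩
  one_smul y := Subtype.ext y.2
  mul_smul b c y := Subtype.ext (mul_assoc b.1 c.1 y.1)
  smul_zero b := Subtype.ext (mul_zero b.1)
  smul_add b y z := Subtype.ext (mul_add b.1 y.1 z.1)
  add_smul b c y := Subtype.ext (add_mul b.1 c.1 y.1)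
  zero_smul y := Subtype.ext (zero_mul y.1)

/-- `Ae` is a right `eAe`-module by multiplication. -/
instance : Module he.Cornerᵐᵒᵖ (Ae he) where
  smul b y := ⟨y.1 * b.unop.1, by
    change y.1 * b.unop.1 * e = y.1 * b.unop.1
    rw [mul_assoc, corner_right]⟩
  one_smul y := Subtype.ext y.2
  mul_smul b c y := Subtype.ext (mul_assoc y.1 c.unop.1 b.unop.1).symm
  smul_zero b := Subtype.ext (zero_mul b.unop.1)
  smul_add b y z := Subtype.ext (add_mul y.1 z.1 b.unop.1)
  add_smul b c y := Subtype.ext (mul_add y.1 b.unop.1 c.unop.1)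
  zero_smul y := Subtype.ext (mul_zero y.1)

/-- `Ae` as a right `eAe`-module. -/
def AeCorner : ModuleCat.{u} he.Cornerᵐᵒᵖ := ModuleCat.of he.Cornerᵐᵒᵖ (Ae he)

/-- The underlying group of `Me`, where `M` is a right `A`-module. -/
def cornerGroup (_ : IsIdempotentElem e) (M : ModuleCat.{u} Aᵐᵒᵖ) : AddSubgroup M where
  carrier := {m | op e • m = m}
  add_mem' {x y} hx hy := by
    change op e • (x + y) = x + y
    rw [smul_add, show op e • x = x from hx, show op e • y = y from hy]
  zero_mem' := smul_zero _
  neg_mem' {x} hx := by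
    change op e • (-x) = -x
    rw [smul_neg, show op e • x = x from hx]

/-- The right `eAe`-module structure of `Me`. -/
instance (M : ModuleCat.{u} Aᵐᵒᵖ) : Module he.Cornerᵐᵒᵖ (cornerGroup he M) where
  smul b m := ⟨op b.unop.1 • m.1, by
    change op e • op b.unop.1 • m.1 = op b.unop.1 • m.1
    rw [← mul_smul, ← op_mul, corner_right]⟩
  one_smul m := Subtype.ext m.2
  mul_smul b c m := Subtype.ext (mul_smul (op b.unop.1) (op c.unop.1) m.1)
  smul_zero b := Subtype.ext (smul_zero (op b.unop.1))
  smul_add b m n := Subtype.ext (smul_add (op b.unop.1) m.1 n.1)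
  add_smul b c m := Subtype.ext (add_smul (op b.unop.1) (op c.unop.1) m.1)
  zero_smul m := Subtype.ext (zero_smul Aᵐᵒᵖ m.1)

/-- The functor `(-)e` from right `A`-modules to right `eAe`-modules. -/
def cornerFunctor : ModuleCat.{u} Aᵐᵒᵖ ⥤ ModuleCat.{u} he.Cornerᵐᵒᵖ where
  obj M := ModuleCat.of he.Cornerᵐᵒᵖ (cornerGroup he M)
  map {M N} f := ModuleCat.ofHom
    { toFun := fun m => ⟨f.hom m.1, by
        change op e • f.hom m.1 = f.hom m.1
        rw [← map_smul, show op e • m.1 = m.1 from m.2]⟩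
      map_add' := fun m n => Subtype.ext (map_add f.hom m.1 n.1)
      map_smul' := fun b m => Subtype.ext (map_smul f.hom (op b.unop.1) m.1) }

/-- `G₁(X) = X ⊗_{eAe} eA` as a right `A`-module: the quotient of `eA ⊗_ℤ X` by the relations
`(b y) ⊗ x = y ⊗ (x b)` for `b ∈ eAe`. -/
def G₁ (X : ModuleCat.{u} he.Cornerᵐᵒᵖ) : ModuleCat.{u} Aᵐᵒᵖ :=
  ModuleCat.of Aᵐᵒᵖ ((eA he ⊗[ℤ] X) ⧸ Submodule.span Aᵐᵒᵖ
    {t : eA he ⊗[ℤ] X | ∃ (b : he.Corner) (y : eA he) (x : X),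
      t = (b • y) ⊗ₜ[ℤ] x - y ⊗ₜ[ℤ] (op b • x)})

/-- `G₂(X) = Hom_{eAe}(Ae, X)`, a right `A`-module by `(f * a)(y) = f (a * y)`. -/
def G₂ (X : ModuleCat.{u} he.Cornerᵐᵒᵖ) : ModuleCat.{u} Aᵐᵒᵖ :=
  letI : Module Aᵐᵒᵖ (Ae he →ₗ[he.Cornerᵐᵒᵖ] X) :=
    { smul := fun a f =>
        { toFun := fun y => f (a.unop • y)
          map_add' := fun y z => by rw [smul_add, map_add]
          map_smul' := fun b y =>
            (congrArg f (Subtype.ext (mul_assoc a.unop y.1 b.unop.1).symm)).trans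
              (map_smul f b (a.unop • y)) }
      one_smul := fun f => by ext y; exact congrArg f (one_smul A y)
      mul_smul := fun a b f => by ext y; exact congrArg f (mul_smul b.unop a.unop y)
      smul_zero := fun _ => rfl
      smul_add := fun _ _ _ => rfl
      add_smul := fun a b f => by
        ext y
        exact (congrArg f (add_smul a.unop b.unop y)).trans (map_add f _ _)
      zero_smul := fun f => by
        ext y
        exact (congrArg f (zero_smul A y)).trans (map_zero f) }
  ModuleCat.of Aᵐᵒᵖ (Ae he →ₗ[he.Cornerᵐᵒᵖ] X)

/-- `W = {X ∈ ⊥(Ae) ∩ (Ae)⊥ | G₁(X) ≅ G₂(X)}`. -/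
def W : ObjectProperty (ModuleCat.{u} he.Cornerᵐᵒᵖ) :=
  fun X => (leftPerp (AeCorner he) ⊓ rightPerp (AeCorner he)) X ∧ Nonempty (G₁ he X ≅ G₂ he X)

end Corner

/-! ### Gendo-symmetric algebras -/

section Gendo

variable (K : Type u) {A : Type u} [Field K] [Ring A] [Algebra K A] {e : A}

/-- An isomorphism `eA ≅ D(Ae)` of `(eAe, A)`-bimodules, where `D(Ae) = Hom_K(Ae, K)` has
`(f * a)(z) = f (a * z)` for `a ∈ A` and `(b * f)(z) = f (z * b)` for `b ∈ eAe`. -/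
structure BimoduleIso (he : IsIdempotentElem e) where
  toEquiv : eA he ≃ₗ[K] (Ae he →ₗ[K] K)
  map_right : ∀ (y : eA he) (a : A) (z : Ae he), toEquiv (op a • y) z = toEquiv y (a • z)
  map_left : ∀ (b : he.Corner) (y : eA he) (z : Ae he), toEquiv (b • y) z = toEquiv y (op b • z)

variable (A)

/-- `A` has dominant dimension at least two and `eA ≅ D(Ae)` as bimodules, where `eA` is a minimal
faithful projective-injective right module. -/
def IsGendoSymmetric : Prop :=
  2 ≤ domDim (ModuleCat.of Aᵐᵒᵖ A) ∧
    ∃ (e : A) (he : IsIdempotentElem e),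
      IsMinimalFaithfulProjInj (ModuleCat.of Aᵐᵒᵖ (eA he)) ∧ Nonempty (BimoduleIso K he)

end Gendo

end

end GendoSym

/-! Write F for the exact functor (-)e and Q for D(A). The bimodule isomorphism D(Ae) ≅ eA gives
F(A) = Ae ≅ D(A)e = F(Q) (`cornerRegularIso`), and dominant dimension at least 2 makes F bijective
on Hom(M, A) and, dually, on Hom(Q, M) for every M. After applying F, maps to the projective A and
maps to the injective Q can therefore be exchanged; this is what `DualPair` records.

Call M local if F is bijective on Hom(A, M), which amounts to M ≅ G₂(Me), and colocal if F is
bijective on Hom(M, Q), which amounts to M ≅ G₁(Me). A finitely generated local module embeds in a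
power of eA, a colocal one is a quotient of such a power, and these powers are projective and
injective both before and after applying F. Dimension shifting along these sequences shows that
Ext(Me, Ae) vanishes iff Ext(M, A) does when M is colocal, and that Ext(Ae, Me) vanishes iff Ext(Q,
M) does when M is local (`extVanish_map_left`, `extVanish_map_right`).

The class Gpi consists of the finitely generated modules that are local, colocal and satisfy Ext(M,
A) = 0 = Ext(Q, M). This class is closed under syzygies and cosyzygies formed with powers of eA, and
iterating these makes M Gorenstein projective and Gorenstein injective (`gpi_of_isBiperpendicular`).
Conversely, a Gorenstein projective module is A-reflexive and so inherits locality from A; the dual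
argument gives colocality of Gorenstein injectives. Since G₁(X) ≅ G₂(X) says that this module is
both local and colocal, F carries Gpi onto W.

If A is nearly Gorenstein and X lies in (Ae)^⊥, then M = G₂(X) is local with Ext(Q, M) = 0, hence
Gorenstein injective, hence colocal. The syzygies of M have the same properties, and exchanging A
and Q kills Ext^1(-, A) at each of them. So (Ae)^⊥ ⊆ W ⊆ ⊥(Ae), and the dual argument with G₁ gives
⊥(Ae) ⊆ (Ae)^⊥. -/

namespace GendoSym

/-! ### Dimension shifting for vanishing of Ext. -/

section ExtVanishing

variable {C : Type*} [Category* C] [Abelian C] [HasExt C]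

/-- `Ext^i(X, Y) = 0` for `1 ≤ i ≤ n`. -/
def ExtVanishUpTo (n : ℕ) (X Y : C) : Prop :=
  ∀ i : ℕ, 1 ≤ i → i ≤ n → Subsingleton (Abelian.Ext X Y i)

/-- `Ext^i(X, Y) = 0` for all `i ≥ 1`. -/
def ExtVanish (X Y : C) : Prop :=
  ∀ i : ℕ, 1 ≤ i → Subsingleton (Abelian.Ext X Y i)

theorem extVanish_iff {X Y : C} : ExtVanish X Y ↔ ∀ n, ExtVanishUpTo n X Y :=
  ⟨fun h _ i hi _ => h i hi, fun h i hi => h i i hi le_rfl⟩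

theorem extVanishUpTo_zero (X Y : C) : ExtVanishUpTo 0 X Y := fun i h h' => by omega

theorem extVanish_of_projective (X Y : C) [Projective X] : ExtVanish X Y := by
  intro i hi
  obtain ⟨j, rfl⟩ : ∃ j, i = j + 1 := ⟨i - 1, by omega⟩
  exact subsingleton_of_forall_eq 0 fun x => x.eq_zero_of_projective

theorem extVanish_of_injective (X Y : C) [Injective Y] : ExtVanish X Y := by
  intro i hi
  obtain ⟨j, rfl⟩ : ∃ j, i = j + 1 := ⟨i - 1, by omega⟩
  exact subsingleton_of_forall_eq 0 fun x => x.eq_zero_of_injective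

theorem ExtVanish.of_iso_left {X X' Y : C} (h : ExtVanish X Y) (φ : X ≅ X') : ExtVanish X' Y := by
  intro i hi
  have := h i hi
  refine subsingleton_of_forall_eq 0 fun x => ?_
  have h0 : (Abelian.Ext.mk₀ φ.hom).comp x (zero_add i) = 0 := Subsingleton.elim _ _
  have h1 : (Abelian.Ext.mk₀ φ.inv).comp ((Abelian.Ext.mk₀ φ.hom).comp x (zero_add i))
      (zero_add i) = x := by
    rw [Abelian.Ext.mk₀_comp_mk₀_assoc, φ.inv_hom_id, Abelian.Ext.mk₀_id_comp]
  rw [← h1, h0, Abelian.Ext.comp_zero]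

theorem ExtVanish.of_iso_right {X Y Y' : C} (h : ExtVanish X Y) (φ : Y ≅ Y') :
    ExtVanish X Y' := by
  intro i hi
  have := h i hi
  refine subsingleton_of_forall_eq 0 fun x => ?_
  have h0 : x.comp (Abelian.Ext.mk₀ φ.inv) (add_zero i) = 0 := Subsingleton.elim _ _
  have h1 : (x.comp (Abelian.Ext.mk₀ φ.inv) (add_zero i)).comp (Abelian.Ext.mk₀ φ.hom)
      (add_zero i) = x := by
    rw [Abelian.Ext.comp_assoc_of_third_deg_zero, Abelian.Ext.mk₀_comp_mk₀, φ.inv_hom_id,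
      Abelian.Ext.comp_mk₀_id]
  rw [← h1, h0, Abelian.Ext.zero_comp]

/-- Every morphism `S.X₁ ⟶ T` extends to `S.X₂`. -/
def Extends (S : ShortComplex C) (T : C) : Prop :=
  ∀ f : S.X₁ ⟶ T, ∃ g : S.X₂ ⟶ T, S.f ≫ g = f

/-- Every morphism `T ⟶ S.X₃` lifts to `S.X₂`. -/
def Lifts (T : C) (S : ShortComplex C) : Prop :=
  ∀ f : T ⟶ S.X₃, ∃ g : T ⟶ S.X₂, g ≫ S.g = f

/-- By the long exact sequence, Ext^1(X₃, T) is the cokernel of Hom(X₂, T) → Hom(X₁, T), and the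
higher groups shift to X₁. The bound on the degree permits induction on `n` while the object varies.
-/
theorem extVanishUpTo_succ_left {S : ShortComplex C} (hS : S.ShortExact) {T : C}
    (h2 : ExtVanish S.X₂ T) (n : ℕ) :
    ExtVanishUpTo (n + 1) S.X₃ T ↔ Extends S T ∧ ExtVanishUpTo n S.X₁ T := by
  constructor
  · intro h
    refine ⟨fun f => ?_, fun i hi hin => ?_⟩
    · have := h 1 le_rfl (by omega)
      obtain ⟨x, hx⟩ := Abelian.Ext.contravariant_sequence_exact₁ hS T (Abelian.Ext.mk₀ f)
        (n₁ := 1) rfl (Subsingleton.elim _ _)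
      obtain ⟨g, rfl⟩ := (Abelian.Ext.mk₀_bijective _ _).2 x
      rw [Abelian.Ext.mk₀_comp_mk₀] at hx
      exact ⟨g, (Abelian.Ext.mk₀_bijective _ _).1 hx⟩
    · have := h (i + 1) (by omega) (by omega)
      have := h2 i hi
      refine subsingleton_of_forall_eq 0 fun x => ?_
      obtain ⟨y, rfl⟩ := Abelian.Ext.contravariant_sequence_exact₁ hS T x
        (n₁ := i + 1) (by omega) (Subsingleton.elim _ _)
      rw [Subsingleton.elim y 0, Abelian.Ext.comp_zero]
  · rintro ⟨he, h⟩ i hi hin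
    obtain ⟨j, rfl⟩ : ∃ j, i = 1 + j := ⟨i - 1, by omega⟩
    have := h2 _ hi
    refine subsingleton_of_forall_eq 0 fun x => ?_
    obtain ⟨y, rfl⟩ := Abelian.Ext.contravariant_sequence_exact₃ hS T x
        (Subsingleton.elim _ _) rfl
    rcases Nat.eq_zero_or_pos j with rfl | hj
    · obtain ⟨f, rfl⟩ := (Abelian.Ext.mk₀_bijective _ _).2 y
      obtain ⟨g, rfl⟩ := he f
      -- In degree 1 the class is the extension class pushed out along a map factoring through
      -- `S.f`, and the pushout along `S.f` is zero.
      rw [← Abelian.Ext.mk₀_comp_mk₀, ← Abelian.Ext.comp_assoc_of_second_deg_zero,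
        hS.extClass_comp, Abelian.Ext.zero_comp]
    · have := h j hj (by omega)
      rw [Subsingleton.elim y 0, Abelian.Ext.comp_zero]

theorem extVanishUpTo_succ_right {S : ShortComplex C} (hS : S.ShortExact) {T : C}
    (h2 : ExtVanish T S.X₂) (n : ℕ) :
    ExtVanishUpTo (n + 1) T S.X₁ ↔ Lifts T S ∧ ExtVanishUpTo n T S.X₃ := by
  constructor
  · intro h
    refine ⟨fun f => ?_, fun i hi hin => ?_⟩
    · have := h 1 le_rfl (by omega)
      obtain ⟨x, hx⟩ := Abelian.Ext.covariant_sequence_exact₃ T hS (Abelian.Ext.mk₀ f)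
        (n₁ := 1) rfl (Subsingleton.elim _ _)
      obtain ⟨g, rfl⟩ := (Abelian.Ext.mk₀_bijective _ _).2 x
      rw [Abelian.Ext.mk₀_comp_mk₀] at hx
      exact ⟨g, (Abelian.Ext.mk₀_bijective _ _).1 hx⟩
    · have := h (i + 1) (by omega) (by omega)
      have := h2 i hi
      refine subsingleton_of_forall_eq 0 fun x => ?_
      obtain ⟨y, rfl⟩ := Abelian.Ext.covariant_sequence_exact₃ T hS x
        (n₁ := i + 1) (by omega) (Subsingleton.elim _ _)
      rw [Subsingleton.elim y 0, Abelian.Ext.zero_comp]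
  · rintro ⟨he, h⟩ i hi hin
    obtain ⟨j, rfl⟩ : ∃ j, i = j + 1 := ⟨i - 1, by omega⟩
    have := h2 _ hi
    refine subsingleton_of_forall_eq 0 fun x => ?_
    obtain ⟨y, rfl⟩ := Abelian.Ext.covariant_sequence_exact₁ T hS x
        (Subsingleton.elim _ _) rfl
    rcases Nat.eq_zero_or_pos j with rfl | hj
    · obtain ⟨f, rfl⟩ := (Abelian.Ext.mk₀_bijective _ _).2 y
      obtain ⟨g, rfl⟩ := he f
      rw [← Abelian.Ext.mk₀_comp_mk₀, Abelian.Ext.comp_assoc_of_second_deg_zero,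
        hS.comp_extClass, Abelian.Ext.comp_zero]
    · have := h j hj (by omega)
      rw [Subsingleton.elim y 0, Abelian.Ext.zero_comp]

theorem extVanish_left_iff {S : ShortComplex C} (hS : S.ShortExact) {T : C}
    (h2 : ExtVanish S.X₂ T) : ExtVanish S.X₃ T ↔ Extends S T ∧ ExtVanish S.X₁ T := by
  simp only [extVanish_iff (X := S.X₁)]
  constructor
  · intro h
    have h' := fun n => (extVanishUpTo_succ_left hS h2 n).1 (extVanish_iff.1 h (n + 1))
    exact ⟨(h' 0).1, fun n => (h' n).2⟩
  · rintro ⟨h, h'⟩ i hi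
    exact (extVanishUpTo_succ_left hS h2 i).2 ⟨h, h' i⟩ i hi (by omega)

theorem extVanish_right_iff {S : ShortComplex C} (hS : S.ShortExact) {T : C}
    (h2 : ExtVanish T S.X₂) : ExtVanish T S.X₁ ↔ Lifts T S ∧ ExtVanish T S.X₃ := by
  simp only [extVanish_iff (Y := S.X₃)]
  constructor
  · intro h
    have h' := fun n => (extVanishUpTo_succ_right hS h2 n).1 (extVanish_iff.1 h (n + 1))
    exact ⟨(h' 0).1, fun n => (h' n).2⟩
  · rintro ⟨h, h'⟩ i hi
    exact (extVanishUpTo_succ_right hS h2 i).2 ⟨h, h' i⟩ i hi (by omega)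

/-- `Extends S T` gives vanishing of Ext^1 for every member of the class; since the kernels are
again members, shifting reaches every degree. -/
theorem extVanish_of_syzygies {T : C} (c : C → Prop)
    (h : ∀ X, c X → ∃ S : ShortComplex C, S.ShortExact ∧ ExtVanish S.X₂ T ∧ Extends S T ∧
      c S.X₁ ∧ S.X₃ = X) {X : C} (hX : c X) : ExtVanish X T := by
  rw [extVanish_iff]
  intro n
  induction n generalizing X with
  | zero => exact extVanishUpTo_zero _ _
  | succ n ih =>
    obtain ⟨S, hS, h2, hE, h1, rfl⟩ := h X hX
    exact (extVanishUpTo_succ_left hS h2 n).2 ⟨hE, ih h1⟩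

theorem extVanish_of_cosyzygies {T : C} (c : C → Prop)
    (h : ∀ X, c X → ∃ S : ShortComplex C, S.ShortExact ∧ ExtVanish T S.X₂ ∧ Lifts T S ∧
      c S.X₃ ∧ S.X₁ = X) {X : C} (hX : c X) : ExtVanish T X := by
  rw [extVanish_iff]
  intro n
  induction n generalizing X with
  | zero => exact extVanishUpTo_zero _ _
  | succ n ih =>
    obtain ⟨S, hS, h2, hE, h1, rfl⟩ := h X hX
    exact (extVanishUpTo_succ_right hS h2 n).2 ⟨hE, ih h1⟩

end ExtVanishing

/-! ### Functors bijective on Hom sets, and exchanging A with Q. -/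

section HomBijective

variable {C D : Type*} [Category* C] [Abelian C] [Category* D] (F : C ⥤ D)

/-- `F` is bijective on the morphisms `X ⟶ Y`. -/
def HomBijective (X Y : C) : Prop := Function.Bijective (F.map : (X ⟶ Y) → (F.obj X ⟶ F.obj Y))

variable {F}

theorem HomBijective.extends_map_iff [Abelian D] [F.Additive] {S : ShortComplex C} {T : C} (h1 : HomBijective F S.X₁ T)
    (h2 : HomBijective F S.X₂ T) : Extends (S.map F) (F.obj T) ↔ Extends S T := by
  constructor
  · intro h f
    obtain ⟨g, hg⟩ := h (F.map f)
    obtain ⟨g, rfl⟩ := h2.2 g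
    refine ⟨g, h1.1 ?_⟩
    rw [F.map_comp]; exact hg
  · intro h f
    obtain ⟨f, rfl⟩ := h1.2 f
    obtain ⟨g, rfl⟩ := h f
    exact ⟨F.map g, (F.map_comp _ _).symm⟩

theorem HomBijective.lifts_map_iff [Abelian D] [F.Additive] {S : ShortComplex C} {T : C} (h3 : HomBijective F T S.X₃)
    (h2 : HomBijective F T S.X₂) : Lifts (F.obj T) (S.map F) ↔ Lifts T S := by
  constructor
  · intro h f
    obtain ⟨g, hg⟩ := h (F.map f)
    obtain ⟨g, rfl⟩ := h2.2 g
    refine ⟨g, h3.1 ?_⟩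
    rw [F.map_comp]; exact hg
  · intro h f
    obtain ⟨f, rfl⟩ := h3.2 f
    obtain ⟨g, rfl⟩ := h f
    exact ⟨F.map g, (F.map_comp _ _).symm⟩

variable (F) in
/-- A projective object `A` and an injective object `Q` with `F A ≅ F Q`, such that `F` is
bijective on morphisms to `A` and on morphisms from `Q`. -/
structure DualPair (A Q : C) where
  projective : Projective A
  injective : Injective Q
  iso : F.obj A ≅ F.obj Q
  bij_to (M : C) : HomBijective F M A
  bij_from (M : C) : HomBijective F Q M

variable {A Q : C}

/-- A map to A becomes, through F A ≅ F Q, the image of a map to Q. That map extends because Q is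
injective, and the extension is translated back to A by `bij_to`. -/
theorem DualPair.extends (p : DualPair F A Q) {S : ShortComplex C} [Mono S.f] (h1 : HomBijective F S.X₁ Q) :
    Extends S A := by
  have := p.injective
  intro c
  obtain ⟨q, hq⟩ := h1.2 (F.map c ≫ p.iso.hom)
  obtain ⟨a, ha⟩ := (p.bij_to S.X₂).2 (F.map (Injective.factorThru q S.f) ≫ p.iso.inv)
  refine ⟨a, (p.bij_to _).1 ?_⟩
  rw [F.map_comp, ha, ← Category.assoc, ← F.map_comp, Injective.comp_factorThru, hq,
    Category.assoc, p.iso.hom_inv_id, Category.comp_id]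

theorem DualPair.lifts (p : DualPair F A Q) {S : ShortComplex C} [Epi S.g] (h3 : HomBijective F A S.X₃) :
    Lifts Q S := by
  have := p.projective
  intro c
  obtain ⟨q, hq⟩ := h3.2 (p.iso.hom ≫ F.map c)
  obtain ⟨a, ha⟩ := (p.bij_from S.X₂).2 (p.iso.inv ≫ F.map (Projective.factorThru q S.g))
  refine ⟨a, (p.bij_from _).1 ?_⟩
  rw [F.map_comp, ha, Category.assoc, ← F.map_comp, Projective.factorThru_comp, hq,
    ← Category.assoc, p.iso.inv_hom_id, Category.id_comp]

variable [Abelian D] [F.Additive] [Limits.PreservesFiniteLimits F] [Limits.PreservesFiniteColimits F]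

/-- Hom(X, -) and F are left exact, so this is a five-lemma argument. -/
theorem HomBijective.kernel {S : ShortComplex C} (hS : S.Exact) [Mono S.f] {X : C}
    (h2 : HomBijective F X S.X₂) (h3 : HomBijective F X S.X₃) : HomBijective F X S.X₁ := by
  constructor
  · intro f g h
    rw [← cancel_mono S.f]
    apply h2.1
    rw [F.map_comp, F.map_comp, h]
  · intro h
    obtain ⟨k, hk⟩ := h2.2 (h ≫ F.map S.f)
    have hz : k ≫ S.g = 0 := by
      apply h3.1
      rw [F.map_comp, hk, Category.assoc, ← F.map_comp, S.zero, F.map_zero, F.map_zero,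
        Limits.comp_zero]
    refine ⟨hS.lift k hz, ?_⟩
    rw [← cancel_mono (F.map S.f), ← F.map_comp, hS.lift_f, hk]

theorem HomBijective.cokernel {S : ShortComplex C} (hS : S.Exact) [Epi S.g] {X : C}
    (h2 : HomBijective F S.X₂ X) (h1 : HomBijective F S.X₁ X) : HomBijective F S.X₃ X := by
  constructor
  · intro f g h
    rw [← cancel_epi S.g]
    apply h2.1
    rw [F.map_comp, F.map_comp, h]
  · intro h
    obtain ⟨k, hk⟩ := h2.2 (F.map S.g ≫ h)
    have hz : S.f ≫ k = 0 := by
      apply h1.1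
      rw [F.map_comp, hk, ← Category.assoc, ← F.map_comp, S.zero, F.map_zero, F.map_zero,
        Limits.zero_comp]
    refine ⟨hS.desc k hz, ?_⟩
    rw [← cancel_epi (F.map S.g), ← F.map_comp, hS.g_desc, hk]

/-- Subobjects of colocal objects need not be colocal. The missing surjectivity comes from the
extension property to A: a map F X₁ → F Q is read as a map X₁ → A, extended to X₂, and read again as
a map to Q. -/
theorem DualPair.bij_syzygy (p : DualPair F A Q) {S : ShortComplex C} (hS : S.ShortExact)
    (h2 : HomBijective F S.X₂ Q) (h3 : HomBijective F S.X₃ Q) (h : Extends S A) :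
    HomBijective F S.X₁ Q := by
  have := p.injective
  have := hS.mono_f
  have hFS := hS.map_of_exact F
  have := hFS.epi_g
  constructor
  · intro k k' hk
    rw [← sub_eq_zero, ← F.map_sub] at hk
    rw [← sub_eq_zero]
    set d := Injective.factorThru (k - k') S.f with hd
    have hd' : S.f ≫ d = k - k' := Injective.comp_factorThru _ _
    have hz : (S.map F).f ≫ F.map d = 0 := by
      change F.map S.f ≫ _ = 0
      rw [← F.map_comp, hd', hk]
    -- F d kills F X₁, so it factors through F X₃; lifting that factor shows that d itself factors
    -- through X₃ and vanishes on X₁.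
    obtain ⟨t, ht⟩ := h3.2 (hFS.exact.desc (F.map d) hz)
    have : d = S.g ≫ t := by
      apply h2.1
      rw [F.map_comp, ht]
      exact (hFS.exact.g_desc _ _).symm
    rw [← hd', this, ← Category.assoc, S.zero, Limits.zero_comp]
  · intro f
    obtain ⟨c, hc⟩ := (p.bij_to _).2 (f ≫ p.iso.inv)
    obtain ⟨c, rfl⟩ := h c
    obtain ⟨q, hq⟩ := h2.2 (F.map c ≫ p.iso.hom)
    refine ⟨S.f ≫ q, ?_⟩
    rw [F.map_comp, hq, ← Category.assoc, ← F.map_comp, hc, Category.assoc, p.iso.inv_hom_id,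
      Category.comp_id]

theorem DualPair.bij_cosyzygy (p : DualPair F A Q) {S : ShortComplex C} (hS : S.ShortExact)
    (h2 : HomBijective F A S.X₂) (h1 : HomBijective F A S.X₁) (h : Lifts Q S) :
    HomBijective F A S.X₃ := by
  have := p.projective
  have := hS.epi_g
  have hFS := hS.map_of_exact F
  have := hFS.mono_f
  constructor
  · intro k k' hk
    rw [← sub_eq_zero, ← F.map_sub] at hk
    rw [← sub_eq_zero]
    set d := Projective.factorThru (k - k') S.g with hd
    have hd' : d ≫ S.g = k - k' := Projective.factorThru_comp _ _
    have hz : F.map d ≫ (S.map F).g = 0 := by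
      change _ ≫ F.map S.g = 0
      rw [← F.map_comp, hd', hk]
    obtain ⟨t, ht⟩ := h1.2 (hFS.exact.lift (F.map d) hz)
    have : d = t ≫ S.f := by
      apply h2.1
      rw [F.map_comp, ht]
      exact (hFS.exact.lift_f _ _).symm
    rw [← hd', this, Category.assoc, S.zero, Limits.comp_zero]
  · intro f
    obtain ⟨c, hc⟩ := (p.bij_from _).2 (p.iso.inv ≫ f)
    obtain ⟨c, rfl⟩ := h c
    obtain ⟨q, hq⟩ := h2.2 (p.iso.hom ≫ F.map c)
    refine ⟨q ≫ S.g, ?_⟩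
    rw [F.map_comp, hq, Category.assoc, ← F.map_comp, hc, ← Category.assoc, p.iso.hom_inv_id,
      Category.id_comp]

end HomBijective

/-! ### Comparing Ext before and after F; closure under syzygies. -/

section Approximation

variable {C D : Type*} [Category* C] [Abelian C] [Category* D]

/-- A dual pair together with a class `P` of projective-injective objects through which all
objects of `fin` on which `F` is bijective can be approximated. -/
structure ApproximableDualPair (F : C ⥤ D) (A Q : C) (fin P : ObjectProperty C) extends
    DualPair F A Q where
  proj : ∀ X, P X → Projective X
  inj : ∀ X, P X → Injective X
  bij_A : ∀ X, P X → HomBijective F A X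
  bij_Q : ∀ X, P X → HomBijective F X Q
  proj_map : ∀ X, P X → Projective (F.obj X)
  inj_map : ∀ X, P X → Injective (F.obj X)
  cover : ∀ M, fin M → HomBijective F M Q →
    ∃ S : ShortComplex C, S.ShortExact ∧ S.X₃ = M ∧ P S.X₂ ∧ fin S.X₁
  cocover : ∀ M, fin M → HomBijective F A M →
    ∃ S : ShortComplex C, S.ShortExact ∧ S.X₁ = M ∧ P S.X₂ ∧ fin S.X₃

variable {F : C ⥤ D} {A Q : C} {fin P : ObjectProperty C}
  [HasExt C] (p : ApproximableDualPair F A Q fin P)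

namespace ApproximableDualPair

include p

theorem extVanish_left {X : C} (hX : P X) (T : C) : ExtVanish X T :=
  have := p.proj X hX
  extVanish_of_projective _ _

theorem extVanish_right {X : C} (hX : P X) (T : C) : ExtVanish T X :=
  have := p.inj X hX
  extVanish_of_injective _ _

end ApproximableDualPair

variable [Abelian D] [F.Additive] [Limits.PreservesFiniteLimits F] [Limits.PreservesFiniteColimits F]

namespace ApproximableDualPair

include p

/-- Both sides are shifted along the same cover. The condition in degree 1 is the same for S and for
F S, and it is also what makes the syzygy colocal again, so that the induction can continue. -/
theorem extVanish_map_left [HasExt D] {M : C} (hM : fin M) (h : HomBijective F M Q) :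
    ExtVanish (F.obj M) (F.obj A) ↔ ExtVanish M A := by
  simp only [extVanish_iff]
  refine forall_congr' fun n => ?_
  induction n generalizing M with
  | zero => exact iff_of_true (extVanishUpTo_zero _ _) (extVanishUpTo_zero _ _)
  | succ n ih =>
    obtain ⟨S, hS, rfl, hP, hf⟩ := p.cover M hM h
    have := p.proj_map _ hP
    rw [extVanishUpTo_succ_left hS (p.extVanish_left hP A) n]
    refine (extVanishUpTo_succ_left (hS.map_of_exact F)
      (extVanish_of_projective (F.obj S.X₂) _) n).trans ?_
    rw [HomBijective.extends_map_iff (p.bij_to _) (p.bij_to _)]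
    refine and_congr_right fun hE => ih hf ?_
    exact p.bij_syzygy hS (p.bij_Q _ hP) h hE

theorem extVanish_map_right [HasExt D] {M : C} (hM : fin M) (h : HomBijective F A M) :
    ExtVanish (F.obj Q) (F.obj M) ↔ ExtVanish Q M := by
  simp only [extVanish_iff]
  refine forall_congr' fun n => ?_
  induction n generalizing M with
  | zero => exact iff_of_true (extVanishUpTo_zero _ _) (extVanishUpTo_zero _ _)
  | succ n ih =>
    obtain ⟨S, hS, rfl, hP, hf⟩ := p.cocover M hM h
    have := p.inj_map _ hP
    rw [extVanishUpTo_succ_right hS (p.extVanish_right hP Q) n]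
    refine (extVanishUpTo_succ_right (hS.map_of_exact F)
      (extVanish_of_injective _ (F.obj S.X₂)) n).trans ?_
    rw [HomBijective.lifts_map_iff (p.bij_from _) (p.bij_from _)]
    refine and_congr_right fun hE => ih hf ?_
    exact p.bij_cosyzygy hS (p.bij_A _ hP) h hE

end ApproximableDualPair

variable (F A Q fin) in
/-- The objects of `fin` without extensions to `A` or from `Q` on which `F` is bijective. -/
structure IsBiperpendicular (M : C) : Prop where
  fin : fin M
  bij_A : HomBijective F A M
  bij_Q : HomBijective F M Q
  ext_A : ExtVanish M A
  ext_Q : ExtVanish Q M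

namespace ApproximableDualPair

include p

/-- Ext^1(Q, M) = 0 provides the lifting property that makes the cokernel local, while colocality of
M provides the extension property behind Ext^1(X₃, A) = 0. The other conditions follow by exactness
and shifting. -/
theorem exists_cosyzygy {M : C} (h : IsBiperpendicular F A Q fin M) :
    ∃ S : ShortComplex C, S.ShortExact ∧ S.X₁ = M ∧ P S.X₂ ∧
      IsBiperpendicular F A Q fin S.X₃ := by
  obtain ⟨S, hS, rfl, hP, hf⟩ := p.cocover M h.fin h.bij_A
  have := hS.mono_f
  have := hS.epi_g
  obtain ⟨hL, hQ⟩ := (extVanish_right_iff hS (p.extVanish_right hP Q)).1 h.ext_Q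
  refine ⟨S, hS, rfl, hP, hf, p.bij_cosyzygy hS (p.bij_A _ hP) h.bij_A hL,
    HomBijective.cokernel hS.exact (p.bij_Q _ hP) h.bij_Q, ?_, hQ⟩
  exact (extVanish_left_iff hS (p.extVanish_left hP A)).2 ⟨p.extends h.bij_Q, h.ext_A⟩

theorem exists_syzygy {M : C} (h : IsBiperpendicular F A Q fin M) :
    ∃ S : ShortComplex C, S.ShortExact ∧ S.X₃ = M ∧ P S.X₂ ∧
      IsBiperpendicular F A Q fin S.X₁ := by
  obtain ⟨S, hS, rfl, hP, hf⟩ := p.cover M h.fin h.bij_Q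
  have := hS.mono_f
  have := hS.epi_g
  obtain ⟨hL, hA⟩ := (extVanish_left_iff hS (p.extVanish_left hP A)).1 h.ext_A
  refine ⟨S, hS, rfl, hP, hf, HomBijective.kernel hS.exact (p.bij_A _ hP) h.bij_A,
    p.bij_syzygy hS (p.bij_Q _ hP) h.bij_Q hL, hA, ?_⟩
  exact (extVanish_right_iff hS (p.extVanish_right hP Q)).2 ⟨p.lifts h.bij_A, h.ext_Q⟩

/-- Under `hQ`, local modules with Ext(Q, M) = 0 are also colocal, so they have covers whose kernels
lie in the same class. Colocality of the kernel then kills Ext^1(M, A). -/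
theorem extVanish_of_extVanish_right (hQ : ∀ M, fin M → ExtVanish Q M → HomBijective F M Q)
    {M : C} (hM : fin M) (hA : HomBijective F A M) (hE : ExtVanish Q M) : ExtVanish M A := by
  refine extVanish_of_syzygies (fun M => fin M ∧ HomBijective F A M ∧ ExtVanish Q M) ?_
    ⟨hM, hA, hE⟩
  rintro M ⟨hM, hA, hE⟩
  obtain ⟨S, hS, rfl, hP, hf⟩ := p.cover M hM (hQ M hM hE)
  have := hS.mono_f
  have := hS.epi_g
  have hE' : ExtVanish Q S.X₁ :=
    (extVanish_right_iff hS (p.extVanish_right hP Q)).2 ⟨p.lifts hA, hE⟩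
  exact ⟨S, hS, p.extVanish_left hP A, p.extends (hQ _ hf hE'),
    ⟨hf, HomBijective.kernel hS.exact (p.bij_A _ hP) hA, hE'⟩, rfl⟩

theorem extVanish_of_extVanish_left (hQ : ∀ M, fin M → ExtVanish M A → HomBijective F A M)
    {M : C} (hM : fin M) (hA : HomBijective F M Q) (hE : ExtVanish M A) : ExtVanish Q M := by
  refine extVanish_of_cosyzygies (fun M => fin M ∧ HomBijective F M Q ∧ ExtVanish M A) ?_
    ⟨hM, hA, hE⟩
  rintro M ⟨hM, hA, hE⟩
  obtain ⟨S, hS, rfl, hP, hf⟩ := p.cocover M hM (hQ M hM hE)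
  have := hS.mono_f
  have := hS.epi_g
  have hE' : ExtVanish S.X₃ A :=
    (extVanish_left_iff hS (p.extVanish_left hP A)).2 ⟨p.extends hA, hE⟩
  exact ⟨S, hS, p.extVanish_right hP Q, p.lifts (hQ _ hf hE'),
    ⟨hf, HomBijective.cokernel hS.exact (p.bij_Q _ hP) hA, hE'⟩, rfl⟩

end ApproximableDualPair

end Approximation

/-! ### Short exact sequences of modules, and retracts. -/

section ModuleCat

variable {R : Type u} [Ring R]

theorem moduleCat_shortExact {X Y Z : ModuleCat.{u} R} (f : X ⟶ Y) (g : Y ⟶ Z)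
    (hf : Function.Injective f.hom) (hg : Function.Surjective g.hom)
    (h : Function.Exact f.hom g.hom) :
    (ShortComplex.mk f g (by ext x; exact h.apply_apply_eq_zero x)).ShortExact where
  exact := (ShortComplex.ShortExact.moduleCat_exact_iff_function_exact _).2 h
  mono_f := (ModuleCat.mono_iff_injective f).2 hf
  epi_g := (ModuleCat.epi_iff_surjective g).2 hg

theorem HomBijective.retract {C D : Type*} [Category* C] [Category* D] {F : C ⥤ D} {X Y Z : C}
    (h : HomBijective F X Y) (i : Z ⟶ Y) (r : Y ⟶ Z) (hir : i ≫ r = 𝟙 Z) :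
    HomBijective F X Z := by
  constructor
  · intro f g hfg
    have : f ≫ i = g ≫ i := h.1 (by rw [F.map_comp, F.map_comp, hfg])
    rw [← Category.comp_id f, ← hir, reassoc_of% this, hir, Category.comp_id]
  · intro k
    obtain ⟨l, hl⟩ := h.2 (k ≫ F.map i)
    refine ⟨l ≫ r, ?_⟩
    rw [F.map_comp, hl, Category.assoc, ← F.map_comp, hir, F.map_id, Category.comp_id]

end ModuleCat

/-! ### The exact functor (-)e, and tests for local and colocal modules. -/

section CornerFunctor

variable {A : Type u} [Ring A] {e : A} (he : IsIdempotentElem e)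

theorem cornerFunctor_map_eq_iff {M N : ModuleCat.{u} Aᵐᵒᵖ} {f g : M ⟶ N} :
    (cornerFunctor he).map f = (cornerFunctor he).map g ↔
      ∀ m : M, op e • m = m → f.hom m = g.hom m := by
  constructor
  · intro h m hm
    have := congrArg (fun k => ((k.hom (⟨m, hm⟩ : cornerGroup he M) : cornerGroup he N) : N)) h
    exact this
  · intro h
    ext m
    exact Subtype.ext (h m.1 m.2)

instance : (cornerFunctor he).Additive where
  map_add {M N f g} := by ext m; rfl

include he in
theorem op_smul_op_smul {M : Type*} [AddCommGroup M] [Module Aᵐᵒᵖ M] (m : M) :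
    op e • op e • m = op e • m := by
  rw [smul_smul, ← op_mul, he.eq]

/-- The element `m * e` of `Me`. -/
def toCorner (M : ModuleCat.{u} Aᵐᵒᵖ) (m : M) : cornerGroup he M :=
  ⟨op e • m, op_smul_op_smul he m⟩

theorem cornerFunctor_shortExact {S : ShortComplex (ModuleCat.{u} Aᵐᵒᵖ)} (hS : S.ShortExact) :
    (S.map (cornerFunctor he)).ShortExact := by
  have hf := (ModuleCat.mono_iff_injective _).1 hS.mono_f
  have hg := (ModuleCat.epi_iff_surjective _).1 hS.epi_g
  have hE := (ShortComplex.ShortExact.moduleCat_exact_iff_function_exact _).1 hS.exact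
  refine moduleCat_shortExact _ _ ?_ ?_ ?_
  · intro x y hxy
    exact Subtype.ext (hf (congrArg Subtype.val hxy))
  · rintro ⟨z, hz⟩
    obtain ⟨y, hy⟩ := hg z
    refine ⟨toCorner he _ y, Subtype.ext ?_⟩
    refine (map_smul S.g.hom (op e) y).trans ?_
    exact (congrArg (op e • ·) hy).trans (hz.trans rfl)
  · rintro ⟨y, hy⟩
    constructor
    · intro h
      obtain ⟨x, rfl⟩ := (hE y).1 (congrArg Subtype.val h)
      refine ⟨⟨x, hf ?_⟩, rfl⟩
      rw [map_smul]
      exact hy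
    · rintro ⟨x, hx⟩
      exact Subtype.ext ((hE y).2 ⟨x.1, congrArg Subtype.val hx⟩)

theorem cornerFunctor_exact : Limits.PreservesFiniteLimits (cornerFunctor he) ∧
    Limits.PreservesFiniteColimits (cornerFunctor he) :=
  ((Functor.exact_tfae (cornerFunctor he)).out 0 3).1 fun _ => cornerFunctor_shortExact he

instance : Limits.PreservesFiniteLimits (cornerFunctor he) := (cornerFunctor_exact he).1

instance : Limits.PreservesFiniteColimits (cornerFunctor he) := (cornerFunctor_exact he).2

variable (A) in
/-- The regular right module. -/
abbrev regular : ModuleCat.{u} Aᵐᵒᵖ := ModuleCat.of Aᵐᵒᵖ A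

/-- The homomorphism `A → M` with `1 ↦ m`. -/
def fromRegular (M : ModuleCat.{u} Aᵐᵒᵖ) (m : M) : regular A ⟶ M :=
  ModuleCat.ofHom
    { toFun := fun a : A => op a • m
      map_add' := fun a b => add_smul (op a) (op b) m
      map_smul' := fun r a => by
        change op (a * r.unop) • m = r • op a • m
        rw [op_mul, op_unop, mul_smul] }

theorem fromRegular_hom_one {M : ModuleCat.{u} Aᵐᵒᵖ} (f : regular A ⟶ M) :
    fromRegular M (f.hom (1 : A)) = f := by
  ext
  change op (1 : A) • f.hom (1 : A) = f.hom (1 : A)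
  rw [op_one, one_smul]

theorem regular_hom_ext {M : ModuleCat.{u} Aᵐᵒᵖ} {f g : regular A ⟶ M}
    (h : f.hom (1 : A) = g.hom (1 : A)) : f = g := by
  rw [← fromRegular_hom_one f, h, fromRegular_hom_one]

variable {he}

theorem cornerHom_congr {M N : ModuleCat.{u} Aᵐᵒᵖ}
    (k : (cornerFunctor he).obj M ⟶ (cornerFunctor he).obj N) {x y : M}
    (hx : x ∈ cornerGroup he M) (hy : y ∈ cornerGroup he M) (h : x = y) :
    (k.hom (⟨x, hx⟩ : cornerGroup he M) : cornerGroup he N).1 =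
      (k.hom (⟨y, hy⟩ : cornerGroup he M) : cornerGroup he N).1 := by
  subst h; rfl

/-- Every element m of M is the image of 1 under a map A → M, so a map k : Me → Le can be extended
one element at a time; uniqueness of the lifts from A makes the result linear. -/
theorem HomBijective.of_regular {L : ModuleCat.{u} Aᵐᵒᵖ}
    (h : HomBijective (cornerFunctor he) (regular A) L) (M : ModuleCat.{u} Aᵐᵒᵖ) :
    HomBijective (cornerFunctor he) M L := by
  constructor
  · intro f g hfg
    ext m
    have : fromRegular M m ≫ f = fromRegular M m ≫ g := h.1 (by
      rw [Functor.map_comp, Functor.map_comp, hfg])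
    have := congrArg (fun k => k.hom (1 : A)) this
    change f.hom (op (1 : A) • m) = g.hom (op (1 : A) • m) at this
    rwa [op_one, one_smul] at this
  · intro k
    -- `l m` lifts a ↦ k(ma), defined on Ae; the desired extension of k sends m to the value of `l
    -- m` at 1.
    choose l hl using fun m : M => h.2 ((cornerFunctor he).map (fromRegular M m) ≫ k)
    have key : ∀ (m : M) (a : A) (ha : op e • a = a),
        ∃ h', (l m).hom a = (k.hom (⟨op a • m, h'⟩ : cornerGroup he M) : cornerGroup he L).1 := by
      intro m a ha
      have ha' : op e • op a • m = op a • m := by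
        rw [smul_smul, ← op_mul]; exact congrArg (fun x => op x • m) ha
      refine ⟨ha', ?_⟩
      have := congrArg (fun k => (k.hom (⟨a, ha⟩ : cornerGroup he (regular A)) :
        cornerGroup he L).1) (hl m)
      exact this
    refine ⟨ModuleCat.ofHom
      { toFun := fun m => (l m).hom (1 : A)
        map_add' := fun m n => ?_
        map_smul' := fun r m => ?_ }, ?_⟩
    · have : l (m + n) = l m + l n := by
        apply h.1
        rw [cornerFunctor_map_eq_iff]
        intro a ha
        obtain ⟨_, h1⟩ := key (m + n) a ha
        obtain ⟨h2, h2'⟩ := key m a ha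
        obtain ⟨h3, h3'⟩ := key n a ha
        change _ = (l m).hom a + (l n).hom a
        rw [h1, h2', h3']
        refine Eq.trans ?_ (congrArg Subtype.val (map_add k.hom
          (⟨op a • m, h2⟩ : cornerGroup he M) (⟨op a • n, h3⟩ : cornerGroup he M)))
        exact cornerHom_congr k _ _ (smul_add _ _ _)
      rw [this]; rfl
    · have : l (r • m) = fromRegular (regular A) r.unop ≫ l m := by
        apply h.1
        rw [cornerFunctor_map_eq_iff]
        intro a ha
        obtain ⟨_, h1⟩ := key (r • m) a ha
        have ha' : op e • (r.unop * a) = r.unop * a := by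
          change r.unop * a * e = _
          rw [mul_assoc]; exact congrArg _ ha
        obtain ⟨_, h2⟩ := key m (r.unop * a) ha'
        change _ = (l m).hom (r.unop * a)
        rw [h1, h2]
        apply cornerHom_congr
        change op a • r • m = op (r.unop * a) • m
        rw [op_mul, mul_smul, op_unop]
      rw [this]
      change (l m).hom (r.unop * 1) = r • (l m).hom (1 : A)
      rw [← map_smul]
      congr 1
      change r.unop * 1 = 1 * r.unop
      rw [one_mul, mul_one]
    · ext m
      apply Subtype.ext
      change (l m.1).hom (1 : A) = _
      -- For m in Me one has m(ea) = ma, so `l m` is unchanged by first multiplying by e on the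
      -- left. This moves the argument 1 to e, which lies in Ae, where `l m` is known.
      have : (l m.1).hom (1 : A) = (l m.1).hom e := by
        have : l m.1 = fromRegular (regular A) e ≫ l m.1 := by
          apply h.1
          rw [cornerFunctor_map_eq_iff]
          intro a ha
          obtain ⟨_, h1⟩ := key m.1 a ha
          have ha' : op e • (e * a) = e * a := by
            change e * a * e = _
            rw [mul_assoc]; exact congrArg _ ha
          obtain ⟨_, h2⟩ := key m.1 (e * a) ha'
          change _ = (l m.1).hom (e * a)
          rw [h1, h2]
          apply cornerHom_congr
          change op a • m.1 = op (e * a) • m.1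
          rw [op_mul, mul_smul, show op e • m.1 = m.1 from m.2]
        conv_lhs => rw [this]
        change (l m.1).hom (e * 1) = _
        rw [mul_one]
      rw [this]
      obtain ⟨_, h1⟩ := key m.1 e he.eq
      rw [h1]
      exact cornerHom_congr k _ _ m.2

theorem HomBijective.pi {X : ModuleCat.{u} Aᵐᵒᵖ} {J : Type u} {M : J → ModuleCat.{u} Aᵐᵒᵖ}
    (h : ∀ j, HomBijective (cornerFunctor he) X (M j)) :
    HomBijective (cornerFunctor he) X (ModuleCat.of Aᵐᵒᵖ (∀ j, M j)) := by
  set p : ∀ j, ModuleCat.of Aᵐᵒᵖ (∀ j, M j) ⟶ M j := fun j => ModuleCat.ofHom (LinearMap.proj j)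
  constructor
  · intro f g hfg
    have : ∀ j, f ≫ p j = g ≫ p j := fun j => (h j).1 (by
      rw [Functor.map_comp, Functor.map_comp, hfg])
    ext x j
    exact congrArg (fun k => k.hom x) (this j)
  · intro k
    choose l hl using fun j => (h j).2 (k ≫ (cornerFunctor he).map (p j))
    refine ⟨ModuleCat.ofHom (LinearMap.pi fun j => (l j).hom), ?_⟩
    ext x
    apply Subtype.ext
    funext j
    exact congrArg (fun f => (f.hom x : cornerGroup he (M j)).1) (hl j)

theorem HomBijective.finite_pi {X : ModuleCat.{u} Aᵐᵒᵖ} {k : ℕ} {M : ModuleCat.{u} Aᵐᵒᵖ}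
    (h : HomBijective (cornerFunctor he) X M) :
    HomBijective (cornerFunctor he) X (ModuleCat.of Aᵐᵒᵖ (Fin k → M)) := by
  have := HomBijective.pi (J := ULift.{u} (Fin k)) (M := fun _ => M) fun _ => h
  refine this.retract (ModuleCat.ofHom (LinearMap.pi fun j => LinearMap.proj j.down))
    (ModuleCat.ofHom (LinearMap.pi fun j => LinearMap.proj (ULift.up j))) ?_
  rfl

/-- The homomorphisms `L → Q` separate the elements of `L`, for every `L`. -/
def IsCogenerator (Q : ModuleCat.{u} Aᵐᵒᵖ) : Prop :=
  ∀ (L : ModuleCat.{u} Aᵐᵒᵖ) (l : L), (∀ f : L ⟶ Q, f.hom l = 0) → l = 0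

/-- L is the kernel of a map between products of copies of Q: embed L in such a product, then embed
the cokernel in another. -/
theorem HomBijective.of_cogenerator {Q : ModuleCat.{u} Aᵐᵒᵖ} (hQ : IsCogenerator Q)
    {M : ModuleCat.{u} Aᵐᵒᵖ} (h : HomBijective (cornerFunctor he) M Q) (L : ModuleCat.{u} Aᵐᵒᵖ) :
    HomBijective (cornerFunctor he) M L := by
  have emb (L : ModuleCat.{u} Aᵐᵒᵖ) : Function.Injective
      (LinearMap.pi (fun f : L ⟶ Q => f.hom) : L →ₗ[Aᵐᵒᵖ] ((L ⟶ Q) → Q)) := by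
    rw [← LinearMap.ker_eq_bot, LinearMap.ker_eq_bot']
    exact fun l hl => hQ L l fun f => congrFun hl f
  set i : L ⟶ ModuleCat.of Aᵐᵒᵖ ((L ⟶ Q) → Q) :=
    ModuleCat.ofHom (LinearMap.pi (fun f : L ⟶ Q => f.hom)) with hi
  let N := ModuleCat.of Aᵐᵒᵖ (((L ⟶ Q) → Q) ⧸ LinearMap.range i.hom)
  let j : N ⟶ ModuleCat.of Aᵐᵒᵖ ((N ⟶ Q) → Q) :=
    ModuleCat.ofHom (LinearMap.pi (fun f : N ⟶ Q => f.hom))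
  let q : ModuleCat.of Aᵐᵒᵖ ((L ⟶ Q) → Q) ⟶ N :=
    ModuleCat.ofHom (LinearMap.range i.hom).mkQ
  have hE : Function.Exact i.hom (q ≫ j).hom := by
    intro x
    change j.hom (q.hom x) = 0 ↔ _
    refine (map_eq_zero_iff j.hom (emb N)).trans ?_
    exact Submodule.Quotient.mk_eq_zero _
  have hz : i ≫ q ≫ j = 0 := by
    ext x : 2
    exact hE.apply_apply_eq_zero x
  have : Mono i := (ModuleCat.mono_iff_injective i).2 (emb L)
  exact HomBijective.kernel (S := ShortComplex.mk i (q ≫ j) hz)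
    ((ShortComplex.ShortExact.moduleCat_exact_iff_function_exact _).2 hE)
    (HomBijective.pi fun _ => h) (HomBijective.pi fun _ => h)

end CornerFunctor

/-! ### Gendo-symmetry expressed as a trace form. -/

section TraceForm

variable (K : Type u) {A : Type u} [Field K] [Ring A] [Algebra K A] {e : A}

/-- A linear form on `A`, symmetric on `eAe`, for which `(y, z) ↦ tr (y * z)` is a perfect pairing
between `eA` and `Ae`. -/
structure TraceForm (_ : IsIdempotentElem e) where
  tr : A →ₗ[K] K
  comm : ∀ b c, e * b = b → b * e = b → e * c = c → c * e = c → tr (b * c) = tr (c * b)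
  rep : ∀ f : A →ₗ[K] K, ∃ y, e * y = y ∧ ∀ z, z * e = z → tr (y * z) = f z
  nondeg : ∀ y, e * y = y → (∀ z, z * e = z → tr (y * z) = 0) → y = 0

variable {K} {he : IsIdempotentElem e}

/-- The pairing of a trace form. -/
def TraceForm.pairing (t : TraceForm K he) : eA he →ₗ[K] Ae he →ₗ[K] K :=
  LinearMap.mk₂ K (fun y z => t.tr (y.1 * z.1))
    (fun y y' z => by rw [← map_add, ← add_mul]; rfl)
    (fun k y z => by
      rw [← map_smul, ← smul_mul_assoc]; rfl)
    (fun y z z' => by rw [← map_add, ← mul_add]; rfl)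
    (fun k y z => by rw [← map_smul, ← mul_smul_comm]; rfl)

/-- Right multiplication by `e`, as a map onto `Ae`. -/
def mulRightAe (K : Type u) [Field K] [Algebra K A] (he : IsIdempotentElem e) : A →ₗ[K] Ae he where
  toFun a := ⟨a * e, by change a * e * e = a * e; rw [mul_assoc, he.eq]⟩
  map_add' a b := Subtype.ext (add_mul a b e)
  map_smul' k a := Subtype.ext (smul_mul_assoc k a e)

theorem TraceForm.pairing_bijective (t : TraceForm K he) : Function.Bijective t.pairing := by
  constructor
  · rw [injective_iff_map_eq_zero]
    intro y hy
    exact Subtype.ext (t.nondeg y.1 y.2 fun z hz => LinearMap.congr_fun hy (⟨z, hz⟩ : Ae he))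
  · intro f
    obtain ⟨y, hy, h⟩ := t.rep (f ∘ₗ mulRightAe K he)
    refine ⟨⟨y, hy⟩, LinearMap.ext fun z => ?_⟩
    change t.tr (y * z.1) = _
    rw [h z.1 z.2]
    exact congrArg f (Subtype.ext z.2)

/-- Over a field, a pairing of finite-dimensional spaces that is perfect on one side is perfect on
the other. -/
theorem TraceForm.flip_bijective [Module.Finite K A] (t : TraceForm K he) :
    Function.Bijective t.pairing.flip := by
  have := Module.Finite.of_injective (⟨⟨Subtype.val, fun _ _ => rfl⟩, fun _ _ => rfl⟩ :
    Ae he →ₗ[K] A) Subtype.val_injective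
  have := Module.Finite.of_injective (⟨⟨Subtype.val, fun _ _ => rfl⟩, fun _ _ => rfl⟩ :
    eA he →ₗ[K] A) Subtype.val_injective
  have : t.pairing.IsPerfPair := .of_bijective _ t.pairing_bijective
  exact LinearMap.IsPerfPair.bijective_right t.pairing

theorem TraceForm.rep_right [Module.Finite K A] (t : TraceForm K he) (f : A →ₗ[K] K) :
    ∃ z, z * e = z ∧ ∀ y, e * y = y → t.tr (y * z) = f y := by
  obtain ⟨z, hz⟩ := t.flip_bijective.2 (f ∘ₗ ⟨⟨Subtype.val, fun _ _ => rfl⟩, fun _ _ => rfl⟩)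
  exact ⟨z.1, z.2, fun y hy => LinearMap.congr_fun hz (⟨y, hy⟩ : eA he)⟩

theorem TraceForm.nondeg_right [Module.Finite K A] (t : TraceForm K he) (z : A) (hz : z * e = z)
    (h : ∀ y, e * y = y → t.tr (y * z) = 0) : z = 0 := by
  have : (⟨z, hz⟩ : Ae he) = 0 := t.flip_bijective.1 (by
    rw [map_zero]
    exact LinearMap.ext fun y => h y.1 y.2)
  exact congrArg Subtype.val this

/-- The trace form `a ↦ β (e, a * e)` of a bimodule isomorphism `β : eA ≅ D(Ae)`. -/
def BimoduleIso.traceForm (β : BimoduleIso K he) : TraceForm K he where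
  tr := β.toEquiv ⟨e, he.eq⟩ ∘ₗ mulRightAe K he
  comm b c hb hb' hc hc' := by
    have key : ∀ (y z : A) (hy : e * y = y) (hz : z * e = z), β.toEquiv ⟨e, he.eq⟩
        (mulRightAe K he (y * z)) = β.toEquiv ⟨y, hy⟩ ⟨z, hz⟩ := by
      intro y z hy hz
      have h := β.map_right ⟨e, he.eq⟩ y ⟨z, hz⟩
      have h1 : (op y • (⟨e, he.eq⟩ : eA he)) = ⟨y, hy⟩ := Subtype.ext hy
      rw [h1] at h
      rw [h]
      congr 1
      apply Subtype.ext
      change y * z * e = y * z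
      rw [mul_assoc, hz]
    change β.toEquiv _ (mulRightAe K he (b * c)) = β.toEquiv _ (mulRightAe K he (c * b))
    rw [key b c hb hc']
    -- Left eAe-linearity moves b from the first argument of β to the right of c in the second; this
    -- is the symmetry of the form on eAe.
    let b' : he.Corner := ⟨b, (Subsemigroup.mem_corner_iff he).2 ⟨hb, hb'⟩⟩
    have h := β.map_left b' ⟨e, he.eq⟩ ⟨c, hc'⟩
    have h1 : b' • (⟨e, he.eq⟩ : eA he) = ⟨b, hb⟩ := Subtype.ext hb'
    rw [h1] at h
    rw [h]
    congr 1
    apply Subtype.ext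
    change c * b = c * b * e
    rw [mul_assoc, hb']
  rep f := by
    obtain ⟨y, hy⟩ := β.toEquiv.surjective (f ∘ₗ ⟨⟨Subtype.val, fun _ _ => rfl⟩, fun _ _ => rfl⟩)
    refine ⟨y.1, y.2, fun z hz => ?_⟩
    have h := β.map_right ⟨e, he.eq⟩ y.1 ⟨z, hz⟩
    have h1 : (op y.1 • (⟨e, he.eq⟩ : eA he)) = y := Subtype.ext y.2
    rw [h1, hy] at h
    refine Eq.trans ?_ h.symm
    change β.toEquiv _ (mulRightAe K he (y.1 * z)) = _
    congr 1
    apply Subtype.ext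
    change y.1 * z * e = y.1 * z
    rw [mul_assoc, hz]
  nondeg y hy h := by
    have : (⟨y, hy⟩ : eA he) = 0 := β.toEquiv.injective (by
      rw [map_zero]
      ext z
      have h0 := β.map_right ⟨e, he.eq⟩ y z
      have h1 : (op y • (⟨e, he.eq⟩ : eA he)) = ⟨y, hy⟩ := Subtype.ext hy
      rw [h1] at h0
      rw [h0]
      refine Eq.trans ?_ (h z.1 z.2)
      change _ = β.toEquiv _ (mulRightAe K he (y * z.1))
      congr 1
      apply Subtype.ext
      change y * z.1 = y * z.1 * e
      rw [mul_assoc, show z.1 * e = z.1 from z.2])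
    exact congrArg Subtype.val this

/-- Transport of a trace form along an isomorphism `eA ≅ e'A` given by `u ∈ eAe'`, `v ∈ e'Ae`. -/
def TraceForm.conj {e' : A} {he' : IsIdempotentElem e'} (t : TraceForm K he') (u v : A)
    (hu : e * u = u) (hu' : u * e' = u) (hv : e' * v = v) (hv' : v * e = v) (huv : u * v = e)
    (hvu : v * u = e') : TraceForm K he where
  tr := t.tr ∘ₗ LinearMap.mulLeft K v ∘ₗ LinearMap.mulRight K u
  comm b c hb hb' hc hc' := by
    change t.tr (v * (b * c * u)) = t.tr (v * (c * b * u))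
    have h1 : v * (b * c * u) = (v * b * u) * (v * c * u) := by
      calc v * (b * c * u) = v * ((b * e) * c * u) := by rw [hb']
        _ = _ := by rw [← huv]; simp only [mul_assoc]
    have h2 : v * (c * b * u) = (v * c * u) * (v * b * u) := by
      calc v * (c * b * u) = v * ((c * e) * b * u) := by rw [hc']
        _ = _ := by rw [← huv]; simp only [mul_assoc]
    rw [h1, h2]
    apply t.comm
    · rw [mul_assoc, ← mul_assoc e', hv]
    · rw [mul_assoc _ u, hu']
    · rw [mul_assoc, ← mul_assoc e', hv]
    · rw [mul_assoc _ u, hu']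
  rep f := by
    obtain ⟨y, hy, h⟩ := t.rep (f ∘ₗ LinearMap.mulRight K v)
    refine ⟨u * y, by rw [← mul_assoc, hu], fun z hz => ?_⟩
    change t.tr (v * (u * y * z * u)) = _
    have : v * (u * y * z * u) = y * (z * u) := by
      rw [mul_assoc u, mul_assoc u, ← mul_assoc v, hvu, ← mul_assoc, ← mul_assoc, hy, mul_assoc]
    rw [this, h _ (by rw [mul_assoc, hu'])]
    change f (z * u * v) = _
    rw [mul_assoc, huv, hz]
  nondeg y hy h := by
    have : v * y = 0 := by
      refine t.nondeg _ (by rw [← mul_assoc, hv]) fun z hz => ?_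
      have := h (z * v) (by rw [mul_assoc, hv'])
      change t.tr (v * (y * (z * v) * u)) = 0 at this
      rw [mul_assoc y, mul_assoc z, hvu, hz, ← mul_assoc] at this
      exact this
    rw [← hy, ← huv, mul_assoc, this, mul_zero]

/-- Each of eA and e'A is a summand of the other, so by dimension they are isomorphic. The
isomorphism is left multiplication by v, the image of e, and its inverse is left multiplication by
u. -/
theorem exists_conj_of_minimal [Module.Finite K A] {e' : A} {he' : IsIdempotentElem e'}
    (h : IsMinimalFaithfulProjInj (ModuleCat.of Aᵐᵒᵖ (eA he)))
    (h' : IsMinimalFaithfulProjInj (ModuleCat.of Aᵐᵒᵖ (eA he'))) :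
    ∃ u v : A, e * u = u ∧ u * e' = u ∧ e' * v = v ∧ v * e = v ∧ u * v = e ∧ v * u = e' := by
  have hf : ∀ {e : A} (he : IsIdempotentElem e), Module.Finite K (eA he) := fun he =>
    Module.Finite.of_injective (⟨⟨Subtype.val, fun _ _ => rfl⟩, fun _ _ => rfl⟩ :
      eA he →ₗ[K] A) Subtype.val_injective
  have := hf he
  have := hf he'
  obtain ⟨i, p, hi⟩ := h.minimal _ h'.finite h'.faithful
  obtain ⟨i', p', hi'⟩ := h'.minimal _ h.finite h.faithful
  change eA he →ₗ[Aᵐᵒᵖ] eA he' at i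
  change eA he' →ₗ[Aᵐᵒᵖ] eA he at i'
  have inj : Function.Injective i := Function.LeftInverse.injective (LinearMap.congr_fun hi)
  have inj' : Function.Injective i' := Function.LeftInverse.injective (LinearMap.congr_fun hi')
  have e1 := LinearMap.finrank_le_finrank_of_injective (f := i.restrictScalars K) inj
  have e2 := LinearMap.finrank_le_finrank_of_injective (f := i'.restrictScalars K) inj'
  have hs : Function.Surjective i :=
    (LinearMap.injective_iff_surjective_of_finrank_eq_finrank (f := i.restrictScalars K)
      (le_antisymm e1 e2)).1 inj
  let φ := LinearEquiv.ofBijective i ⟨inj, hs⟩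
  have key (x : eA he) : (φ x).1 = (φ ⟨e, he.eq⟩).1 * x.1 := by
    have : x = op x.1 • (⟨e, he.eq⟩ : eA he) := Subtype.ext x.2.symm
    conv_lhs => rw [this, map_smul]
    rfl
  have key' (x : eA he') : (φ.symm x).1 = (φ.symm ⟨e', he'.eq⟩).1 * x.1 := by
    have : x = op x.1 • (⟨e', he'.eq⟩ : eA he') := Subtype.ext x.2.symm
    conv_lhs => rw [this, map_smul]
    rfl
  refine ⟨(φ.symm ⟨e', he'.eq⟩).1, (φ ⟨e, he.eq⟩).1, (φ.symm ⟨e', he'.eq⟩).2, ?_,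
    (φ ⟨e, he.eq⟩).2, ?_, ?_, ?_⟩
  · exact (key' ⟨e', he'.eq⟩).symm
  · exact (key ⟨e, he.eq⟩).symm
  · rw [← key', φ.symm_apply_apply]
  · rw [← key, φ.apply_symm_apply]

/-- Gendo-symmetry provides a bimodule isomorphism for some idempotent, not necessarily for the
given e; conjugation transports its trace form to e. -/
theorem exists_traceForm [Module.Finite K A] (hA : IsGendoSymmetric K A)
    (h : IsMinimalFaithfulProjInj (ModuleCat.of Aᵐᵒᵖ (eA he))) : Nonempty (TraceForm K he) := by
  obtain ⟨-, e', he', h', ⟨β⟩⟩ := hA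
  obtain ⟨u, v, h1, h2, h3, h4, h5, h6⟩ := exists_conj_of_minimal (K := K) h h'
  exact ⟨β.traceForm.conj u v h1 h2 h3 h4 h5 h6⟩

end TraceForm

/-! ### The duality D between left and right modules. -/

section Duality

open scoped ModuleCat

variable (K : Type u) {A : Type u} [Field K] [Ring A] [Algebra K A]

/-- The linear form underlying an element of `D(N)`, for a left module `N`. -/
def formL {N : ModuleCat.{u} A} (q : dualOfLeft K A N) : N →ₗ[K] K := q

/-- A linear form on a left module `N` as an element of `D(N)`. -/
def ofFormL {N : ModuleCat.{u} A} (q : N →ₗ[K] K) : dualOfLeft K A N := q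

/-- The linear form underlying an element of `D(M)`, for a right module `M`. -/
def formR {M : ModuleCat.{u} Aᵐᵒᵖ} (q : dualOfRight K A M) : M →ₗ[K] K := q

/-- A linear form on a right module `M` as an element of `D(M)`. -/
def ofFormR {M : ModuleCat.{u} Aᵐᵒᵖ} (q : M →ₗ[K] K) : dualOfRight K A M := q

variable {K}

theorem formL_ext {N : ModuleCat.{u} A} {q q' : dualOfLeft K A N}
    (h : ∀ n, formL K q n = formL K q' n) : q = q' := LinearMap.ext h

theorem formR_ext {M : ModuleCat.{u} Aᵐᵒᵖ} {q q' : dualOfRight K A M}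
    (h : ∀ n, formR K q n = formR K q' n) : q = q' := LinearMap.ext h

theorem formL_smul {N : ModuleCat.{u} A} (a : Aᵐᵒᵖ) (q : dualOfLeft K A N) (n : N) :
    formL K (a • q) n = formL K q (a.unop • n) := rfl

theorem formR_smul {M : ModuleCat.{u} Aᵐᵒᵖ} (a : A) (q : dualOfRight K A M) (m : M) :
    formR K (a • q) m = formR K q (op a • m) := rfl

theorem formL_smul_field {N : ModuleCat.{u} A} (k : K) (q : dualOfLeft K A N) (n : N) :
    formL K (k • q) n = k * formL K q n := by
  rw [← algebraMap_smul Aᵐᵒᵖ k q, formL_smul]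
  refine Eq.trans ?_ ((formL K q).map_smul k n)
  congr 1

theorem formR_smul_field {M : ModuleCat.{u} Aᵐᵒᵖ} (k : K) (q : dualOfRight K A M) (m : M) :
    formR K (k • q) m = k * formR K q m := by
  rw [← algebraMap_smul A k q, formR_smul]
  refine Eq.trans ?_ ((formR K q).map_smul k m)
  congr 1

/-- The adjunction `Hom(M, D(N)) → Hom(N, D(M))`. -/
def flipL {M : ModuleCat.{u} Aᵐᵒᵖ} {N : ModuleCat.{u} A} (g : M ⟶ dualOfLeft K A N) :
    N ⟶ dualOfRight K A M :=
  ModuleCat.ofHom (Y := dualOfRight K A M)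
    { toFun := fun n => ofFormR K
        { toFun := fun m => formL K (g.hom m) n
          map_add' := fun m m' => by rw [map_add]; rfl
          map_smul' := fun k m => by
            rw [← algebraMap_smul Aᵐᵒᵖ k m, map_smul, algebraMap_smul, formL_smul_field]; rfl }
      map_add' := fun n n' => formR_ext fun m => (formL K (g.hom m)).map_add n n'
      map_smul' := fun a n => formR_ext fun m => by
        change formL K (g.hom m) (a • n) = formL K (g.hom (op a • m)) n
        rw [map_smul g.hom, formL_smul]; rfl }

/-- The adjunction `Hom(N, D(M)) → Hom(M, D(N))`. -/
def flipR {M : ModuleCat.{u} Aᵐᵒᵖ} {N : ModuleCat.{u} A} (g : N ⟶ dualOfRight K A M) :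
    M ⟶ dualOfLeft K A N :=
  ModuleCat.ofHom (Y := dualOfLeft K A N)
    { toFun := fun m => ofFormL K
        { toFun := fun n => formR K (g.hom n) m
          map_add' := fun n n' => by rw [map_add]; rfl
          map_smul' := fun k n => by
            rw [← algebraMap_smul A k n, map_smul, algebraMap_smul, formR_smul_field]; rfl }
      map_add' := fun m m' => formL_ext fun n => (formR K (g.hom n)).map_add m m'
      map_smul' := fun a m => formL_ext fun n => by
        change formR K (g.hom n) (a • m) = formR K (g.hom (a.unop • n)) m
        rw [map_smul g.hom, formR_smul]; rfl }

variable (K) in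
/-- `D(f)` for a homomorphism `f` of left modules. -/
def dualMapL {N N' : ModuleCat.{u} A} (f : N ⟶ N') : dualOfLeft K A N' ⟶ dualOfLeft K A N :=
  ModuleCat.ofHom (X := dualOfLeft K A N') (Y := dualOfLeft K A N)
    { toFun := fun q => ofFormL K
        { toFun := fun n => formL K q (f.hom n)
          map_add' := fun n n' => by rw [map_add, map_add]
          map_smul' := fun k n => by
            rw [← algebraMap_smul A k n, map_smul, algebraMap_smul, map_smul]; rfl }
      map_add' := fun q q' => rfl
      map_smul' := fun a q => formL_ext fun n => by
        change formL K q (a.unop • f.hom n) = formL K q (f.hom (a.unop • n))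
        rw [map_smul f.hom] }

variable (K) in
/-- `D(f)` for a homomorphism `f` of right modules. -/
def dualMapR {M M' : ModuleCat.{u} Aᵐᵒᵖ} (f : M ⟶ M') : dualOfRight K A M' ⟶ dualOfRight K A M :=
  ModuleCat.ofHom (X := dualOfRight K A M') (Y := dualOfRight K A M)
    { toFun := fun q => ofFormR K
        { toFun := fun n => formR K q (f.hom n)
          map_add' := fun n n' => by rw [map_add, map_add]
          map_smul' := fun k n => by
            rw [← algebraMap_smul Aᵐᵒᵖ k n, map_smul, algebraMap_smul, map_smul]; rfl }
      map_add' := fun q q' => rfl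
      map_smul' := fun a q => formR_ext fun n => by
        change formR K q (op a • f.hom n) = formR K q (f.hom (op a • n))
        rw [map_smul f.hom] }

section LinearForms

variable {V V' V'' : Type*} [AddCommGroup V] [AddCommGroup V'] [AddCommGroup V''] [Module K V]
  [Module K V'] [Module K V'']

theorem exists_form_extension (f : V →ₗ[K] V') (hf : Function.Injective f) (q : V →ₗ[K] K) :
    ∃ q' : V' →ₗ[K] K, ∀ v, q' (f v) = q v := by
  obtain ⟨g, hg⟩ := LinearMap.exists_leftInverse_of_injective f (LinearMap.ker_eq_bot.2 hf)
  exact ⟨q ∘ₗ g, fun v => congrArg q (LinearMap.congr_fun hg v)⟩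

theorem exists_form_factor (f : V →ₗ[K] V') (g : V' →ₗ[K] V'') (hE : Function.Exact f g)
    (hg : Function.Surjective g) (q : V' →ₗ[K] K) (hq : ∀ v, q (f v) = 0) :
    ∃ q' : V'' →ₗ[K] K, ∀ v, q' (g v) = q v := by
  obtain ⟨s, hs⟩ := LinearMap.exists_rightInverse_of_surjective g (LinearMap.range_eq_top.2 hg)
  refine ⟨q ∘ₗ s, fun v => ?_⟩
  have h1 : g (s (g v) - v) = 0 := by
    rw [map_sub, sub_eq_zero]; exact LinearMap.congr_fun hs (g v)
  obtain ⟨w, hw⟩ := (hE _).1 h1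
  have := hq w
  rw [hw, map_sub, sub_eq_zero] at this
  exact this

end LinearForms

variable (K) in
/-- A homomorphism of modules over a `K`-algebra as a `K`-linear map. -/
def restrictHom {R : Type u} [Ring R] [Algebra K R] {M N : ModuleCat.{u} R} (f : M ⟶ N) :
    M →ₗ[K] N where
  toFun := f.hom
  map_add' := map_add f.hom
  map_smul' k m := by
    rw [← algebraMap_smul R k m, map_smul, algebraMap_smul]; rfl

variable (K) in
theorem dualMapL_shortExact {S : ShortComplex (ModuleCat.{u} A)} (hS : S.ShortExact) :
    (ShortComplex.mk (dualMapL K S.g) (dualMapL K S.f) (by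
      ext q
      exact formL_ext fun n => by
        change formL K q (S.g.hom (S.f.hom n)) = 0
        rw [← LinearMap.comp_apply, ← ModuleCat.hom_comp, S.zero]
        exact (formL K q).map_zero)).ShortExact := by
  have hf := (ModuleCat.mono_iff_injective _).1 hS.mono_f
  have hg := (ModuleCat.epi_iff_surjective _).1 hS.epi_g
  have hE := (ShortComplex.ShortExact.moduleCat_exact_iff_function_exact _).1 hS.exact
  refine moduleCat_shortExact _ _ ?_ ?_ ?_
  · intro q q' h
    refine formL_ext fun n => ?_
    obtain ⟨x, rfl⟩ := hg n
    exact congrArg (fun r => formL K r x) h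
  · intro q
    obtain ⟨q', hq'⟩ := exists_form_extension (restrictHom K S.f) hf (formL K q)
    exact ⟨ofFormL K q', formL_ext hq'⟩
  · intro q
    constructor
    · intro h
      obtain ⟨q', hq'⟩ := exists_form_factor (restrictHom K S.f) (restrictHom K S.g) hE hg
        (formL K q) fun v => congrArg (fun r => formL K r v) h
      exact ⟨ofFormL K q', formL_ext hq'⟩
    · rintro ⟨q', rfl⟩
      refine formL_ext fun n => ?_
      change formL K q' (S.g.hom (S.f.hom n)) = 0
      rw [← LinearMap.comp_apply, ← ModuleCat.hom_comp, S.zero]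
      exact (formL K q').map_zero

variable (K) in
theorem dualMapR_shortExact {S : ShortComplex (ModuleCat.{u} Aᵐᵒᵖ)} (hS : S.ShortExact) :
    (ShortComplex.mk (dualMapR K S.g) (dualMapR K S.f) (by
      ext q
      exact formR_ext fun n => by
        change formR K q (S.g.hom (S.f.hom n)) = 0
        rw [← LinearMap.comp_apply, ← ModuleCat.hom_comp, S.zero]
        exact (formR K q).map_zero)).ShortExact := by
  have hf := (ModuleCat.mono_iff_injective _).1 hS.mono_f
  have hg := (ModuleCat.epi_iff_surjective _).1 hS.epi_g
  have hE := (ShortComplex.ShortExact.moduleCat_exact_iff_function_exact _).1 hS.exact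
  refine moduleCat_shortExact _ _ ?_ ?_ ?_
  · intro q q' h
    refine formR_ext fun n => ?_
    obtain ⟨x, rfl⟩ := hg n
    exact congrArg (fun r => formR K r x) h
  · intro q
    obtain ⟨q', hq'⟩ := exists_form_extension (restrictHom K S.f) hf (formR K q)
    exact ⟨ofFormR K q', formR_ext hq'⟩
  · intro q
    constructor
    · intro h
      obtain ⟨q', hq'⟩ := exists_form_factor (restrictHom K S.f) (restrictHom K S.g) hE hg
        (formR K q) fun v => congrArg (fun r => formR K r v) h
      exact ⟨ofFormR K q', formR_ext hq'⟩
    · rintro ⟨q', rfl⟩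
      refine formR_ext fun n => ?_
      change formR K q' (S.g.hom (S.f.hom n)) = 0
      rw [← LinearMap.comp_apply, ← ModuleCat.hom_comp, S.zero]
      exact (formR K q').map_zero

variable (K) in
-- By the adjunction Hom(M, D(N)) ≅ Hom(N, D(M)), extending along a monomorphism f becomes lifting
-- along the epimorphism D(f).
theorem injective_dualOfLeft (N : ModuleCat.{u} A) [Projective N] :
    Injective (dualOfLeft K A N) where
  factors {X Y} g f hf := by
    have hf' := (ModuleCat.mono_iff_injective f).1 hf
    have : Epi (dualMapR K f) := by
      rw [ModuleCat.epi_iff_surjective]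
      intro q
      obtain ⟨q', hq'⟩ := exists_form_extension (restrictHom K f) hf' (formR K q)
      exact ⟨ofFormR K q', formR_ext hq'⟩
    refine ⟨flipR (Projective.factorThru (flipL g) (dualMapR K f)), ?_⟩
    ext x
    refine formL_ext fun n => ?_
    have := congrArg (fun k => formR K (k.hom n) x)
      (Projective.factorThru_comp (flipL g) (dualMapR K f))
    exact this

theorem finite_of_finite {R : Type u} [Ring R] [Algebra K R] [Module.Finite K R]
    (M : ModuleCat.{u} R) [Module.Finite R M] : Module.Finite K M :=
  Module.Finite.trans R M

variable (K) in
theorem finite_dualOfRight [Module.Finite K A] (M : ModuleCat.{u} Aᵐᵒᵖ) [Module.Finite Aᵐᵒᵖ M] :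
    Module.Finite A (dualOfRight K A M) := by
  have : Module.Finite K M := finite_of_finite M
  have : Module.Finite K (dualOfRight K A M) := by
    refine Module.Finite.of_surjective (M := M →ₗ[K] K)
      (⟨⟨ofFormR K, fun _ _ => rfl⟩, fun k q => formR_ext fun m => ?_⟩ :
        (M →ₗ[K] K) →ₗ[K] dualOfRight K A M) (fun q => ⟨formR K q, rfl⟩)
    exact (formR_smul_field k (ofFormR K q) m).symm
  exact Module.Finite.of_restrictScalars_finite K A _

variable (K) in
/-- `M ≅ D(D(M))` for finitely generated `M`. -/
theorem nonempty_biduality [Module.Finite K A] (M : ModuleCat.{u} Aᵐᵒᵖ) [Module.Finite Aᵐᵒᵖ M] :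
    Nonempty (M ≅ dualOfLeft K A (dualOfRight K A M)) := by
  have : Module.Finite K M := finite_of_finite M
  have hb : Function.Bijective (flipR (𝟙 (dualOfRight K A M))).hom := by
    constructor
    · rw [injective_iff_map_eq_zero]
      intro m hm
      rw [← Module.forall_dual_apply_eq_zero_iff K]
      intro f
      exact congrArg (fun r => formL K r (ofFormR K f)) hm
    · intro q
      let q' : Module.Dual K (Module.Dual K M) :=
        { toFun := fun f => formL K q (ofFormR K f)
          map_add' := fun f f' => (formL K q).map_add _ _
          map_smul' := fun k f => by
            refine Eq.trans ?_ ((formL K q).map_smul k (ofFormR K f))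
            congr 1
            exact formR_ext fun m => (formR_smul_field k (ofFormR K f) m).symm }
      refine ⟨(Module.evalEquiv K M).symm q', formL_ext fun f => ?_⟩
      change formR K f ((Module.evalEquiv K M).symm q') = _
      exact Module.apply_evalEquiv_symm_apply (R := K) (M := M) (formR K f) q'
  exact ⟨(LinearEquiv.ofBijective _ hb).toModuleIso⟩

variable (K A) in
/-- The right module `D(A)`. -/
abbrev regularDual : ModuleCat.{u} Aᵐᵒᵖ := dualOfLeft K A (ModuleCat.of A A)

/-- A map D(T) → D(N) assigns to each n an element of T** = T. Only T has to be finite; N may be a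
large projective, as in `extVanish_dual_iff`. -/
theorem dualMapL_bijective [Module.Finite K A] (N T : ModuleCat.{u} A)
    [Module.Finite A T] : Function.Bijective (dualMapL K : (N ⟶ T) → _) := by
  have : Module.Finite K T := finite_of_finite T
  constructor
  · intro f g h
    ext n
    rw [← sub_eq_zero, ← Module.forall_dual_apply_eq_zero_iff K (V := T)]
    intro q
    rw [map_sub, sub_eq_zero]
    exact congrArg (fun k => formL K (k.hom (ofFormL K q)) n) h
  · intro g
    let Φ (n : N) : Module.Dual K (Module.Dual K T) :=
      { toFun := fun f => formL K (g.hom (ofFormL K f)) n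
        map_add' := fun f f' => congrArg (fun r => formL K r n)
          (map_add g.hom (ofFormL K f) (ofFormL K f'))
        map_smul' := fun k f => by
          refine Eq.trans ?_ (formL_smul_field k (g.hom (ofFormL K f)) n)
          congr 1
          rw [← algebraMap_smul Aᵐᵒᵖ k (g.hom (ofFormL K f)), ← map_smul, algebraMap_smul]
          congr 2
          exact formL_ext fun m => (formL_smul_field k (ofFormL K f) m).symm }
    let h (n : N) : T := (Module.evalEquiv K T).symm (Φ n)
    have key (n : N) (f : Module.Dual K T) :
        f (h n) = formL K (g.hom (ofFormL K f)) n :=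
      Module.apply_evalEquiv_symm_apply (R := K) (M := T) f (Φ n)
    refine ⟨ModuleCat.ofHom
      { toFun := h
        map_add' := fun n n' => ?_
        map_smul' := fun a n => ?_ }, ?_⟩
    · rw [← sub_eq_zero, ← Module.forall_dual_apply_eq_zero_iff K (V := T)]
      intro f
      rw [map_sub, map_add, key, key, key, map_add, sub_self]
    · rw [← sub_eq_zero, ← Module.forall_dual_apply_eq_zero_iff K (V := T)]
      intro f
      rw [map_sub, key, RingHom.id_apply]
      have h1 : f (a • h n) = formL K (op a • ofFormL K f) (h n) := rfl
      have h2 := key n (formL K (op a • ofFormL K f))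
      rw [h1, h2, sub_eq_zero]
      change formL K (op a • g.hom (ofFormL K f)) n = _
      rw [← map_smul]
      rfl
    · ext q
      exact formL_ext fun n => key n (formL K q)

/-- D turns a projective presentation of N into an injective copresentation of D(N), and extension
problems to A into lifting problems from D(A); both sides shift together. -/
theorem extVanish_dual_iff [Module.Finite K A] (N : ModuleCat.{u} A) :
    ExtVanish (regularDual K A) (dualOfLeft K A N) ↔ ExtVanish N (ModuleCat.of A A) := by
  simp only [extVanish_iff]
  refine forall_congr' fun n => ?_
  induction n generalizing N with
  | zero => exact iff_of_true (extVanishUpTo_zero _ _) (extVanishUpTo_zero _ _)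
  | succ n ih =>
    let p : Projective.over N ⟶ N := Projective.π N
    have hS : (ShortComplex.mk (Limits.kernel.ι p) p (Limits.kernel.condition p)).ShortExact :=
      { exact := ShortComplex.exact_kernel p }
    set S := ShortComplex.mk (Limits.kernel.ι p) p (Limits.kernel.condition p)
    have : Projective S.X₂ := inferInstanceAs (Projective (Projective.over N))
    have := injective_dualOfLeft K S.X₂
    rw [show N = S.X₃ from rfl, extVanishUpTo_succ_left hS (extVanish_of_projective S.X₂ _)]
    refine (extVanishUpTo_succ_right (dualMapL_shortExact K hS)
      (extVanish_of_injective _ (dualOfLeft K A S.X₂)) n).trans ?_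
    refine and_congr ?_ (ih _)
    constructor
    · intro h f
      obtain ⟨g, hg⟩ := h (dualMapL K f)
      obtain ⟨g, rfl⟩ := (dualMapL_bijective _ (ModuleCat.of A A)).2 g
      exact ⟨g, (dualMapL_bijective _ (ModuleCat.of A A)).1 hg⟩
    · intro h f
      obtain ⟨f, rfl⟩ := (dualMapL_bijective _ (ModuleCat.of A A)).2 f
      obtain ⟨g, rfl⟩ := h f
      exact ⟨dualMapL K g, rfl⟩

end Duality

/-! ### Morphisms Me → Ne as functions on M. -/

section CornerHom

variable {A : Type u} [Ring A] {e : A} {he : IsIdempotentElem e}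

/-- An element of `eAe` as an element of the corner ring. -/
def mkCorner (he : IsIdempotentElem e) (b : A) (h : e * b = b) (h' : b * e = b) : he.Corner :=
  ⟨b, (Subsemigroup.mem_corner_iff he).2 ⟨h, h'⟩⟩

/-- The map `M → N` with `m ↦ k (m * e)`. -/
def cornerHomFun {M N : ModuleCat.{u} Aᵐᵒᵖ}
    (k : (cornerFunctor he).obj M ⟶ (cornerFunctor he).obj N) (m : M) : N :=
  (k.hom (toCorner he M m) : cornerGroup he N).1

section

variable {M N : ModuleCat.{u} Aᵐᵒᵖ} (k : (cornerFunctor he).obj M ⟶ (cornerFunctor he).obj N)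

theorem cornerHomFun_coe (m : cornerGroup he M) :
    cornerHomFun k m.1 = (k.hom m : cornerGroup he N).1 :=
  cornerHom_congr k _ _ m.2

theorem cornerHomFun_mem (m : M) : op e • cornerHomFun k m = cornerHomFun k m :=
  (k.hom (toCorner he M m) : cornerGroup he N).2

theorem cornerHomFun_add (m m' : M) :
    cornerHomFun k (m + m') = cornerHomFun k m + cornerHomFun k m' := by
  refine Eq.trans ?_ (congrArg Subtype.val (map_add k.hom (toCorner he M m) (toCorner he M m')))
  exact cornerHom_congr k _ _ (smul_add _ _ _)

theorem cornerHomFun_smul (b : A) (h : e * b = b) (h' : b * e = b) (m : M) :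
    cornerHomFun k (op b • m) = op b • cornerHomFun k m := by
  refine Eq.trans ?_ (congrArg Subtype.val
    (map_smul k.hom (op (mkCorner he b h h')) (toCorner he M m)))
  refine cornerHom_congr k _ _ ?_
  change op e • op b • m = op b • op e • m
  rw [smul_smul, smul_smul, ← op_mul, ← op_mul, h, h']

theorem cornerHomFun_map (f : M ⟶ N) (m : M) :
    cornerHomFun ((cornerFunctor he).map f) m = op e • f.hom m :=
  map_smul f.hom (op e) m

theorem cornerHom_ext {k k' : (cornerFunctor he).obj M ⟶ (cornerFunctor he).obj N}
    (h : ∀ m : M, op e • m = m → cornerHomFun k m = cornerHomFun k' m) : k = k' := by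
  ext m
  apply Subtype.ext
  exact (cornerHomFun_coe k m).symm.trans ((h m.1 m.2).trans (cornerHomFun_coe k' m))

end

end CornerHom

/-! ### The functor G₂ and local modules. -/

section CoinducedModule

variable {A : Type u} [Ring A] {e : A} (he : IsIdempotentElem e)

variable {he} in
/-- An element of `G₂(X)` as a homomorphism. -/
def homOfG₂ {X : ModuleCat.{u} he.Cornerᵐᵒᵖ} (φ : G₂ he X) : Ae he →ₗ[he.Cornerᵐᵒᵖ] X := φ

variable {he} in
/-- A homomorphism as an element of `G₂(X)`. -/
def toG₂ {X : ModuleCat.{u} he.Cornerᵐᵒᵖ} (φ : Ae he →ₗ[he.Cornerᵐᵒᵖ] X) : G₂ he X := φ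

variable {he}

theorem homOfG₂_ext {X : ModuleCat.{u} he.Cornerᵐᵒᵖ} {φ ψ : G₂ he X}
    (h : ∀ z, homOfG₂ φ z = homOfG₂ ψ z) : φ = ψ := LinearMap.ext h

theorem homOfG₂_smul {X : ModuleCat.{u} he.Cornerᵐᵒᵖ} (a : Aᵐᵒᵖ) (φ : G₂ he X) (z : Ae he) :
    homOfG₂ (a • φ) z = homOfG₂ φ (a.unop • z) := rfl

/-- The element `e` of `Ae`. -/
def idemAe (he : IsIdempotentElem e) : Ae he := ⟨e, he.eq⟩

theorem e_mul_mem_corner (z : Ae he) : e * (e * z.1) = e * z.1 ∧ e * z.1 * e = e * z.1 :=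
  ⟨by rw [← mul_assoc, he.eq], by rw [mul_assoc, show z.1 * e = z.1 from z.2]⟩

/-- The element `e * z` of `eAe`, for `z ∈ Ae`. -/
def eMul (z : Ae he) : he.Corner := mkCorner he (e * z.1) (e_mul_mem_corner z).1
  (e_mul_mem_corner z).2

theorem op_eMul_smul_idemAe (z : Ae he) : op (eMul z) • idemAe he = e • z :=
  Subtype.ext (e_mul_mem_corner z).1

/-- Here φ(z) = φ(ez), and ez = e(ez) with ez in eAe, so φ is determined by its value at e. -/
theorem homOfG₂_of_mem {X : ModuleCat.{u} he.Cornerᵐᵒᵖ} {φ : G₂ he X} (h : op e • φ = φ)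
    (z : Ae he) : homOfG₂ φ z = op (eMul z) • homOfG₂ φ (idemAe he) := by
  rw [← map_smul (homOfG₂ φ), op_eMul_smul_idemAe]
  conv_lhs => rw [← h]
  rfl

/-- The isomorphism `G₂(X)e ≅ X`, evaluation at `e`. -/
def evalG₂ (X : ModuleCat.{u} he.Cornerᵐᵒᵖ) : (cornerFunctor he).obj (G₂ he X) ≅ X :=
  LinearEquiv.toModuleIso (X₁ := cornerGroup he (G₂ he X)) (X₂ := X)
    { toFun := fun φ => homOfG₂ φ.1 (idemAe he)
      map_add' := fun _ _ => rfl
      map_smul' := fun b φ => by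
        change homOfG₂ φ.1 (b.unop.1 • idemAe he) = b • homOfG₂ φ.1 (idemAe he)
        rw [← map_smul (homOfG₂ φ.1)]
        congr 1
        apply Subtype.ext
        change b.unop.1 * e = e * b.unop.1
        rw [corner_left, corner_right]
      invFun := fun x => ⟨toG₂
        { toFun := fun z => op (eMul z) • x
          map_add' := fun z z' => by
            rw [← add_smul]
            congr 1
            exact congrArg op (Subtype.ext (mul_add e z.1 z'.1))
          map_smul' := fun b z => by
            rw [RingHom.id_apply, smul_smul]
            congr 1
            exact congrArg op (Subtype.ext (mul_assoc e z.1 b.unop.1).symm :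
              eMul (b • z) = eMul z * b.unop) }, by
        refine homOfG₂_ext fun z => ?_
        change op (eMul (e • z)) • x = op (eMul z) • x
        congr 2
        exact Subtype.ext (e_mul_mem_corner z).1⟩
      left_inv := fun φ => Subtype.ext (homOfG₂_ext fun z => (homOfG₂_of_mem φ.2 z).symm)
      right_inv := fun x => by
        change op (eMul (idemAe he)) • x = x
        rw [show eMul (idemAe he) = 1 from Subtype.ext he.eq, op_one, one_smul] }

/-- `G₂(f)`. -/
def mapG₂ {X Y : ModuleCat.{u} he.Cornerᵐᵒᵖ} (f : X ⟶ Y) : G₂ he X ⟶ G₂ he Y :=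
  ModuleCat.ofHom (X := G₂ he X) (Y := G₂ he Y)
    { toFun := fun φ => toG₂ (f.hom ∘ₗ homOfG₂ φ)
      map_add' := fun φ ψ => homOfG₂_ext fun z => map_add f.hom (homOfG₂ φ z) (homOfG₂ ψ z)
      map_smul' := fun _ _ => rfl }

theorem mapG₂_evalG₂ {X Y : ModuleCat.{u} he.Cornerᵐᵒᵖ} (f : X ⟶ Y) :
    (cornerFunctor he).map (mapG₂ f) ≫ (evalG₂ Y).hom = (evalG₂ X).hom ≫ f := rfl

instance {X Y : ModuleCat.{u} he.Cornerᵐᵒᵖ} (f : X ⟶ Y) [Mono f] : Mono (mapG₂ f) := by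
  have := (ModuleCat.mono_iff_injective f).1 inferInstance
  rw [ModuleCat.mono_iff_injective]
  intro φ ψ h
  exact homOfG₂_ext fun z => this (congrArg (fun χ => homOfG₂ χ z) h)

/-- Evaluation at e identifies G₂(X)e with X, and Hom(Ae, X) = G₂(X) = Hom(A, G₂(X)). -/
theorem homBijective_G₂ (X : ModuleCat.{u} he.Cornerᵐᵒᵖ) :
    HomBijective (cornerFunctor he) (regular A) (G₂ he X) := by
  constructor
  · intro f g hfg
    rw [cornerFunctor_map_eq_iff] at hfg
    apply regular_hom_ext
    refine homOfG₂_ext fun z => ?_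
    have h0 (f : regular A ⟶ G₂ he X) :
        homOfG₂ (f.hom z.1) (idemAe he) = homOfG₂ (f.hom (1 : A)) z := by
      have : f.hom z.1 = op z.1 • f.hom (1 : A) := by
        rw [← map_smul f.hom]
        exact congrArg f.hom (one_mul z.1).symm
      rw [this, homOfG₂_smul]
      congr 1
      exact Subtype.ext z.2
    rw [← h0, ← h0, hfg z.1 z.2]
  · intro g
    let φ : G₂ he X := toG₂
      { toFun := fun z => homOfG₂ (cornerHomFun g z.1) (idemAe he)
        map_add' := fun z z' => by
          change homOfG₂ (cornerHomFun g (z.1 + z'.1)) _ = _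
          rw [cornerHomFun_add]; rfl
        map_smul' := fun b z => by
          change homOfG₂ (cornerHomFun g (op b.unop.1 • z.1)) _ = _
          rw [cornerHomFun_smul g _ (corner_left he b.unop) (corner_right he b.unop),
            homOfG₂_smul, RingHom.id_apply, ← map_smul]
          congr 1
          apply Subtype.ext
          change b.unop.1 * e = e * b.unop.1
          rw [corner_left, corner_right] }
    refine ⟨fromRegular _ φ, cornerHom_ext fun a ha => ?_⟩
    rw [cornerHomFun_map]
    change op e • op a • φ = _
    refine homOfG₂_ext fun z => ?_
    rw [homOfG₂_of_mem (cornerHomFun_mem g a)]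
    change homOfG₂ (cornerHomFun g (a * (e * z.1))) (idemAe he) = _
    rw [← map_smul, op_eMul_smul_idemAe]
    have h1 : cornerHomFun g (a * (e * z.1)) = _ :=
      cornerHomFun_smul g (e * z.1) (e_mul_mem_corner z).1 (e_mul_mem_corner z).2 a
    rw [h1, homOfG₂_smul]
    congr 1
    apply Subtype.ext
    change e * z.1 * e = e * z.1
    exact (e_mul_mem_corner z).2

/-- Both modules are local with isomorphic images under F, so the isomorphism of images lifts in
both directions. -/
theorem nonempty_iso_G₂ {M : ModuleCat.{u} Aᵐᵒᵖ}
    (h : HomBijective (cornerFunctor he) (regular A) M) :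
    Nonempty (M ≅ G₂ he ((cornerFunctor he).obj M)) := by
  have h' := homBijective_G₂ ((cornerFunctor he).obj M)
  obtain ⟨f, hf⟩ := (h'.of_regular M).2 (evalG₂ _).inv
  obtain ⟨g, hg⟩ := (h.of_regular _).2 (evalG₂ ((cornerFunctor he).obj M)).hom
  exact ⟨f, g, (h.of_regular _).1 (by rw [Functor.map_comp, hf, hg]; simp),
    (h'.of_regular _).1 (by rw [Functor.map_comp, hf, hg]; simp)⟩

end CoinducedModule

/-! ### The functor G₁ and colocal modules. -/

section InducedModule

variable {A : Type u} [Ring A] {e : A} {he : IsIdempotentElem e}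

/-- The class of `y ⊗ x` in `G₁(X)`. -/
def tmulG₁ {X : ModuleCat.{u} he.Cornerᵐᵒᵖ} (y : eA he) (x : X) : G₁ he X :=
  Submodule.Quotient.mk (y ⊗ₜ[ℤ] x)

/-- The element `e` of `eA`. -/
def idemEA (he : IsIdempotentElem e) : eA he := ⟨e, he.eq⟩

theorem tmulG₁_add {X : ModuleCat.{u} he.Cornerᵐᵒᵖ} (y : eA he) (x x' : X) :
    tmulG₁ y (x + x') = tmulG₁ y x + tmulG₁ y x' :=
  congrArg Submodule.Quotient.mk (TensorProduct.tmul_add y x x')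

theorem smul_tmulG₁ {X : ModuleCat.{u} he.Cornerᵐᵒᵖ} (a : Aᵐᵒᵖ) (y : eA he) (x : X) :
    a • tmulG₁ y x = tmulG₁ (a • y) x := rfl

theorem tmulG₁_smul {X : ModuleCat.{u} he.Cornerᵐᵒᵖ} (b : he.Corner) (y : eA he) (x : X) :
    tmulG₁ (b • y) x = tmulG₁ y (op b • x) := by
  refine (Submodule.Quotient.eq _).2 ?_
  exact Submodule.subset_span ⟨b, y, x, rfl⟩

theorem tmulG₁_eq {X : ModuleCat.{u} he.Cornerᵐᵒᵖ} (y : eA he) (x : X) :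
    tmulG₁ y x = op y.1 • tmulG₁ (idemEA he) x := by
  rw [smul_tmulG₁]
  congr 1
  exact Subtype.ext y.2.symm

theorem induction_G₁ {X : ModuleCat.{u} he.Cornerᵐᵒᵖ} {p : G₁ he X → Prop} (h0 : p 0)
    (ht : ∀ y x, p (tmulG₁ y x)) (ha : ∀ s t, p s → p t → p (s + t)) (t : G₁ he X) : p t := by
  obtain ⟨t, rfl⟩ := Submodule.Quotient.mk_surjective _ t
  induction t using TensorProduct.induction_on with
  | zero => exact h0
  | tmul y x => exact ht y x
  | add s t hs ht => exact ha _ _ hs ht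

/-- The unit `X → G₁(X)e`, `x ↦ e ⊗ x`. -/
def unitG₁ (X : ModuleCat.{u} he.Cornerᵐᵒᵖ) : X ⟶ (cornerFunctor he).obj (G₁ he X) :=
  ModuleCat.ofHom (Y := (cornerFunctor he).obj (G₁ he X))
    { toFun := fun x => (⟨tmulG₁ (idemEA he) x, by
        change op e • tmulG₁ (idemEA he) x = _
        rw [smul_tmulG₁]
        congr 1
        exact Subtype.ext he.eq⟩ : cornerGroup he (G₁ he X))
      map_add' := fun x x' => Subtype.ext (tmulG₁_add _ x x')
      map_smul' := fun b x => Subtype.ext (by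
        change tmulG₁ (idemEA he) (op b.unop • x) = op b.unop.1 • tmulG₁ (idemEA he) x
        rw [← tmulG₁_smul, smul_tmulG₁]
        congr 1
        apply Subtype.ext
        change b.unop.1 * e = e * b.unop.1
        rw [corner_left, corner_right]) }

theorem exists_hom_G₁ {X : ModuleCat.{u} he.Cornerᵐᵒᵖ} {N : ModuleCat.{u} Aᵐᵒᵖ}
    (h : X ⟶ (cornerFunctor he).obj N) :
    ∃ f : G₁ he X ⟶ N, unitG₁ X ≫ (cornerFunctor he).map f = h := by
  let hf (x : X) : N := (h.hom x : cornerGroup he N).1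
  have hadd (x x' : X) : hf (x + x') = hf x + hf x' := congrArg Subtype.val (map_add h.hom x x')
  let l : eA he ⊗[ℤ] X →ₗ[Aᵐᵒᵖ] N := TensorProduct.AlgebraTensorModule.lift
    { toFun := fun y =>
        { toFun := fun x => op y.1 • hf x
          map_add' := fun x x' => by rw [hadd, smul_add]
          map_smul' := fun n x => by
            change op y.1 • hf (n • x) = n • op y.1 • hf x
            rw [smul_comm n]
            congr 1
            exact map_zsmul (AddMonoidHom.mk' hf hadd) n x }
      map_add' := fun y y' => by
        ext x
        exact add_smul (op y.1) (op y'.1) (hf x)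
      map_smul' := fun a y => by
        ext x
        exact mul_smul a (op y.1) (hf x) }
  have hl (y : eA he) (x : X) : l (y ⊗ₜ[ℤ] x) = op y.1 • hf x := rfl
  refine ⟨ModuleCat.ofHom (X := G₁ he X) (Submodule.liftQ _ l ?_), ?_⟩
  · rw [Submodule.span_le]
    rintro _ ⟨b, y, x, rfl⟩
    change l _ = 0
    rw [map_sub, hl, hl, sub_eq_zero]
    have : hf (op b • x) = op b.1 • hf x := congrArg Subtype.val (map_smul h.hom (op b) x)
    rw [this, smul_smul]
    rfl
  · ext x
    apply Subtype.ext
    change op e • hf x = hf x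
    exact (h.hom x : cornerGroup he N).2

theorem hom_G₁_ext {X : ModuleCat.{u} he.Cornerᵐᵒᵖ} {N : ModuleCat.{u} Aᵐᵒᵖ} {f g : G₁ he X ⟶ N}
    (h : unitG₁ X ≫ (cornerFunctor he).map f = unitG₁ X ≫ (cornerFunctor he).map g) : f = g := by
  ext t
  induction t using induction_G₁ with
  | h0 => rw [map_zero, map_zero]
  | ht y x =>
    rw [tmulG₁_eq, map_smul, map_smul]
    congr 1
    exact congrArg (fun k => (k.hom x : cornerGroup he N).1) h
  | ha s t hs ht => rw [map_add, map_add, hs, ht]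

theorem unitG₁_bijective (X : ModuleCat.{u} he.Cornerᵐᵒᵖ) :
    Function.Bijective (unitG₁ X).hom := by
  constructor
  -- The canonical map G₁(X) → G₂(X) turns the unit into the isomorphism X ≅ G₂(X)e, so the unit is
  -- a monomorphism.
  · obtain ⟨f, hf⟩ := exists_hom_G₁ (evalG₂ X).inv
    have hm : Mono (unitG₁ X) := by
      have : Mono (unitG₁ X ≫ (cornerFunctor he).map f) := by rw [hf]; infer_instance
      exact mono_of_mono _ ((cornerFunctor he).map f)
    exact (ModuleCat.mono_iff_injective _).1 hm
  · have key (t : G₁ he X) : ∃ x : X, tmulG₁ (idemEA he) x = op e • t := by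
      induction t using induction_G₁ with
      | h0 => exact ⟨0, by
          rw [smul_zero]
          exact congrArg Submodule.Quotient.mk (TensorProduct.tmul_zero _ _)⟩
      | ht y x =>
        have h1 : e * (y.1 * e) = y.1 * e := by rw [← mul_assoc, show e * y.1 = y.1 from y.2]
        have h2 : y.1 * e * e = y.1 * e := by rw [mul_assoc, he.eq]
        -- (y ⊗ x)e = ye ⊗ x, and ye lies in eAe, so it can be moved across the tensor sign.
        refine ⟨op (mkCorner he (y.1 * e) h1 h2) • x, ?_⟩
        rw [← tmulG₁_smul, smul_tmulG₁]
        congr 1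
        exact Subtype.ext h2
      | ha s t hs ht =>
        obtain ⟨x, hx⟩ := hs
        obtain ⟨x', hx'⟩ := ht
        exact ⟨x + x', by rw [tmulG₁_add, hx, hx', smul_add]⟩
    intro t
    obtain ⟨x, hx⟩ := key (t : cornerGroup he (G₁ he X)).1
    exact ⟨x, Subtype.ext (hx.trans (t : cornerGroup he (G₁ he X)).2)⟩

/-- The isomorphism `X ≅ G₁(X)e`. -/
noncomputable def unitIsoG₁ (X : ModuleCat.{u} he.Cornerᵐᵒᵖ) :
    X ≅ (cornerFunctor he).obj (G₁ he X) :=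
  (LinearEquiv.ofBijective (unitG₁ X).hom (unitG₁_bijective X)).toModuleIso

/-- G₁ is left adjoint to F and its unit is an isomorphism. -/
theorem homBijective_G₁ (X : ModuleCat.{u} he.Cornerᵐᵒᵖ) (N : ModuleCat.{u} Aᵐᵒᵖ) :
    HomBijective (cornerFunctor he) (G₁ he X) N := by
  have : IsIso (unitG₁ X) := (unitIsoG₁ X).isIso_hom
  refine ⟨fun f g h => hom_G₁_ext (by rw [h]), fun g => ?_⟩
  obtain ⟨f, hf⟩ := exists_hom_G₁ (unitG₁ X ≫ g)
  exact ⟨f, (cancel_epi _).1 hf⟩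

theorem nonempty_iso_G₁ {M : ModuleCat.{u} Aᵐᵒᵖ} {X : ModuleCat.{u} he.Cornerᵐᵒᵖ}
    (h : ∀ N, HomBijective (cornerFunctor he) M N) (φ : (cornerFunctor he).obj M ≅ X) :
    Nonempty (G₁ he X ≅ M) := by
  have h' := homBijective_G₁ X
  obtain ⟨f, hf⟩ := (h' M).2 ((unitIsoG₁ X).inv ≫ φ.inv)
  obtain ⟨g, hg⟩ := (h _).2 (φ.hom ≫ (unitIsoG₁ X).hom)
  exact ⟨f, g, (h' _).1 (by rw [Functor.map_comp, hf, hg]; simp),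
    (h _).1 (by rw [Functor.map_comp, hf, hg]; simp)⟩

theorem finite_G₁ (X : ModuleCat.{u} he.Cornerᵐᵒᵖ) [Module.Finite he.Cornerᵐᵒᵖ X] :
    Module.Finite Aᵐᵒᵖ (G₁ he X) := by
  obtain ⟨s, hs⟩ := Module.Finite.fg_top (R := he.Cornerᵐᵒᵖ) (M := X)
  classical
  refine ⟨⟨s.image (tmulG₁ (idemEA he)), ?_⟩⟩
  rw [eq_top_iff]
  rintro t -
  have key (x : X) : tmulG₁ (idemEA he) x ∈
      Submodule.span Aᵐᵒᵖ (s.image (tmulG₁ (idemEA he)) : Set (G₁ he X)) := by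
    have hx : x ∈ Submodule.span he.Cornerᵐᵒᵖ (s : Set X) := by rw [hs]; trivial
    induction hx using Submodule.span_induction with
    | mem x hx => exact Submodule.subset_span (by simpa using ⟨x, hx, rfl⟩)
    | zero =>
      rw [show tmulG₁ (idemEA he) (0 : X) = 0 from
        congrArg Submodule.Quotient.mk (TensorProduct.tmul_zero _ _)]
      exact Submodule.zero_mem _
    | add x y _ _ hx hy => rw [tmulG₁_add]; exact Submodule.add_mem _ hx hy
    | smul b x _ hx =>
      rw [show b = op b.unop from rfl, ← tmulG₁_smul, tmulG₁_eq]
      exact Submodule.smul_mem _ _ hx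
  induction t using induction_G₁ with
  | h0 => exact Submodule.zero_mem _
  | ht y x => rw [tmulG₁_eq]; exact Submodule.smul_mem _ _ (key x)
  | ha s t hs ht => exact Submodule.add_mem _ hs ht

end InducedModule

/-! ### Finiteness of Me and G₂(X). -/

section FiniteCorner

variable (K : Type u) {A : Type u} [Field K] [Ring A] [Algebra K A] {e : A}
  (he : IsIdempotentElem e)

/-- The corner ring as a `K`-algebra. -/
abbrev cornerAlgebra : Algebra K he.Corner :=
  RingHom.toAlgebra'
    { toFun := fun k => mkCorner he (k • e) (by rw [mul_smul_comm, he.eq])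
        (by rw [smul_mul_assoc, he.eq])
      map_one' := Subtype.ext (one_smul K e)
      map_mul' := fun k l => Subtype.ext (by
        change (k * l) • e = (k • e) * (l • e)
        rw [smul_mul_smul_comm, he.eq])
      map_zero' := Subtype.ext (zero_smul K e)
      map_add' := fun k l => Subtype.ext (add_smul k l e) }
    (fun k b => Subtype.ext (by
      change (k • e) * b.1 = b.1 * (k • e)
      rw [smul_mul_assoc, mul_smul_comm, corner_left, corner_right]))

variable [Module.Finite K A]

include K

open scoped ModuleCat in
theorem finite_cornerFunctor (M : ModuleCat.{u} Aᵐᵒᵖ) [Module.Finite Aᵐᵒᵖ M] :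
    Module.Finite he.Cornerᵐᵒᵖ ((cornerFunctor he).obj M) := by
  have : Module.Finite K M := finite_of_finite M
  classical
  let b := Module.finBasis K M
  refine ⟨⟨Finset.univ.image fun i => toCorner he M (b i), ?_⟩⟩
  rw [eq_top_iff]
  rintro (m : cornerGroup he M) -
  let c (k : K) : he.Corner := mkCorner he (k • e) (by rw [mul_smul_comm, he.eq])
        (by rw [smul_mul_assoc, he.eq])
  have h : m = ∑ i, op (c (b.repr m.1 i)) • toCorner he M (b i) := by
    apply Subtype.ext
    rw [AddSubgroup.val_finsetSum]
    conv_lhs => rw [← show op e • m.1 = m.1 from m.2]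
    conv_lhs => rw [← b.sum_repr m.1]
    rw [Finset.smul_sum]
    refine Finset.sum_congr rfl fun i _ => ?_
    change op e • b.repr m.1 i • b i = op (b.repr m.1 i • e) • op e • b i
    rw [op_smul, smul_assoc, op_smul_op_smul he, ← algebraMap_smul Aᵐᵒᵖ, smul_smul,
      ← Algebra.commutes, mul_smul, algebraMap_smul]
  rw [h]
  refine Submodule.sum_mem _ fun i _ => Submodule.smul_mem _ _ (Submodule.subset_span ?_)
  exact Finset.mem_coe.2 (Finset.mem_image_of_mem _ (Finset.mem_univ i))

open scoped ModuleCat in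
-- G₂(X) embeds in the finite-dimensional space Hom_K(Ae, X); the work is to match the K-actions
-- through A and through eAe.
theorem finite_G₂ (X : ModuleCat.{u} he.Cornerᵐᵒᵖ) [Module.Finite he.Cornerᵐᵒᵖ X] :
    Module.Finite Aᵐᵒᵖ (G₂ he X) := by
  let := cornerAlgebra K he
  have : Module.Finite K he.Corner :=
    Module.Finite.of_injective (⟨⟨Subtype.val, fun _ _ => rfl⟩, fun k b => by
      rw [Algebra.smul_def]
      change (k • e) * b.1 = k • b.1
      rw [smul_mul_assoc, corner_left]⟩ : he.Corner →ₗ[K] A) Subtype.val_injective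
  have : Module.Finite K X := finite_of_finite X
  have : Module.Finite K (Ae he) := Module.Finite.of_injective
    (⟨⟨Subtype.val, fun _ _ => rfl⟩, fun _ _ => rfl⟩ : Ae he →ₗ[K] A) Subtype.val_injective
  have hk (k : K) (z : Ae he) : k • z = algebraMap K he.Cornerᵐᵒᵖ k • z := by
    apply Subtype.ext
    change k • z.1 = z.1 * (k • e)
    rw [mul_smul_comm, show z.1 * e = z.1 from z.2]
  have hk' (k : K) (φ : G₂ he X) (z : Ae he) : homOfG₂ (k • φ) z = k • homOfG₂ φ z := by
    rw [← algebraMap_smul Aᵐᵒᵖ, homOfG₂_smul, ← algebraMap_smul he.Cornerᵐᵒᵖ, ← map_smul, ← hk]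
    congr 1
    apply Subtype.ext
    exact (Algebra.smul_def k z.1).symm
  have : Module.Finite K (G₂ he X) := by
    let l (φ : G₂ he X) : Ae he →ₗ[K] X :=
      { toFun := homOfG₂ φ
        map_add' := map_add (homOfG₂ φ)
        map_smul' := fun k z => by
          rw [hk, map_smul, algebraMap_smul]; rfl }
    let l' : G₂ he X →ₗ[K] Ae he →ₗ[K] X :=
      { toFun := l
        map_add' := fun _ _ => rfl
        map_smul' := fun k φ => LinearMap.ext fun z => hk' k φ z }
    refine Module.Finite.of_injective l' ?_
    intro φ ψ h
    exact homOfG₂_ext fun z => LinearMap.congr_fun h z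
  exact Module.Finite.of_restrictScalars_finite K Aᵐᵒᵖ _

end FiniteCorner

/-! ### Locality of modules of dominant dimension at least two. -/

section ProjectiveInjective

variable {K A : Type u} [Field K] [Ring A] [Algebra K A] {e : A} {he : IsIdempotentElem e}

theorem mul_eq_zero_of_forall_mul_Ae (t : TraceForm K he) {y : A} (hy : e * y = y)
    (h : ∀ z, z * e = z → y * z = 0) : y = 0 :=
  t.nondeg y hy fun z hz => by rw [h z hz, map_zero]

theorem eA_apply_hom {N : ModuleCat.{u} Aᵐᵒᵖ} (f : N →ₗ[Aᵐᵒᵖ] eA he) (a : A) (n : N) :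
    (f (op a • n)).1 = (f n).1 * a := by
  rw [map_smul]; rfl

/-- The claim is that every eAe-linear map Ae → eAe is left multiplication by a unique y in eA.
Uniqueness is nondegeneracy; for existence, y represents the trace of the map. -/
theorem homBijective_regular_eA (t : TraceForm K he) :
    HomBijective (cornerFunctor he) (regular A) (ModuleCat.of Aᵐᵒᵖ (eA he)) := by
  constructor
  · intro f g hfg
    rw [cornerFunctor_map_eq_iff] at hfg
    apply regular_hom_ext
    apply Subtype.ext
    rw [← sub_eq_zero]
    refine mul_eq_zero_of_forall_mul_Ae t (AddSubgroup.sub_mem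
      (eA he).toAddSubgroup (f.hom (1 : A)).2 (g.hom (1 : A)).2) fun z hz => ?_
    have h0 (f : regular A ⟶ ModuleCat.of Aᵐᵒᵖ (eA he)) :
        (f.hom (1 : A) : eA he).1 * z = (f.hom z : eA he).1 := by
      rw [← eA_apply_hom (N := regular A) f.hom]
      exact congrArg (fun x : A => (f.hom x : eA he).1) (one_mul z)
    rw [sub_mul, h0, h0, hfg z hz, sub_self]
  · intro k
    let κ (a : A) : A := (cornerHomFun (M := regular A) k a : eA he).1
    have hadd (a b : A) : κ (a + b) = κ a + κ b :=
      congrArg Subtype.val (cornerHomFun_add (M := regular A) k a b)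
    have hmul (a b : A) (hb : e * b = b) (hb' : b * e = b) : κ (a * b) = κ a * b :=
      congrArg Subtype.val (cornerHomFun_smul (M := regular A) k b hb hb' a)
    have hmem (a : A) : κ a * e = κ a :=
      congrArg Subtype.val (cornerHomFun_mem (M := regular A) k a)
    have hmem' (a : A) : e * κ a = κ a := (cornerHomFun (M := regular A) k a : eA he).2
    have hs (c : K) (a : A) : κ (c • a) = c • κ a := by
      have h1 : e * (c • e) = c • e := by rw [mul_smul_comm, he.eq]
      have h2 : (c • e) * e = c • e := by rw [smul_mul_assoc, he.eq]
      have h3 : κ ((c • a) * e) = κ (c • a) := by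
        rw [hmul _ _ he.eq he.eq, hmem]
      rw [← h3, smul_mul_assoc, ← mul_smul_comm, hmul _ _ h1 h2, mul_smul_comm, hmem]
    obtain ⟨y, hy, hyt⟩ := t.rep (t.tr ∘ₗ
      { toFun := κ, map_add' := hadd, map_smul' := hs })
    -- Equality of traces becomes equality of elements: testing against w in Ae, zw = z(ew) with ew
    -- in eAe, and κ commutes with right multiplication by ew.
    have key (z : A) (hz : z * e = z) : y * z = κ z := by
      rw [← sub_eq_zero]
      refine t.nondeg _ ?_ fun w hw => ?_
      · rw [mul_sub, ← mul_assoc, hy, hmem']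
      · have h1 : e * (e * w) = e * w := by rw [← mul_assoc, he.eq]
        have h2 : e * w * e = e * w := by rw [mul_assoc, hw]
        have h3 : κ z * w = κ (z * (e * w)) := by
          rw [hmul _ _ h1 h2]
          conv_lhs => rw [← hmem, mul_assoc]
        have h4 : y * z * w = y * (z * (e * w)) := by
          rw [← mul_assoc z, hz, mul_assoc]
        rw [sub_mul, h3, h4, map_sub, hyt, sub_eq_zero]
        · rfl
        · rw [mul_assoc, h2]
    refine ⟨fromRegular _ (⟨y, hy⟩ : eA he), cornerHom_ext (M := regular A) fun a ha => ?_⟩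
    apply Subtype.ext
    change y * (a * e) = κ a
    rw [show a * e = a from ha, key a ha]

/-- As eA is faithful, A and hence every projective embeds in a product of copies of eA; an
injective I is then a retract of that product. -/
theorem homBijective_regular_of_proj_inj (t : TraceForm K he)
    (hf : ∀ a : A, (∀ y, e * y = y → y * a = 0) → a = 0) (I : ModuleCat.{u} Aᵐᵒᵖ)
    (hP : Module.Projective Aᵐᵒᵖ I) (hI : Module.Injective Aᵐᵒᵖ I) :
    HomBijective (cornerFunctor he) (regular A) I := by
  let E : ModuleCat.{u} Aᵐᵒᵖ := ModuleCat.of Aᵐᵒᵖ (eA he)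
  let j : I →ₗ[Aᵐᵒᵖ] ((I ⟶ E) → E) := LinearMap.pi fun f => f.hom
  have hj : Function.Injective j := by
    rw [← LinearMap.ker_eq_bot, LinearMap.ker_eq_bot']
    intro x hx
    obtain ⟨s, hs⟩ := hP
    have : s x = 0 := by
      ext i
      change s x i = 0
      apply unop_injective
      refine hf _ fun y hy => ?_
      let g : I ⟶ E := ModuleCat.ofHom (Y := eA he)
        { toFun := fun x => ⟨y * (s x i).unop, by
            change e * (y * _) = _
            rw [← mul_assoc, hy]⟩
          map_add' := fun x x' => Subtype.ext (by
            change y * (s (x + x') i).unop = y * (s x i).unop + y * (s x' i).unop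
            rw [map_add, ← mul_add]; rfl)
          map_smul' := fun a x => Subtype.ext (by
            change y * (s (a • x) i).unop = y * (s x i).unop * a.unop
            rw [map_smul, mul_assoc]; rfl) }
      exact congrArg Subtype.val (congrFun hx g)
    rw [← hs x, this, map_zero]
  obtain ⟨r, hr⟩ := hI.out j hj LinearMap.id
  refine HomBijective.retract (Y := ModuleCat.of Aᵐᵒᵖ ((I ⟶ E) → E))
    (HomBijective.pi fun _ => homBijective_regular_eA t)
    (ModuleCat.ofHom j) (ModuleCat.ofHom r) ?_
  ext x
  exact hr x

/-- A supremum of values all at most 1 cannot reach 2. The form `n + 2` suffices, since its first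
two terms can be unfolded. -/
theorem exists_domDimGE {R : Type u} [Ring R] {M : ModuleCat.{u} R} (h : 2 ≤ domDim M) :
    ∃ n, DomDimGE (n + 2) M := by
  by_contra hc
  have : domDim M ≤ 1 := by
    refine iSup₂_le fun n hn => ?_
    rcases n with _ | _ | n
    · simp
    · simp
    · exact (hc ⟨n, hn⟩).elim
  exact absurd (h.trans this) (by decide)

/-- M is the kernel of a map I → J between projective-injective modules, which are local. -/
theorem homBijective_regular_of_domDim (t : TraceForm K he)
    (hf : ∀ a : A, (∀ y, e * y = y → y * a = 0) → a = 0) (M : ModuleCat.{u} Aᵐᵒᵖ)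
    (hd : 2 ≤ domDim M) : HomBijective (cornerFunctor he) (regular A) M := by
  obtain ⟨n, I, f, hI, hP, J, g, hJ, hP', -⟩ := exists_domDimGE hd
  let q : I ⟶ ModuleCat.of Aᵐᵒᵖ (I ⧸ LinearMap.range f) :=
    ModuleCat.ofHom (LinearMap.range f).mkQ
  have hE : Function.Exact (ModuleCat.ofHom f).hom (q ≫ ModuleCat.ofHom g).hom := by
    intro x
    change g (q.hom x) = 0 ↔ _
    refine (map_eq_zero_iff g hJ.injective_map).trans ?_
    exact Submodule.Quotient.mk_eq_zero _
  have hz : ModuleCat.ofHom f ≫ q ≫ ModuleCat.ofHom g = 0 := by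
    ext x : 2
    exact hE.apply_apply_eq_zero x
  have : Mono (ModuleCat.ofHom f) := (ModuleCat.mono_iff_injective _).2 hI.injective_map
  exact HomBijective.kernel (S := ShortComplex.mk (ModuleCat.ofHom f) (q ≫ ModuleCat.ofHom g) hz)
    ((ShortComplex.ShortExact.moduleCat_exact_iff_function_exact _).2 hE)
    (homBijective_regular_of_proj_inj t hf I hP hI.injective_obj)
    (homBijective_regular_of_proj_inj t hf J hP' hJ.injective_obj)

theorem homBijective_eA (M : ModuleCat.{u} Aᵐᵒᵖ) :
    HomBijective (cornerFunctor he) (ModuleCat.of Aᵐᵒᵖ (eA he)) M := by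
  have hE : op e • idemEA he = idemEA he := Subtype.ext he.eq
  have h0 (y : eA he) : op y.1 • idemEA he = y := Subtype.ext y.2
  constructor
  · intro f g hfg
    rw [cornerFunctor_map_eq_iff] at hfg
    ext y
    rw [← h0 y, map_smul, map_smul]
    congr 1
    exact hfg (idemEA he) hE
  · intro k
    let m : M := cornerHomFun k (idemEA he)
    refine ⟨ModuleCat.ofHom (X := eA he)
      { toFun := fun y => op y.1 • m
        map_add' := fun y y' => add_smul (op y.1) (op y'.1) m
        map_smul' := fun a y => mul_smul a (op y.1) m }, cornerHom_ext fun y hy => ?_⟩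
    change eA he at y
    rw [cornerHomFun_map]
    change op e • op y.1 • m = _
    have hy' : y.1 * e = y.1 := congrArg Subtype.val hy
    conv_rhs => rw [← h0 y]
    refine Eq.trans ?_ (cornerHomFun_smul k y.1 y.2 hy' (idemEA he)).symm
    rw [smul_smul, ← op_mul, hy']

end ProjectiveInjective

/-! ### D(A) as the dual partner of A. -/

section RegularDual

open scoped ModuleCat

variable {K A : Type u} [Field K] [Ring A] [Algebra K A] {e : A} {he : IsIdempotentElem e}

/-- An additive map that is linear for the action of `K ⊆ A` as an element of `D(N)`. -/
def mkFormL {N : ModuleCat.{u} A} (f : N →+ K) (hf : ∀ k n, f (algebraMap K A k • n) = k * f n) :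
    dualOfLeft K A N :=
  ofFormL K
    { toFun := f
      map_add' := map_add f
      map_smul' := fun k n => by rw [← algebraMap_smul A k n, hf]; rfl }

theorem formL_algebraMap_smul {N : ModuleCat.{u} A} (q : dualOfLeft K A N) (k : K) (n : N) :
    formL K q (algebraMap K A k • n) = k * formL K q n := by
  rw [algebraMap_smul, map_smul]; rfl

/-- A linear form on `A` as an element of `D(A)`. -/
def toRegularDual (f : A →ₗ[K] K) : regularDual K A :=
  mkFormL (N := ModuleCat.of A A) f.toAddMonoidHom fun k a => by
    refine Eq.trans ?_ (map_smul f k a)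
    exact congrArg f (Algebra.smul_def k (show A from a)).symm

/-- An element of `D(A)` as a linear form on `A`. -/
def ofRegularDual (q : regularDual K A) : A →ₗ[K] K where
  toFun a := formL K q a
  map_add' := map_add (formL K q)
  map_smul' k a := by
    rw [Algebra.smul_def]
    exact formL_algebraMap_smul q k a

theorem regularDual_ext {q q' : regularDual K A}
    (h : ∀ a : A, ofRegularDual q a = ofRegularDual q' a) : q = q' := formL_ext h

theorem ofRegularDual_smul (a : Aᵐᵒᵖ) (q : regularDual K A) (x : A) :
    ofRegularDual (a • q) x = ofRegularDual q (a.unop * x) := rfl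

theorem op_smul_field {M : ModuleCat.{u} Aᵐᵒᵖ} (k : K) (a : A) (m : M) :
    op (k • a) • m = k • op a • m := by
  rw [op_smul, smul_assoc]

theorem isCogenerator_regularDual : IsCogenerator (regularDual K A) := by
  intro L l h
  rw [← Module.forall_dual_apply_eq_zero_iff K]
  intro φ
  let g : L ⟶ regularDual K A := ModuleCat.ofHom (Y := regularDual K A)
    { toFun := fun m => toRegularDual
        { toFun := fun a => φ (op a • m)
          map_add' := fun a b => by rw [← map_add, ← add_smul]; rfl
          map_smul' := fun k a => by rw [op_smul_field, map_smul]; rfl }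
      map_add' := fun m m' => regularDual_ext fun a => by
        change φ (op a • (m + m')) = φ (op a • m) + φ (op a • m')
        rw [smul_add, map_add]
      map_smul' := fun b m => regularDual_ext fun a => by
        change φ (op a • b • m) = φ (op (b.unop * a) • m)
        rw [smul_smul]; rfl }
  have h1 : ofRegularDual (g.hom l) (1 : A) = φ l := by
    change φ (op (1 : A) • l) = φ l
    rw [op_one, one_smul]
  rw [← h1, h g]
  rfl

instance injective_regularDual : Injective (regularDual K A) :=
  have : Projective (ModuleCat.of A A) := ModuleCat.projective_of_free (ι := Unit)
    (M := ModuleCat.of A A) (Module.Basis.singleton Unit A)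
  injective_dualOfLeft K _

variable [Module.Finite K A]

/-- The linear form `x ↦ tr (e * x * z)`. -/
def traceFunctional (t : TraceForm K he) (z : A) : regularDual K A :=
  toRegularDual (t.tr ∘ₗ LinearMap.mulLeft K e ∘ₗ LinearMap.mulRight K z)

theorem traceFunctional_eq_zero (t : TraceForm K he) {z : A} (hz : z * e = z)
    (h : traceFunctional t z = 0) : z = 0 := by
  refine t.nondeg_right z hz fun y hy => ?_
  have := congrArg (fun q => ofRegularDual q y) h
  change t.tr (e * (y * z)) = 0 at this
  rwa [← mul_assoc, hy] at this

/-- The isomorphism `Ae ≅ D(A)e` given by a trace form. -/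
noncomputable def cornerRegularIso (t : TraceForm K he) :
    (cornerFunctor he).obj (regular A) ≅ (cornerFunctor he).obj (regularDual K A) := by
  let ψ : (cornerFunctor he).obj (regular A) →ₗ[he.Cornerᵐᵒᵖ]
      (cornerFunctor he).obj (regularDual K A) :=
    { toFun := fun z => ⟨traceFunctional t z.1, regularDual_ext fun x => by
        rw [ofRegularDual_smul]
        change t.tr (e * (e * x * z.1)) = t.tr (e * (x * z.1))
        rw [← mul_assoc, ← mul_assoc, he.eq, mul_assoc]⟩
      map_add' := fun z z' => Subtype.ext (regularDual_ext fun x => by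
        change t.tr (e * (x * (z.1 + z'.1))) = t.tr (e * (x * z.1)) + t.tr (e * (x * z'.1))
        rw [mul_add, mul_add, map_add])
      map_smul' := fun b z => Subtype.ext (regularDual_ext fun x => by
        change t.tr (e * (x * (z.1 * b.unop.1))) = t.tr (e * (b.unop.1 * x * z.1))
        have hz : z.1 * e = z.1 := z.2
        have hb := corner_left he b.unop
        have hb' := corner_right he b.unop
        -- Symmetry of the trace on eAe is what makes z ↦ tr(e - z) linear over eAe.
        have h1 := t.comm (e * (x * z.1)) b.unop.1 (by rw [← mul_assoc, he.eq])
          (by rw [mul_assoc, mul_assoc, hz]) hb hb'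
        rw [show e * (x * (z.1 * b.unop.1)) = e * (x * z.1) * b.unop.1 by
          simp only [mul_assoc], h1]
        congr 1
        rw [← mul_assoc, hb', mul_assoc, ← mul_assoc e, hb]) }
  have hψ : Function.Bijective ψ := by
    constructor
    · rw [injective_iff_map_eq_zero]
      intro z hz
      exact Subtype.ext (traceFunctional_eq_zero t z.2 (congrArg Subtype.val hz))
    · rintro ⟨q, hq⟩
      obtain ⟨z, hz, hzq⟩ := t.rep_right (ofRegularDual q)
      refine ⟨⟨z, hz⟩, Subtype.ext (regularDual_ext fun x => ?_)⟩
      change t.tr (e * (x * z)) = _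
      have h1 : ofRegularDual (op e • q) x = ofRegularDual q x := by rw [hq]
      rw [ofRegularDual_smul] at h1
      rw [← mul_assoc, hzq _ (by rw [← mul_assoc, he.eq]), ← h1]
      rfl
  exact (LinearEquiv.ofBijective ψ hψ).toModuleIso

variable (K) in
/-- The endomorphism `f ↦ f (- * a)` of `D(A)`. -/
def rightMulDual (a : A) : regularDual K A ⟶ regularDual K A :=
  ModuleCat.ofHom (X := regularDual K A) (Y := regularDual K A)
    { toFun := fun q => toRegularDual (ofRegularDual q ∘ₗ LinearMap.mulRight K a)
      map_add' := fun _ _ => rfl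
      map_smul' := fun b q => regularDual_ext fun x => by
        change ofRegularDual q (b.unop * (x * a)) = ofRegularDual q (b.unop * x * a)
        rw [mul_assoc] }

theorem exists_rightMulDual (f : regularDual K A ⟶ regularDual K A) :
    ∃ a : A, f = rightMulDual K a := by
  obtain ⟨g, rfl⟩ := (dualMapL_bijective (ModuleCat.of A A) (ModuleCat.of A A)).2 f
  refine ⟨g.hom (1 : A), ?_⟩
  ext q
  refine regularDual_ext fun x => ?_
  change ofRegularDual q (g.hom x) = ofRegularDual q (x * g.hom (1 : A))
  congr 1
  rw [← smul_eq_mul, ← map_smul g.hom]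
  exact congrArg g.hom (mul_one x).symm

/-- By duality End(D(A)) = A. The isomorphism Ae ≅ D(A)e turns left multiplication by a into
`rightMulDual K a`, so the bijection from A to End(Ae) carries over. -/
theorem homBijective_regularDual_self (t : TraceForm K he)
    (hA : HomBijective (cornerFunctor he) (regular A) (regular A)) :
    HomBijective (cornerFunctor he) (regularDual K A) (regularDual K A) := by
  have hfaith (a : A) (ha : ∀ z, z * e = z → a * z = 0) : a = 0 := by
    have : fromRegular (regular A) a = 0 := hA.1 (by
      rw [cornerFunctor_map_eq_iff]
      intro z hz
      exact ha z hz)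
    have := congrArg (fun f => (f.hom (1 : A) : A)) this
    change a * 1 = 0 at this
    rwa [mul_one] at this
  have hmem (z : A) (hz : z * e = z) : op e • traceFunctional t z = traceFunctional t z :=
    ((cornerRegularIso t).hom.hom (⟨z, hz⟩ : cornerGroup he (regular A)) :
      cornerGroup he (regularDual K A)).2
  constructor
  · intro f g hfg
    rw [← sub_eq_zero]
    rw [← sub_eq_zero, ← Functor.map_sub] at hfg
    obtain ⟨a, ha⟩ := exists_rightMulDual (f - g)
    rw [ha] at hfg ⊢
    have : a = 0 := by
      refine hfaith a fun z hz => ?_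
      refine traceFunctional_eq_zero t (by rw [mul_assoc, hz]) (regularDual_ext fun x => ?_)
      have h1 := (cornerFunctor_map_eq_iff he (g := (0 : regularDual K A ⟶ regularDual K A))).1
        (hfg.trans (Functor.map_zero _ _ _).symm) (traceFunctional t z) (hmem z hz)
      have := congrArg (fun q => ofRegularDual q x) h1
      change t.tr (e * (x * a * z)) = 0 at this
      rw [mul_assoc] at this
      exact this
    subst this
    ext q
    refine regularDual_ext fun x => ?_
    change ofRegularDual q (x * 0) = 0
    rw [mul_zero, map_zero]
  · intro h
    obtain ⟨l, hl⟩ := hA.2 ((cornerRegularIso t).hom ≫ h ≫ (cornerRegularIso t).inv)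
    refine ⟨rightMulDual K (l.hom (1 : A)), ?_⟩
    rw [← cancel_epi (cornerRegularIso t).hom]
    have hl' : (cornerFunctor he).map l ≫ (cornerRegularIso t).hom =
        (cornerRegularIso t).hom ≫ h := by rw [hl]; simp
    rw [← hl']
    refine cornerHom_ext fun z hz => ?_
    have hz' : z ∈ cornerGroup he (regular A) := hz
    rw [cornerHomFun_coe _ (⟨z, hz'⟩ : cornerGroup he (regular A)),
      cornerHomFun_coe _ (⟨z, hz'⟩ : cornerGroup he (regular A))]
    refine regularDual_ext fun x => ?_
    change t.tr (e * (x * l.hom (1 : A) * z)) = t.tr (e * (x * l.hom z))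
    rw [mul_assoc x]
    congr 3
    have : l.hom (op (show A from z) • (1 : A)) = op (show A from z) • l.hom (1 : A) :=
      map_smul l.hom _ _
    refine this.symm.trans ?_
    exact congrArg l.hom (one_mul (show A from z))

/-- `A` and `D(A)` form a dual pair for `(-)e`. -/
noncomputable def regularDualPair (t : TraceForm K he)
    (hA : HomBijective (cornerFunctor he) (regular A) (regular A)) :
    DualPair (cornerFunctor he) (regular A) (regularDual K A) where
  projective := (IsProjective.iff_projective (R := Aᵐᵒᵖ) A).1
    (Module.Projective.of_equiv (show Aᵐᵒᵖ ≃ₗ[Aᵐᵒᵖ] A from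
      { toFun := unop
        invFun := op
        map_add' := fun _ _ => rfl
        map_smul' := fun _ _ => rfl
        left_inv := fun _ => rfl
        right_inv := fun _ => rfl }))
  injective := inferInstance
  iso := cornerRegularIso t
  bij_to := hA.of_regular
  bij_from := HomBijective.of_cogenerator isCogenerator_regularDual
    (homBijective_regularDual_self t hA)

end RegularDual

/-! ### Covers and embeddings by powers of eA. -/

section Approximation

open scoped ModuleCat

variable {K A : Type u} [Field K] [Ring A] [Algebra K A] {e : A} {he : IsIdempotentElem e}

/-- The right module `(eA)^k`. -/
abbrev powEA (he : IsIdempotentElem e) (k : ℕ) : ModuleCat.{u} Aᵐᵒᵖ :=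
  ModuleCat.of Aᵐᵒᵖ (Fin k → eA he)

theorem homBijective_powEA_left (k : ℕ) (M : ModuleCat.{u} Aᵐᵒᵖ) :
    HomBijective (cornerFunctor he) (powEA he k) M := by
  classical
  let E : ModuleCat.{u} Aᵐᵒᵖ := ModuleCat.of Aᵐᵒᵖ (eA he)
  let ι (i : Fin k) : E ⟶ powEA he k :=
    ModuleCat.ofHom (LinearMap.single Aᵐᵒᵖ (fun _ => eA he) i)
  have hsum (x : powEA he k) : x = ∑ i, (ι i).hom (x i) :=
    (Finset.univ_sum_single (show Fin k → eA he from x)).symm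
  constructor
  · intro f g hfg
    have (i : Fin k) : ι i ≫ f = ι i ≫ g := (homBijective_eA M).1 (by
      rw [Functor.map_comp, Functor.map_comp, hfg])
    refine ModuleCat.hom_ext (LinearMap.ext fun x => ?_)
    rw [hsum x, map_sum, map_sum]
    refine Finset.sum_congr rfl fun i _ => ?_
    exact congrArg (fun h => h.hom (x i)) (this i)
  · intro h
    choose f hf using fun i => (homBijective_eA (he := he) M).2 ((cornerFunctor he).map (ι i) ≫ h)
    let l : powEA he k ⟶ M := ∑ i, ModuleCat.ofHom (LinearMap.proj i) ≫ f i
    have hl : (cornerFunctor he).map (𝟙 (powEA he k)) =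
        ∑ i, (cornerFunctor he).map (ModuleCat.ofHom (LinearMap.proj i)) ≫
          (cornerFunctor he).map (ι i) := by
      rw [show 𝟙 (powEA he k) = ∑ i, ModuleCat.ofHom (LinearMap.proj i) ≫ ι i by
        refine ModuleCat.hom_ext (LinearMap.ext fun x => ?_)
        rw [ModuleCat.hom_sum, LinearMap.sum_apply]
        exact hsum x, Functor.map_sum]
      simp only [Functor.map_comp]
    refine ⟨l, ?_⟩
    rw [Functor.map_sum]
    conv_rhs => rw [← Category.id_comp h, ← CategoryTheory.Functor.map_id, hl, Preadditive.sum_comp]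
    refine Finset.sum_congr rfl fun i _ => ?_
    rw [Functor.map_comp, hf, Category.assoc]

/-- G₂ preserves monomorphisms: a map X → F P comes from a map G₂(X) → P, which extends to G₂(Y). -/
theorem injective_map_of_injective {P : ModuleCat.{u} Aᵐᵒᵖ} [Injective P]
    (h : ∀ M, HomBijective (cornerFunctor he) M P) : Injective ((cornerFunctor he).obj P) where
  factors {X Y} g f hf := by
    obtain ⟨k, hk⟩ := (h _).2 ((evalG₂ X).hom ≫ g)
    refine ⟨(evalG₂ Y).inv ≫ (cornerFunctor he).map (Injective.factorThru k (mapG₂ f)), ?_⟩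
    rw [← cancel_epi (evalG₂ X).hom, ← Category.assoc, ← mapG₂_evalG₂, Category.assoc,
      Iso.hom_inv_id_assoc, ← Functor.map_comp, Injective.comp_factorThru, hk]

theorem projective_map_powEA (k : ℕ) : Projective ((cornerFunctor he).obj (powEA he k)) := by
  let ψ : (Fin k → he.Cornerᵐᵒᵖ) →ₗ[he.Cornerᵐᵒᵖ] (cornerFunctor he).obj (powEA he k) :=
    { toFun := fun b => ⟨fun i => ⟨(b i).unop.1, corner_left he _⟩,
        funext fun i => Subtype.ext (corner_right he (b i).unop)⟩
      map_add' := fun _ _ => rfl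
      map_smul' := fun _ _ => rfl }
  have hψ : Function.Bijective ψ := by
    refine ⟨fun b b' h => funext fun i => unop_injective (Subtype.ext ?_), fun x => ?_⟩
    · exact congrArg (fun x : cornerGroup he (powEA he k) => (x.1 i : eA he).1) h
    · let y : cornerGroup he (powEA he k) := x
      exact ⟨fun i => op (mkCorner he (y.1 i : eA he).1 (y.1 i : eA he).2
        (congrArg Subtype.val (congrFun y.2 i))), rfl⟩
  have : Module.Projective he.Cornerᵐᵒᵖ ((cornerFunctor he).obj (powEA he k)) :=
    Module.Projective.of_equiv (LinearEquiv.ofBijective ψ hψ)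
  exact (IsProjective.iff_projective ((cornerFunctor he).obj (powEA he k))).1 this

/-- The map sends m to the form z ↦ f(mz) in D(Ae), identified with eA by the trace form. -/
theorem exists_hom_eA (t : TraceForm K he) (M : ModuleCat.{u} Aᵐᵒᵖ) (f : M →ₗ[K] K) :
    ∃ g : M →ₗ[Aᵐᵒᵖ] eA he, ∀ m z, z * e = z → t.tr ((g m).1 * z) = f (op z • m) := by
  let φ (m : M) : A →ₗ[K] K :=
    { toFun := fun a => f (op a • m)
      map_add' := fun a b => by rw [← map_add, ← add_smul]; rfl
      map_smul' := fun k a => by rw [op_smul_field, map_smul]; rfl }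
  choose y hy hyt using fun m => t.rep (φ m)
  have uniq (x x' : A) (hx : e * x = x) (hx' : e * x' = x')
      (h : ∀ z, z * e = z → t.tr (x * z) = t.tr (x' * z)) : x = x' := by
    rw [← sub_eq_zero]
    refine t.nondeg _ (by rw [mul_sub, hx, hx']) fun z hz => ?_
    rw [sub_mul, map_sub, h z hz, sub_self]
  refine ⟨
    { toFun := fun m => ⟨y m, hy m⟩
      map_add' := fun m m' => Subtype.ext <| uniq _ _ (hy _)
        (by change e * (y m + y m') = y m + y m'; rw [mul_add, hy, hy]) fun z hz => by
          change _ = t.tr ((y m + y m') * z)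
          rw [add_mul, map_add, hyt _ z hz, hyt _ z hz, hyt _ z hz]
          change f (op z • (m + m')) = f (op z • m) + f (op z • m')
          rw [smul_add, map_add]
      map_smul' := fun a m => Subtype.ext <| uniq _ _ (hy _)
        (by change e * (y m * a.unop) = y m * a.unop; rw [← mul_assoc, hy]) fun z hz => by
          change _ = t.tr (y m * a.unop * z)
          rw [mul_assoc, hyt _ z hz, hyt _ (a.unop * z) (by rw [mul_assoc, hz])]
          change f (op z • a • m) = f (op (a.unop * z) • m)
          rw [smul_smul]; rfl }, fun m z hz => hyt m z hz⟩

variable [Module.Finite K A]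

variable (he) in
/-- The finite powers of `eA`. -/
def IsPowEA : ObjectProperty (ModuleCat.{u} Aᵐᵒᵖ) := fun X => ∃ k, X = powEA he k

variable (A) in
/-- The finitely generated modules. -/
def IsFinite : ObjectProperty (ModuleCat.{u} Aᵐᵒᵖ) := fun X => Module.Finite Aᵐᵒᵖ X

variable (K) in
include K in
theorem isFinite_kernel {M N : ModuleCat.{u} Aᵐᵒᵖ} (f : M →ₗ[Aᵐᵒᵖ] N)
    [Module.Finite Aᵐᵒᵖ M] : Module.Finite Aᵐᵒᵖ (LinearMap.ker f) := by
  have : IsNoetherianRing Aᵐᵒᵖ := IsNoetherianRing.of_finite K Aᵐᵒᵖ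
  infer_instance

theorem exists_cover (hE : Module.Finite Aᵐᵒᵖ (eA he)) (M : ModuleCat.{u} Aᵐᵒᵖ)
    [Module.Finite Aᵐᵒᵖ M] (hM : HomBijective (cornerFunctor he) M (regularDual K A)) :
    ∃ S : ShortComplex (ModuleCat.{u} Aᵐᵒᵖ), S.ShortExact ∧ S.X₃ = M ∧ IsPowEA he S.X₂ ∧
      IsFinite A S.X₁ := by
  have : Module.Finite K M := finite_of_finite M
  let b := Module.finBasis K M
  let π : (Fin (Module.finrank K M) → eA he) →ₗ[Aᵐᵒᵖ] M :=
    { toFun := fun y => ∑ i, op (y i).1 • b i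
      map_add' := fun y y' => by
        rw [← Finset.sum_add_distrib]
        exact Finset.sum_congr rfl fun i _ => add_smul (op (y i).1) (op (y' i).1) (b i)
      map_smul' := fun a y => by
        rw [RingHom.id_apply, Finset.smul_sum]
        exact Finset.sum_congr rfl fun i _ => mul_smul a (op (y i).1) (b i) }
  have hπe (m : M) (hm : op e • m = m) : m ∈ LinearMap.range π := by
    refine ⟨fun i => ⟨b.repr m i • e, by
      change e * (b.repr m i • e) = _
      rw [mul_smul_comm, he.eq]⟩, ?_⟩
    change ∑ i, op (b.repr m i • e) • b i = m
    conv_rhs => rw [← hm, ← b.sum_repr m, Finset.smul_sum]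
    refine Finset.sum_congr rfl fun i _ => ?_
    rw [op_smul_field, ← algebraMap_smul Aᵐᵒᵖ, ← algebraMap_smul Aᵐᵒᵖ, smul_smul, smul_smul,
      Algebra.commutes]
  have hπ : Function.Surjective π := by
    rw [← LinearMap.range_eq_top, eq_top_iff]
    rintro m -
    -- The image of π contains Me, so maps M → L → D(A) vanish on Me and hence vanish by colocality;
    -- as D(A) cogenerates, L is zero.
    let L : ModuleCat.{u} Aᵐᵒᵖ := ModuleCat.of Aᵐᵒᵖ (M ⧸ LinearMap.range π)
    let p : M ⟶ L := ModuleCat.ofHom (LinearMap.range π).mkQ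
    have : p.hom m = 0 := isCogenerator_regularDual (K := K) L _ fun f => by
      have : p ≫ f = 0 := hM.1 (by
        rw [cornerFunctor_map_eq_iff]
        intro x hx
        have : p.hom x = 0 := (Submodule.Quotient.mk_eq_zero _).2 (hπe x hx)
        change f.hom (p.hom x) = 0
        rw [this, map_zero])
      exact congrArg (fun k => k.hom m) this
    exact (Submodule.Quotient.mk_eq_zero _).1 this
  exact ⟨_, moduleCat_shortExact (X := ModuleCat.of Aᵐᵒᵖ (LinearMap.ker π)) (Y := powEA he _)
    (Z := M) (ModuleCat.ofHom (LinearMap.ker π).subtype) (ModuleCat.ofHom π)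
    Subtype.val_injective hπ (LinearMap.exact_subtype_ker_map π), rfl, ⟨_, rfl⟩,
    isFinite_kernel K (M := powEA he _) π⟩

/-- The coordinate forms of a K-basis give maps M → eA. If all of them kill m, then mz = 0 for every
z in Ae, and locality gives m = 0. -/
theorem exists_cocover (t : TraceForm K he) (hE : Module.Finite Aᵐᵒᵖ (eA he))
    (M : ModuleCat.{u} Aᵐᵒᵖ) [Module.Finite Aᵐᵒᵖ M]
    (hM : HomBijective (cornerFunctor he) (regular A) M) :
    ∃ S : ShortComplex (ModuleCat.{u} Aᵐᵒᵖ), S.ShortExact ∧ S.X₁ = M ∧ IsPowEA he S.X₂ ∧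
      IsFinite A S.X₃ := by
  have : Module.Finite K M := finite_of_finite M
  let b := Module.finBasis K M
  choose g hg using fun i => exists_hom_eA t M (b.coord i)
  let j : M →ₗ[Aᵐᵒᵖ] (Fin (Module.finrank K M) → eA he) := LinearMap.pi g
  have hj : Function.Injective j := by
    rw [← LinearMap.ker_eq_bot, LinearMap.ker_eq_bot']
    intro m hm
    have hz (z : A) (hz : z * e = z) : op z • m = 0 := by
      rw [← b.repr.map_eq_zero_iff]
      ext i
      have h1 := hg i m z hz
      have h2 : g i m = 0 := congrFun hm i
      rw [h2] at h1
      change t.tr (0 * z) = _ at h1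
      rw [zero_mul, map_zero] at h1
      exact h1.symm
    have : fromRegular M m = 0 := hM.1 (by
      rw [cornerFunctor_map_eq_iff]
      exact hz)
    have := congrArg (fun k => k.hom (1 : A)) this
    change op (1 : A) • m = 0 at this
    rwa [op_one, one_smul] at this
  refine ⟨_, moduleCat_shortExact (X := M) (Y := powEA he _)
    (Z := ModuleCat.of Aᵐᵒᵖ ((Fin (Module.finrank K M) → eA he) ⧸ LinearMap.range j))
    (ModuleCat.ofHom j) (ModuleCat.ofHom (LinearMap.range j).mkQ)
    hj (Submodule.mkQ_surjective _) (LinearMap.exact_map_mkQ_range j), rfl, ⟨_, rfl⟩, ?_⟩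
  exact inferInstanceAs (Module.Finite Aᵐᵒᵖ
    ((Fin (Module.finrank K M) → eA he) ⧸ LinearMap.range j))

/-- The approximable dual pair of a gendo-symmetric algebra. -/
noncomputable def gendoDualPair (t : TraceForm K he)
    (hE : IsMinimalFaithfulProjInj (ModuleCat.of Aᵐᵒᵖ (eA he)))
    (hd : 2 ≤ domDim (regular A)) :
    ApproximableDualPair (cornerFunctor he) (regular A) (regularDual K A) (IsFinite A)
      (IsPowEA he) :=
  have hf (a : A) (h : ∀ y, e * y = y → y * a = 0) : a = 0 := by
    have := hE.faithful
    have h0 : op a = 0 := this.eq_of_smul_eq_smul fun y => by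
      rw [zero_smul]
      exact Subtype.ext (h (y : eA he).1 (y : eA he).2)
    exact op_injective h0
  have hA := homBijective_regular_of_domDim t hf _ hd
  have hbij (k : ℕ) : HomBijective (cornerFunctor he) (regular A) (powEA he k) :=
    HomBijective.finite_pi (homBijective_regular_eA t)
  have hinj (k : ℕ) : Injective (powEA he k) := by
    have := hE.injective
    have : Module.Injective Aᵐᵒᵖ (eA he) := this
    exact (Module.injective_iff_injective_object _ _).1 inferInstance
  have hproj (k : ℕ) : Projective (powEA he k) := by
    have := hE.projective
    have : Module.Projective Aᵐᵒᵖ (eA he) := this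
    exact (IsProjective.iff_projective _).1
      (Module.Projective.of_equiv (DFinsupp.linearEquivFunOnFintype (R := Aᵐᵒᵖ)
        (M := fun _ : Fin k => eA he)))
  { toDualPair := regularDualPair t hA
    proj := by rintro _ ⟨k, rfl⟩; exact hproj k
    inj := by rintro _ ⟨k, rfl⟩; exact hinj k
    bij_A := by rintro _ ⟨k, rfl⟩; exact hbij k
    bij_Q := by rintro _ ⟨k, rfl⟩; exact homBijective_powEA_left k _
    proj_map := by rintro _ ⟨k, rfl⟩; exact projective_map_powEA k
    inj_map := by
      rintro _ ⟨k, rfl⟩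
      have := hinj k
      exact injective_map_of_injective (hbij k).of_regular
    cover := fun M hM h => by
      have : Module.Finite Aᵐᵒᵖ M := hM
      exact exists_cover hE.finite M h
    cocover := fun M hM h => by
      have : Module.Finite Aᵐᵒᵖ M := hM
      exact exists_cocover t hE.finite M h }

end Approximation

/-! ### Gorenstein projective modules, reflexivity and cosyzygies. -/

section Gorenstein

variable {R S T : Type u} [Ring R] [Ring S] [AddCommGroup T] [Module R T] [Module S T]
  [SMulCommClass R S T]

variable (S) in
/-- Evaluation at `m` as a homomorphism `Hom(M, T) → T`. -/
def evalAt {M : Type u} [AddCommGroup M] [Module R M] (m : M) : (M →ₗ[R] T) →ₗ[S] T where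
  toFun g := g m
  map_add' _ _ := rfl
  map_smul' _ _ := rfl

variable (R S T) in
/-- `T` is freely generated by `t` both over `R` and over `S`. -/
structure IsFreeGenerator (t : T) : Prop where
  left : Function.Bijective fun r : R => r • t
  right : Function.Bijective fun s : S => s • t

variable (S) in
-- `b` and `f` form a dual basis of P; the commuting actions of R and S on T convert coefficients on
-- one side into coefficients on the other.
theorem evalAt_bijective {t : T} (ht : IsFreeGenerator R S T t) {P : Type u} [AddCommGroup P]
    [Module R P] [Module.Finite R P] [Module.Projective R P] :
    Function.Bijective (evalAt S : P → ((P →ₗ[R] T) →ₗ[S] T)) := by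
  obtain ⟨n, p, i, -, -, hpi⟩ := Module.Finite.exists_comp_eq_id_of_projective R P
  let b (j : Fin n) : P := p fun l => if j = l then 1 else 0
  let f (j : Fin n) : P →ₗ[R] T := LinearMap.toSpanSingleton R T t ∘ₗ LinearMap.proj j ∘ₗ i
  have hf (j : Fin n) (x : P) : f j x = i x j • t := rfl
  have hb (x : P) : x = ∑ j, i x j • b j := by
    conv_lhs => rw [← LinearMap.id_apply (R := R) x, ← hpi, LinearMap.comp_apply,
      LinearMap.pi_apply_eq_sum_univ p (i x)]
  constructor
  · intro x y hxy
    have : i x = i y := funext fun j => ht.left.1 (LinearMap.congr_fun hxy (f j))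
    rw [hb x, hb y, this]
  · intro φ
    choose r hr using fun j => ht.left.2 (φ (f j))
    choose s hs using fun g : P →ₗ[R] T => fun j => ht.right.2 (g (b j))
    refine ⟨∑ j, r j • b j, LinearMap.ext fun g => ?_⟩
    have hg : g = ∑ j, s g j • f j := by
      ext x
      conv_lhs => rw [hb x, map_sum]
      rw [LinearMap.sum_apply]
      refine Finset.sum_congr rfl fun j _ => ?_
      rw [map_smul, LinearMap.smul_apply, hf, ← hs g j]
      exact smul_comm _ _ _
    change g (∑ j, r j • b j) = φ g
    conv_rhs => rw [hg, map_sum]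
    rw [map_sum]
    refine Finset.sum_congr rfl fun j _ => ?_
    rw [map_smul, map_smul, ← hr j, ← hs g j]
    exact smul_comm _ _ _

variable (S) in
theorem dual_projective {t : T} (ht : IsFreeGenerator R S T t) {P : Type u} [AddCommGroup P]
    [Module R P] [Module.Finite R P] [Module.Projective R P] :
    Module.Finite S (P →ₗ[R] T) ∧ Module.Projective S (P →ₗ[R] T) := by
  obtain ⟨n, p, i, -, -, hpi⟩ := Module.Finite.exists_comp_eq_id_of_projective R P
  let σ : S ≃ₗ[S] T := LinearEquiv.ofBijective (LinearMap.toSpanSingleton S T t) ht.right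
  let b (j : Fin n) : P := p fun l => if j = l then 1 else 0
  let f (j : Fin n) : P →ₗ[R] T := LinearMap.toSpanSingleton R T t ∘ₗ LinearMap.proj j ∘ₗ i
  have hb (x : P) : x = ∑ j, i x j • b j := by
    conv_lhs => rw [← LinearMap.id_apply (R := R) x, ← hpi, LinearMap.comp_apply,
      LinearMap.pi_apply_eq_sum_univ p (i x)]
  let sec : (P →ₗ[R] T) →ₗ[S] (Fin n → S) :=
    LinearMap.pi fun j => σ.symm.toLinearMap ∘ₗ evalAt S (b j)
  let ret : (Fin n → S) →ₗ[S] (P →ₗ[R] T) := Fintype.linearCombination S f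
  have h : ret ∘ₗ sec = LinearMap.id := by
    ext g x
    have h1 : ret (sec g) = ∑ j, σ.symm (g (b j)) • f j := rfl
    rw [LinearMap.comp_apply, h1, LinearMap.sum_apply]
    conv_rhs => rw [LinearMap.id_apply, hb x, map_sum]
    refine Finset.sum_congr rfl fun j _ => ?_
    have h2 : σ (σ.symm (g (b j))) = g (b j) := σ.apply_symm_apply _
    change σ.symm (g (b j)) • i x j • t = g (i x j • b j)
    rw [map_smul, ← smul_comm]
    exact congrArg (i x j • ·) h2
  exact ⟨Module.Finite.of_surjective ret (Function.RightInverse.surjective (LinearMap.congr_fun h)),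
    Module.Projective.of_split sec ret h⟩

variable (R S T) in
/-- Every homomorphism `Hom(M, T) → T` is the evaluation at a unique element of `M`. -/
def IsReflexive (M : ModuleCat.{u} R) : Prop :=
  Function.Bijective (evalAt S : M → ((M →ₗ[R] T) →ₗ[S] T))

/-- `Hom(-, T)` of a homomorphism. -/
abbrev dualHom {M N : ModuleCat.{u} R} (f : M →ₗ[R] N) :
    ModuleCat.of S (N →ₗ[R] T) ⟶ ModuleCat.of S (M →ₗ[R] T) :=
  ModuleCat.ofHom (homDual R S T f)

variable (S T) in
theorem transpose_shortExact {M N : ModuleCat.{u} R} (f : M →ₗ[R] N) :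
    (ShortComplex.mk (ModuleCat.ofHom (LinearMap.range (homDual R S T f)).subtype)
      (ModuleCat.ofHom (LinearMap.range (homDual R S T f)).mkQ)
      (by ext x; exact (Submodule.Quotient.mk_eq_zero _).2 x.2)).ShortExact :=
  moduleCat_shortExact _ _ Subtype.val_injective (Submodule.mkQ_surjective _)
    (by
      rw [LinearMap.exact_iff]
      exact (Submodule.ker_mkQ _).trans (Submodule.range_subtype _).symm)

theorem homDual_eq_zero_iff {P₁ P₀ M : ModuleCat.{u} R} {f : P₁ →ₗ[R] P₀} {g : P₀ →ₗ[R] M}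
    (hfg : Function.Exact f g) (hg : Function.Surjective g) (h : P₀ →ₗ[R] T) :
    homDual R S T f h = 0 ↔ ∃ k : M →ₗ[R] T, homDual R S T g k = h := by
  constructor
  · intro hh
    have hker : LinearMap.ker g ≤ LinearMap.ker h := by
      intro x hx
      obtain ⟨y, rfl⟩ := (hfg x).1 hx
      exact LinearMap.congr_fun hh y
    let e := g.quotKerEquivOfSurjective hg
    refine ⟨(LinearMap.ker g).liftQ h hker ∘ₗ e.symm.toLinearMap, LinearMap.ext fun x => ?_⟩
    change (LinearMap.ker g).liftQ h hker (e.symm (g x)) = h x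
    have : e.symm (g x) = (LinearMap.ker g).mkQ x := by
      rw [LinearEquiv.symm_apply_eq]; rfl
    rw [this]
    rfl
  · rintro ⟨k, rfl⟩
    ext x
    change k (g (f x)) = 0
    rw [hfg.apply_apply_eq_zero, map_zero]

theorem homDual_injective {M N : ModuleCat.{u} R} {g : M →ₗ[R] N} (hg : Function.Surjective g) :
    Function.Injective (homDual R S T g) := by
  intro h k hk
  ext y
  obtain ⟨x, rfl⟩ := hg y
  exact LinearMap.congr_fun hk x

variable (S T) in
theorem dual_shortExact {P₁ P₀ M : ModuleCat.{u} R} {f : P₁ →ₗ[R] P₀} {g : P₀ →ₗ[R] M}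
    (hfg : Function.Exact f g) (hg : Function.Surjective g) :
    (ShortComplex.mk (dualHom (S := S) (T := T) g)
      (ModuleCat.ofHom (Y := LinearMap.range (homDual R S T f)) (homDual R S T f).rangeRestrict)
      (by
        ext x : 2
        exact Subtype.ext ((homDual_eq_zero_iff hfg hg _).2 ⟨x, rfl⟩))).ShortExact :=
  moduleCat_shortExact _ _ (homDual_injective hg) (LinearMap.surjective_rangeRestrict _)
    (fun h => Iff.trans
      (Subtype.ext_iff (a1 := (homDual R S T f).rangeRestrict h) (a2 := 0))
      (homDual_eq_zero_iff hfg hg h))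

/-- In 0 → M* → P₀* → P₁* → Tr M → 0, vanishing of Ext^1(Tr M, T) and Ext^2(Tr M, T) says that maps
to T extend from the image of f* to P₁* and from M* to P₀*. These yield injectivity and surjectivity
of M → M**. -/
theorem isReflexive_of_gorensteinProjective {t : T} (ht : IsFreeGenerator R S T t)
    {M : ModuleCat.{u} R} (hM : gorensteinProjective R S T M) : IsReflexive R S T M := by
  obtain ⟨-, N, ⟨P₁, P₀, f, g, _, _, _, _, hfg, hg, ⟨φ⟩⟩, -, hN⟩ := hM
  have hN' : ExtVanish (ModuleCat.of S ((P₁ →ₗ[R] T) ⧸ LinearMap.range (homDual R S T f)))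
      (ModuleCat.of S T) := ExtVanish.of_iso_left hN φ
  have := (dual_projective S ht (P := P₁)).2
  have hP₁ : Projective (ModuleCat.of S (P₁ →ₗ[R] T)) := (IsProjective.iff_projective _).1 this
  have := (dual_projective S ht (P := P₀)).2
  have hP₀ : Projective (ModuleCat.of S (P₀ →ₗ[R] T)) := (IsProjective.iff_projective _).1 this
  obtain ⟨e1, hI⟩ := (extVanish_left_iff (transpose_shortExact S T f)
    (extVanish_of_projective (ModuleCat.of S (P₁ →ₗ[R] T)) _)).1 hN'
  obtain ⟨e0, -⟩ := (extVanish_left_iff (dual_shortExact S T hfg hg)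
    (extVanish_of_projective (ModuleCat.of S (P₀ →ₗ[R] T)) _)).1 hI
  constructor
  · intro m m' hmm
    obtain ⟨p, hp⟩ := hg (m - m')
    have hker (k : M →ₗ[R] T) : k (g p) = 0 := by
      rw [hp, map_sub, sub_eq_zero]
      exact LinearMap.congr_fun hmm k
    -- Evaluation at p kills M*, so it descends to the image of f*; its extension to P₁* is
    -- evaluation at some q, whence p = f(q) and g(p) = 0.
    have hle : LinearMap.ker (homDual R S T f) ≤ LinearMap.ker (evalAt (T := T) S p) := by
      intro h hh
      obtain ⟨k, rfl⟩ := (homDual_eq_zero_iff hfg hg h).1 hh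
      exact hker k
    let ψ : LinearMap.range (homDual R S T f) →ₗ[S] T :=
      (LinearMap.ker (homDual R S T f)).liftQ (evalAt S p) hle ∘ₗ (homDual R S T f).quotKerEquivRange.symm.toLinearMap
    have hψ (h : P₀ →ₗ[R] T) : ψ ((homDual R S T f).rangeRestrict h) = h p := by
      have : (homDual R S T f).quotKerEquivRange.symm ((homDual R S T f).rangeRestrict h) =
          (LinearMap.ker (homDual R S T f)).mkQ h := by
        rw [LinearEquiv.symm_apply_eq]; rfl
      change (LinearMap.ker (homDual R S T f)).liftQ (evalAt S p) hle ((homDual R S T f).quotKerEquivRange.symm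
        ((homDual R S T f).rangeRestrict h)) = h p
      rw [this]
      rfl
    obtain ⟨χ, hχ⟩ := e1 (ModuleCat.ofHom ψ)
    obtain ⟨q, hq⟩ := (evalAt_bijective S ht (P := P₁)).2 χ.hom
    have : p = f q := (evalAt_bijective S ht (P := P₀)).1 (LinearMap.ext fun h => by
      have h1 := congrArg (fun k => k.hom ((homDual R S T f).rangeRestrict h)) hχ
      change χ.hom (homDual R S T f h) = ψ ((homDual R S T f).rangeRestrict h) at h1
      rw [hψ, ← hq] at h1
      exact h1.symm)
    rw [this, hfg.apply_apply_eq_zero] at hp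
    exact (sub_eq_zero.1 hp.symm)
  · intro φ
    obtain ⟨χ, hχ⟩ := e0 (ModuleCat.ofHom φ)
    obtain ⟨p, hp⟩ := (evalAt_bijective S ht (P := P₀)).2 χ.hom
    refine ⟨g p, LinearMap.ext fun k => ?_⟩
    have h1 := congrArg (fun l => l.hom k) hχ
    change χ.hom (homDual R S T g k) = φ k at h1
    rw [← h1, ← hp]
    rfl

/-- A class of finitely generated modules without extensions by `T` that is closed under some
cosyzygies consists of Gorenstein projective modules. -/
theorem gorensteinProjective_of_cosyzygies [IsNoetherianRing R] {t : T}
    (ht : IsFreeGenerator R S T t) (c : ModuleCat.{u} R → Prop)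
    (hfin : ∀ M, c M → Module.Finite R M) (hext : ∀ M, c M → ExtVanish M (ModuleCat.of R T))
    (hc : ∀ M, c M → ∃ X : ShortComplex (ModuleCat.{u} R), X.ShortExact ∧ X.X₁ = M ∧
      Module.Finite R X.X₂ ∧ Module.Projective R X.X₂ ∧ c X.X₃) {M : ModuleCat.{u} R} (hM : c M) :
    gorensteinProjective R S T M := by
  have tl (M : ModuleCat.{u} R) (hM : c M) :
      Function.Injective (evalAt S : M → ((M →ₗ[R] T) →ₗ[S] T)) := by
    obtain ⟨X, hX, rfl, _, _, h3⟩ := hc M hM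
    have hf := (ModuleCat.mono_iff_injective _).1 hX.mono_f
    intro m m' h
    refine hf ((evalAt_bijective S ht (P := X.X₂)).1 (LinearMap.ext fun g => ?_))
    exact LinearMap.congr_fun h (g ∘ₗ X.f.hom)
  have extend (X : ShortComplex (ModuleCat.{u} R)) (hX : X.ShortExact)
      (hP : Module.Projective R X.X₂) (h3 : c X.X₃) (g : X.X₁ →ₗ[R] T) :
      ∃ g' : X.X₂ →ₗ[R] T, g' ∘ₗ X.f.hom = g := by
    have : Projective X.X₂ := (IsProjective.iff_projective X.X₂).1 hP
    obtain ⟨g', hg'⟩ := ((extVanish_left_iff hX (extVanish_of_projective _ _)).1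
      (hext _ h3)).1 (ModuleCat.ofHom g)
    exact ⟨g'.hom, congrArg ModuleCat.Hom.hom hg'⟩
  -- A functional on M*, pulled back to X₂*, is evaluation at some p in X₂. Since X₃ is torsionless,
  -- p maps to 0 there and so comes from M.
  have refl (M : ModuleCat.{u} R) (hM : c M) : IsReflexive R S T M := by
    refine ⟨tl M hM, fun φ => ?_⟩
    obtain ⟨X, hX, rfl, _, hP, h3⟩ := hc M hM
    have hE := (ShortComplex.ShortExact.moduleCat_exact_iff_function_exact _).1 hX.exact
    obtain ⟨p, hp⟩ := (evalAt_bijective S ht (P := X.X₂)).2 (φ ∘ₗ homDual R S T X.f.hom)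
    have hp0 : X.g.hom p = 0 := tl _ h3 (LinearMap.ext fun g' => by
      have h1 := LinearMap.congr_fun hp (g' ∘ₗ X.g.hom)
      have h2 : homDual R S T X.f.hom (g' ∘ₗ X.g.hom) = 0 := by
        ext x
        change g' (X.g.hom (X.f.hom x)) = 0
        rw [hE.apply_apply_eq_zero, map_zero]
      rw [LinearMap.comp_apply, h2, map_zero] at h1
      exact h1.trans (map_zero g').symm)
    obtain ⟨m, rfl⟩ := (hE p).1 hp0
    refine ⟨m, LinearMap.ext fun g => ?_⟩
    obtain ⟨g', rfl⟩ := extend X hX hP h3 g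
    exact LinearMap.congr_fun hp g'
  -- Dualizing 0 → M → X₂ → X₃ → 0 makes X₃* a syzygy of M*, and reflexivity of X₃ kills Ext^1(M*,
  -- T); iterating shifts through all degrees.
  have dualExt (M : ModuleCat.{u} R) (hM : c M) :
      ExtVanish (ModuleCat.of S (M →ₗ[R] T)) (ModuleCat.of S T) := by
    refine extVanish_of_syzygies
      (fun X => ∃ M, c M ∧ X = ModuleCat.of S (M →ₗ[R] T)) ?_ ⟨M, hM, rfl⟩
    rintro _ ⟨M, hM, rfl⟩
    obtain ⟨X, hX, rfl, _, hP, h3⟩ := hc M hM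
    have hE := (ShortComplex.ShortExact.moduleCat_exact_iff_function_exact _).1 hX.exact
    have hg := (ModuleCat.epi_iff_surjective _).1 hX.epi_g
    have := (dual_projective S ht (P := X.X₂)).2
    have hP' : Projective (ModuleCat.of S (X.X₂ →ₗ[R] T)) := (IsProjective.iff_projective _).1 this
    refine ⟨_, moduleCat_shortExact (dualHom (S := S) (T := T) X.g.hom)
      (dualHom (S := S) (T := T) X.f.hom) (homDual_injective hg) (extend X hX hP h3)
      (fun h => homDual_eq_zero_iff hE hg h),
      extVanish_of_projective (ModuleCat.of S (X.X₂ →ₗ[R] T)) _, ?_, ⟨_, h3, rfl⟩, rfl⟩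
    intro φ
    obtain ⟨m, hm⟩ := (refl _ h3).2 φ.hom
    obtain ⟨p, rfl⟩ := hg m
    refine ⟨ModuleCat.ofHom (evalAt S p), ?_⟩
    refine ModuleCat.hom_ext ?_
    rw [← hm]
    rfl
  have := hfin M hM
  obtain ⟨n, g, hg⟩ := Module.Finite.exists_fin' R M
  obtain ⟨k, f', hf'⟩ := Module.Finite.exists_fin' R (LinearMap.ker g)
  let P₀ : ModuleCat.{u} R := ModuleCat.of R (Fin n → R)
  let P₁ : ModuleCat.{u} R := ModuleCat.of R (Fin k → R)
  let f : P₁ →ₗ[R] P₀ := (LinearMap.ker g).subtype ∘ₗ f'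
  have hfg : Function.Exact f (show P₀ →ₗ[R] M from g) := by
    intro x
    constructor
    · intro hx
      obtain ⟨y, hy⟩ := hf' ⟨x, hx⟩
      exact ⟨y, congrArg Subtype.val hy⟩
    · rintro ⟨y, rfl⟩
      exact (f' y).2
  have hf1 : Module.Finite R P₁ := inferInstanceAs (Module.Finite R (Fin k → R))
  have hf0 : Module.Finite R P₀ := inferInstanceAs (Module.Finite R (Fin n → R))
  have hp1 : Module.Projective R P₁ := inferInstanceAs (Module.Projective R (Fin k → R))
  have hp0 : Module.Projective R P₀ := inferInstanceAs (Module.Projective R (Fin n → R))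
  have hP1 := dual_projective S ht (P := P₁)
  have hP0 := dual_projective S ht (P := P₀)
  have hP1' : Projective (ModuleCat.of S (P₁ →ₗ[R] T)) := (IsProjective.iff_projective _).1 hP1.2
  have hP0' : Projective (ModuleCat.of S (P₀ →ₗ[R] T)) := (IsProjective.iff_projective _).1 hP0.2
  have := hP1.1
  refine ⟨⟨hfin M hM, hext M hM⟩,
    ModuleCat.of S ((P₁ →ₗ[R] T) ⧸ LinearMap.range (homDual R S T f)),
    ⟨P₁, P₀, f, g, hf1, hp1, hf0, hp0, hfg, hg, ⟨Iso.refl _⟩⟩, ?_, ?_⟩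
  · exact inferInstanceAs (Module.Finite S ((P₁ →ₗ[R] T) ⧸ LinearMap.range (homDual R S T f)))
  · refine (extVanish_left_iff (transpose_shortExact S T f)
      (extVanish_of_projective (ModuleCat.of S (P₁ →ₗ[R] T)) _)).2 ⟨fun φ => ?_,
      (extVanish_left_iff (dual_shortExact S T hfg hg)
        (extVanish_of_projective (ModuleCat.of S (P₀ →ₗ[R] T)) _)).2 ⟨fun φ => ?_, dualExt M hM⟩⟩
    · obtain ⟨p, hp⟩ := (evalAt_bijective S ht (P := P₀)).2
        (φ.hom ∘ₗ (homDual R S T f).rangeRestrict)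
      have hgp : g p = 0 := tl M hM (LinearMap.ext fun h => by
        have h1 := LinearMap.congr_fun hp (h ∘ₗ g)
        have h2 : (homDual R S T f).rangeRestrict (h ∘ₗ g) = 0 :=
          Subtype.ext ((homDual_eq_zero_iff hfg hg _).2 ⟨h, rfl⟩)
        rw [LinearMap.comp_apply, h2, map_zero] at h1
        exact h1.trans (map_zero h).symm)
      obtain ⟨q, rfl⟩ := (hfg p).1 hgp
      refine ⟨ModuleCat.ofHom (evalAt S q), ?_⟩
      ext ⟨_, h, rfl⟩
      exact LinearMap.congr_fun hp h
    · obtain ⟨m, hm⟩ := (refl M hM).2 φ.hom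
      obtain ⟨p, rfl⟩ := hg m
      refine ⟨ModuleCat.ofHom (evalAt S p), ?_⟩
      refine ModuleCat.hom_ext ?_
      rw [← hm]
      rfl

end Gorenstein

/-! ### Transferring Hom bijectivity to reflexive modules. -/

section Reflexive

variable {R S T : Type u} [Ring R] [Ring S] [AddCommGroup T] [Module R T] [Module S T]
  [SMulCommClass R S T]

/-- The homomorphism `T → M` mapping the generator `t` to `m`. -/
noncomputable def IsFreeGenerator.hom {t : T} (ht : IsFreeGenerator R S T t) {M : ModuleCat.{u} R}
    (m : M) : ModuleCat.of R T ⟶ M :=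
  ModuleCat.ofHom (LinearMap.toSpanSingleton R M m ∘ₗ
    (LinearEquiv.ofBijective (LinearMap.toSpanSingleton R T t) ht.left).symm.toLinearMap)

omit [SMulCommClass R S T] in
theorem IsFreeGenerator.hom_apply {t : T} (ht : IsFreeGenerator R S T t) {M : ModuleCat.{u} R}
    (m : M) : (ht.hom m).hom t = m := by
  have : (LinearEquiv.ofBijective (LinearMap.toSpanSingleton R T t) ht.left).symm t = 1 := by
    rw [LinearEquiv.symm_apply_eq]
    exact (one_smul R t).symm
  change LinearMap.toSpanSingleton R M m
    ((LinearEquiv.ofBijective (LinearMap.toSpanSingleton R T t) ht.left).symm t) = m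
  rw [this]
  exact one_smul R m

omit [SMulCommClass R S T] in
theorem IsFreeGenerator.hom_ext {t : T} (ht : IsFreeGenerator R S T t) {M : ModuleCat.{u} R}
    {f g : ModuleCat.of R T ⟶ M} (h : f.hom t = g.hom t) : f = g := by
  ext x
  obtain ⟨r, rfl⟩ := ht.left.2 x
  change f.hom (r • t) = g.hom (r • t)
  rw [map_smul, map_smul, h]

/-- A functor that is bijective on the endomorphisms of `T` is bijective on the homomorphisms
from `T` to a reflexive module. -/
theorem HomBijective.of_isReflexive {D : Type*} [Category* D] [Preadditive D]
    {F : ModuleCat.{u} R ⥤ D} [F.Additive] {t : T} (ht : IsFreeGenerator R S T t)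
    (hT : HomBijective F (ModuleCat.of R T) (ModuleCat.of R T)) {M : ModuleCat.{u} R}
    (hM : IsReflexive R S T M)
    (hF : ∀ h h' : F.obj (ModuleCat.of R T) ⟶ F.obj M,
      (∀ n : M ⟶ ModuleCat.of R T, h ≫ F.map n = h' ≫ F.map n) → h = h') :
    HomBijective F (ModuleCat.of R T) M := by
  constructor
  · intro f g hfg
    refine ht.hom_ext (hM.1 (LinearMap.ext fun n => ?_))
    have : f ≫ ModuleCat.ofHom n = g ≫ ModuleCat.ofHom n := hT.1 (by
      rw [F.map_comp, F.map_comp, hfg])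
    exact congrArg (fun k => k.hom t) this
  · intro h
    -- Composing h with each functional n gives an endomorphism `k n` of T; n ↦ (k n)(t) is S-linear
    -- on M*, hence is evaluation at some m, and t ↦ m is the lift of h.
    choose k hk using fun n : M →ₗ[R] T => hT.2 (h ≫ F.map (ModuleCat.ofHom n))
    let σ (s : S) : ModuleCat.of R T ⟶ ModuleCat.of R T :=
      ModuleCat.ofHom
        { toFun := fun x => s • x
          map_add' := smul_add s
          map_smul' := fun r x => (smul_comm r s x).symm }
    obtain ⟨m, hm⟩ := hM.2
      { toFun := fun n => (k n).hom t
        map_add' := fun n n' => by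
          have : k (n + n') = k n + k n' := hT.1 (by
            rw [F.map_add, hk, hk, hk, ModuleCat.ofHom_add, F.map_add, Preadditive.comp_add])
          rw [this]
          rfl
        map_smul' := fun s n => by
          have : k (s • n) = k n ≫ σ s := hT.1 (by
            rw [F.map_comp, hk, hk, Category.assoc, ← F.map_comp]
            rfl)
          rw [this]
          rfl }
    refine ⟨ht.hom m, hF _ _ fun n => ?_⟩
    rw [← F.map_comp]
    refine Eq.trans ?_ (hk n.hom)
    congr 1
    refine ht.hom_ext ?_
    change n.hom ((ht.hom m).hom t) = _
    rw [ht.hom_apply]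
    exact LinearMap.congr_fun hm n.hom

end Reflexive

theorem HomBijective.of_iso_left {C D : Type*} [Category* C] [Category* D] {F : C ⥤ D} {X X' Y : C}
    (h : HomBijective F X Y) (i : X ≅ X') : HomBijective F X' Y := by
  constructor
  · intro f g hfg
    rw [← cancel_epi i.hom]
    exact h.1 (by rw [F.map_comp, F.map_comp, hfg])
  · intro k
    obtain ⟨l, hl⟩ := h.2 (F.map i.hom ≫ k)
    exact ⟨i.inv ≫ l, by rw [F.map_comp, hl, ← F.map_comp_assoc, i.inv_hom_id, F.map_id,
      Category.id_comp]⟩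

theorem isFreeGenerator_right (A : Type u) [Ring A] : IsFreeGenerator Aᵐᵒᵖ A A 1 where
  left := by
    convert unop_bijective (α := A) using 1
    exact funext fun a => one_mul a.unop
  right := by
    convert Function.bijective_id (α := A) using 1
    exact funext fun a => mul_one a

theorem isFreeGenerator_left (A : Type u) [Ring A] : IsFreeGenerator A Aᵐᵒᵖ A 1 where
  left := by
    convert Function.bijective_id (α := A) using 1
    exact funext fun a => mul_one a
  right := by
    convert unop_bijective (α := A) using 1
    exact funext fun a => one_mul a.unop

/-! ### Gorenstein projectives are local, Gorenstein injectives are colocal. -/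

section Duality

open scoped ModuleCat

variable {K A : Type u} [Field K] [Ring A] [Algebra K A] {e : A} {he : IsIdempotentElem e}

theorem homBijective_of_gp (hA : HomBijective (cornerFunctor he) (regular A) (regular A))
    {M : ModuleCat.{u} Aᵐᵒᵖ} (hM : Gp A M) : HomBijective (cornerFunctor he) (regular A) M := by
  have hM := isReflexive_of_gorensteinProjective (isFreeGenerator_right A) hM
  refine HomBijective.of_isReflexive (isFreeGenerator_right A) hA hM fun h h' H => ?_
  ext x
  refine Subtype.ext (hM.1 (LinearMap.ext fun n => ?_))
  exact congrArg (fun k => (k.hom x : cornerGroup he (regular A)).1) (H (ModuleCat.ofHom n))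

variable (K A he) in
/-- The contravariant functor `N ↦ D(N)e`. -/
def dualCornerFunctor : ModuleCat.{u} A ⥤ (ModuleCat.{u} he.Cornerᵐᵒᵖ)ᵒᵖ where
  obj N := Opposite.op ((cornerFunctor he).obj (dualOfLeft K A N))
  map f := ((cornerFunctor he).map (dualMapL K f)).op

instance : (dualCornerFunctor K A he).Additive where
  map_add {N N' f g} := by
    refine Quiver.Hom.unop_inj ?_
    change (cornerFunctor he).map (dualMapL K (f + g)) =
      (cornerFunctor he).map (dualMapL K f) + (cornerFunctor he).map (dualMapL K g)
    rw [← Functor.map_add]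
    congr 1
    ext q
    exact formL_ext fun n => map_add (formL K q) (f.hom n) (g.hom n)

variable [Module.Finite K A]

omit [Module.Finite K A] in
theorem homBijective_dualCornerFunctor_iff {N T : ModuleCat.{u} A}
    (h : Function.Bijective (dualMapL K : (N ⟶ T) → _)) :
    HomBijective (dualCornerFunctor K A he) N T ↔
      HomBijective (cornerFunctor he) (dualOfLeft K A T) (dualOfLeft K A N) := by
  refine Iff.trans ?_ (Function.Bijective.of_comp_iff (cornerFunctor he).map h)
  exact Function.Bijective.of_comp_iff' (f := Quiver.Hom.op)
    ⟨Quiver.Hom.op_inj, fun f => ⟨f.unop, rfl⟩⟩ ((cornerFunctor he).map ∘ dualMapL K)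

/-- Dual to N being torsionless: a map D(N) → D(A) is the dual of some x : A → N, and if it kills
every image of D(A) then every functional on N kills x(1), so x = 0. -/
theorem iSup_range_dualMapL {N : ModuleCat.{u} A} [Module.Finite A N]
    (hN : ∀ x : N, (∀ n : N →ₗ[A] A, n x = 0) → x = 0) :
    ⨆ n : N ⟶ ModuleCat.of A A, LinearMap.range (dualMapL K n).hom = ⊤ := by
  rw [eq_top_iff]
  rintro w -
  set P := ⨆ n : N ⟶ ModuleCat.of A A, LinearMap.range (dualMapL K n).hom
  let L : ModuleCat.{u} Aᵐᵒᵖ := ModuleCat.of Aᵐᵒᵖ (dualOfLeft K A N ⧸ P)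
  let p : dualOfLeft K A N ⟶ L := ModuleCat.ofHom (X := dualOfLeft K A N) P.mkQ
  refine (Submodule.Quotient.mk_eq_zero P).1 (isCogenerator_regularDual (K := K) L _ fun f => ?_)
  obtain ⟨x, hx⟩ := (dualMapL_bijective (K := K) (ModuleCat.of A A) N).2 (p ≫ f)
  have hx0 : x = 0 := by
    refine (isFreeGenerator_left A).hom_ext (hN _ fun n => ?_)
    have h1 : dualMapL K (x ≫ ModuleCat.ofHom n) = dualMapL K 0 := by
      refine (show _ = dualMapL K (ModuleCat.ofHom n) ≫ dualMapL K x from rfl).trans ?_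
      rw [hx]
      ext q
      have : p.hom ((dualMapL K (ModuleCat.ofHom n)).hom q) = 0 :=
        (Submodule.Quotient.mk_eq_zero P).2
          (Submodule.mem_iSup_of_mem (ModuleCat.ofHom n) ⟨q, rfl⟩)
      refine (congrArg f.hom this).trans ((map_zero f.hom).trans ?_)
      exact formL_ext fun n => (map_zero (formL K q)).symm
    exact congrArg (fun k => k.hom (1 : A)) ((dualMapL_bijective (K := K) _ _).1 h1)
  have := congrArg (fun k => k.hom w) hx
  refine this.symm.trans ?_
  rw [hx0]
  exact formL_ext fun n => map_zero (formL K w)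

omit [Module.Finite K A] in
theorem cornerHomFun_zero {M N : ModuleCat.{u} Aᵐᵒᵖ}
    (k : (cornerFunctor he).obj M ⟶ (cornerFunctor he).obj N) : cornerHomFun k 0 = 0 := by
  have := cornerHomFun_add k 0 0
  rwa [add_zero, left_eq_add] at this

theorem corner_dualMapL_jointly_epi {N : ModuleCat.{u} A} [Module.Finite A N]
    (hN : ∀ x : N, (∀ n : N →ₗ[A] A, n x = 0) → x = 0) {M : ModuleCat.{u} Aᵐᵒᵖ}
    {k k' : (cornerFunctor he).obj (dualOfLeft K A N) ⟶ (cornerFunctor he).obj M}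
    (h : ∀ n : N ⟶ ModuleCat.of A A, (cornerFunctor he).map (dualMapL K n) ≫ k =
      (cornerFunctor he).map (dualMapL K n) ≫ k') : k = k' := by
  refine cornerHom_ext fun w hw => ?_
  have hw' : w ∈ ⨆ n : N ⟶ ModuleCat.of A A, LinearMap.range (dualMapL K n).hom := by
    rw [iSup_range_dualMapL hN]; trivial
  clear hw
  induction hw' using Submodule.iSup_induction' with
  | mem n w hw =>
    obtain ⟨q, rfl⟩ := hw
    exact (cornerHom_congr k _ _ (map_smul (dualMapL K n).hom (op e) q).symm).trans
      ((congrArg (fun k => cornerHomFun k q) (h n)).trans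
        (cornerHom_congr k' _ _ (map_smul (dualMapL K n).hom (op e) q)))
  | zero => rw [cornerHomFun_zero, cornerHomFun_zero]
  | add w w' _ _ hw hw' => rw [cornerHomFun_add, cornerHomFun_add, hw, hw']

/-- The transfer to reflexive modules is applied to left modules and the contravariant functor N ↦
D(N)e. -/
theorem homBijective_dualOfLeft
    (hQ : HomBijective (cornerFunctor he) (regularDual K A) (regularDual K A))
    {N : ModuleCat.{u} A} [Module.Finite A N] (hN : IsReflexive A Aᵐᵒᵖ A N) :
    HomBijective (cornerFunctor he) (dualOfLeft K A N) (regularDual K A) :=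
  (homBijective_dualCornerFunctor_iff (dualMapL_bijective _ _)).1
    (HomBijective.of_isReflexive (isFreeGenerator_left A)
      ((homBijective_dualCornerFunctor_iff (dualMapL_bijective _ _)).2 hQ) hN fun _ _ H =>
      Quiver.Hom.unop_inj (corner_dualMapL_jointly_epi
        (fun _ hx => hN.1 (LinearMap.ext fun n => (hx n).trans (map_zero n).symm))
        fun n => congrArg Quiver.Hom.unop (H n)))

theorem homBijective_of_gi
    (hQ : HomBijective (cornerFunctor he) (regularDual K A) (regularDual K A))
    {M : ModuleCat.{u} Aᵐᵒᵖ} (hM : Gi K A M) :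
    HomBijective (cornerFunctor he) M (regularDual K A) := by
  have := hM.1
  have := finite_dualOfRight K M
  obtain ⟨i⟩ := nonempty_biduality K M
  exact (homBijective_dualOfLeft hQ
    (isReflexive_of_gorensteinProjective (isFreeGenerator_left A) hM.2)).of_iso_left i.symm

theorem extVanish_dualOfRight_iff {M : ModuleCat.{u} Aᵐᵒᵖ} [Module.Finite Aᵐᵒᵖ M] :
    ExtVanish (dualOfRight K A M) (ModuleCat.of A A) ↔ ExtVanish (regularDual K A) M := by
  obtain ⟨i⟩ := nonempty_biduality K M
  rw [← extVanish_dual_iff (K := K)]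
  exact ⟨fun h => h.of_iso_right i.symm, fun h => h.of_iso_right i⟩

/-- A free cover of D(M) dualizes to a monomorphism out of the injective module DD(M) ≅ M. It
splits, and dualizing the splitting back splits the cover. -/
theorem projective_dualOfRight {M : ModuleCat.{u} Aᵐᵒᵖ} [Module.Finite Aᵐᵒᵖ M] [Injective M] :
    Module.Projective A (dualOfRight K A M) := by
  have := finite_dualOfRight K M
  obtain ⟨i⟩ := nonempty_biduality K M
  have : Injective (dualOfLeft K A (dualOfRight K A M)) := Injective.of_iso i inferInstance
  obtain ⟨n, g, hg⟩ := Module.Finite.exists_fin' A (dualOfRight K A M)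
  let T : ModuleCat.{u} A := ModuleCat.of A (Fin n → A)
  have : Module.Finite A T := inferInstanceAs (Module.Finite A (Fin n → A))
  let p : T ⟶ dualOfRight K A M := ModuleCat.ofHom (X := T) (Y := dualOfRight K A M) g
  have : Mono (dualMapL K p) := by
    rw [ModuleCat.mono_iff_injective]
    intro q q' h
    refine formL_ext fun x => ?_
    obtain ⟨y, rfl⟩ := hg x
    exact congrArg (fun k => formL K k y) h
  obtain ⟨s, hs⟩ := (dualMapL_bijective (K := K) _ T).2
    (Injective.factorThru (𝟙 _) (dualMapL K p))
  have hsp : s ≫ p = 𝟙 _ := (dualMapL_bijective (K := K) _ _).1 (by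
    refine (show _ = dualMapL K p ≫ dualMapL K s from rfl).trans ?_
    rw [hs, Injective.comp_factorThru]
    rfl)
  have : Module.Projective A T := inferInstanceAs (Module.Projective A (Fin n → A))
  exact Module.Projective.of_split s.hom p.hom (congrArg ModuleCat.Hom.hom hsp)

end Duality

/-! ### Identification of Gpi and the equivalences. -/

section Equivalence

variable {K A : Type u} [Field K] [Ring A] [Algebra K A] [Module.Finite K A] {e : A}
  {he : IsIdempotentElem e}

theorem extVanish_regularDual_of_gi {M : ModuleCat.{u} Aᵐᵒᵖ} (hM : Gi K A M) :
    ExtVanish (regularDual K A) M := by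
  have := hM.1
  exact extVanish_dualOfRight_iff.1 hM.2.1.2

theorem isPowEA_finite (hE : Module.Finite Aᵐᵒᵖ (eA he)) {X : ModuleCat.{u} Aᵐᵒᵖ}
    (hX : IsPowEA he X) : Module.Finite Aᵐᵒᵖ X := by
  obtain ⟨k, rfl⟩ := hX
  exact inferInstanceAs (Module.Finite Aᵐᵒᵖ (Fin k → eA he))

/-- A finitely generated module that is biperpendicular is Gorenstein projective and Gorenstein
injective. -/
theorem gpi_of_isBiperpendicular
    (p : ApproximableDualPair (cornerFunctor he) (regular A) (regularDual K A) (IsFinite A)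
      (IsPowEA he)) (hE : Module.Finite Aᵐᵒᵖ (eA he)) {M : ModuleCat.{u} Aᵐᵒᵖ}
    (hM : IsBiperpendicular (cornerFunctor he) (regular A) (regularDual K A) (IsFinite A) M) :
    Gpi K A M := by
  have : IsNoetherianRing Aᵐᵒᵖ := IsNoetherianRing.of_finite K Aᵐᵒᵖ
  have : IsNoetherianRing A := IsNoetherianRing.of_finite K A
  refine ⟨?_, hM.fin, ?_⟩
  · refine gorensteinProjective_of_cosyzygies (isFreeGenerator_right A)
      (IsBiperpendicular (cornerFunctor he) (regular A) (regularDual K A) (IsFinite A))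
      (fun M h => h.fin) (fun M h => h.ext_A) (fun M h => ?_) hM
    obtain ⟨S, hS, h1, h2, h3⟩ := p.exists_cosyzygy h
    exact ⟨S, hS, h1, isPowEA_finite hE h2, (IsProjective.iff_projective S.X₂).2 (p.proj _ h2), h3⟩
  -- The duals of syzygies of M are cosyzygies of D(M), so the cosyzygy criterion applies to the
  -- dual class.
  · refine gorensteinProjective_of_cosyzygies (isFreeGenerator_left A)
      (fun N => ∃ M, IsBiperpendicular (cornerFunctor he) (regular A) (regularDual K A)
        (IsFinite A) M ∧ N = dualOfRight K A M) ?_ ?_ ?_ ⟨M, hM, rfl⟩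
    · rintro _ ⟨M, hM, rfl⟩
      have : Module.Finite Aᵐᵒᵖ M := hM.fin
      exact finite_dualOfRight K M
    · rintro _ ⟨M, hM, rfl⟩
      have : Module.Finite Aᵐᵒᵖ M := hM.fin
      exact extVanish_dualOfRight_iff.2 hM.ext_Q
    · rintro _ ⟨M, hM, rfl⟩
      obtain ⟨S, hS, rfl, h2, h3⟩ := p.exists_syzygy hM
      have := isPowEA_finite hE h2
      have := p.inj _ h2
      exact ⟨_, dualMapR_shortExact K hS, rfl, finite_dualOfRight K S.X₂, projective_dualOfRight,
        _, h3, rfl⟩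

theorem isBiperpendicular_of_gpi
    (p : ApproximableDualPair (cornerFunctor he) (regular A) (regularDual K A) (IsFinite A)
      (IsPowEA he)) {M : ModuleCat.{u} Aᵐᵒᵖ} (hM : Gpi K A M) :
    IsBiperpendicular (cornerFunctor he) (regular A) (regularDual K A) (IsFinite A) M where
  fin := hM.2.1
  bij_A := homBijective_of_gp (p.bij_to _) hM.1
  bij_Q := homBijective_of_gi (p.bij_from _) hM.2
  ext_A := hM.1.1.2
  ext_Q := extVanish_regularDual_of_gi hM.2

/-- `Ae`, as the image of the regular module. -/
def cornerRegularIsoAe : (cornerFunctor he).obj (regular A) ≅ AeCorner he :=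
  let φ : (cornerFunctor he).obj (regular A) ≃ₗ[he.Cornerᵐᵒᵖ] AeCorner he :=
    { toFun := fun z => (⟨z.1, z.2⟩ : Ae he)
      invFun := fun z => (⟨z.1, z.2⟩ : cornerGroup he (regular A))
      map_add' := fun _ _ => rfl
      map_smul' := fun _ _ => rfl
      left_inv := fun _ => rfl
      right_inv := fun _ => rfl }
  φ.toModuleIso

theorem leftPerp_map_iff
    (p : ApproximableDualPair (cornerFunctor he) (regular A) (regularDual K A) (IsFinite A)
      (IsPowEA he)) {M : ModuleCat.{u} Aᵐᵒᵖ} (hM : Module.Finite Aᵐᵒᵖ M)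
    (h : HomBijective (cornerFunctor he) M (regularDual K A)) :
    leftPerp (AeCorner he) ((cornerFunctor he).obj M) ↔ ExtVanish M (regular A) := by
  rw [← p.extVanish_map_left hM h]
  exact ⟨fun H => ExtVanish.of_iso_right H.2 cornerRegularIsoAe.symm,
    fun H => ⟨finite_cornerFunctor K he M, H.of_iso_right cornerRegularIsoAe⟩⟩

/-- The comparison concerns Ext out of F Q = D(A)e, which the trace form identifies with Ae. -/
theorem rightPerp_map_iff
    (p : ApproximableDualPair (cornerFunctor he) (regular A) (regularDual K A) (IsFinite A)
      (IsPowEA he)) {M : ModuleCat.{u} Aᵐᵒᵖ} (hM : Module.Finite Aᵐᵒᵖ M)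
    (h : HomBijective (cornerFunctor he) (regular A) M) :
    rightPerp (AeCorner he) ((cornerFunctor he).obj M) ↔ ExtVanish (regularDual K A) M := by
  rw [← p.extVanish_map_right hM h]
  have i := p.iso.symm ≪≫ cornerRegularIsoAe
  exact ⟨fun H => ExtVanish.of_iso_left H.2 i.symm,
    fun H => ⟨finite_cornerFunctor K he M, H.of_iso_left i⟩⟩

theorem leftPerp_of_iso {R : Type u} [Ring R] {T X Y : ModuleCat.{u} R} (i : X ≅ Y)
    (h : leftPerp T X) : leftPerp T Y :=
  have := h.1
  ⟨Module.Finite.equiv i.toLinearEquiv, ExtVanish.of_iso_left h.2 i⟩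

theorem rightPerp_of_iso {R : Type u} [Ring R] {T X Y : ModuleCat.{u} R} (i : X ≅ Y)
    (h : rightPerp T X) : rightPerp T Y :=
  have := h.1
  ⟨Module.Finite.equiv i.toLinearEquiv, ExtVanish.of_iso_right h.2 i⟩

theorem W_map_of_gpi
    (p : ApproximableDualPair (cornerFunctor he) (regular A) (regularDual K A) (IsFinite A)
      (IsPowEA he)) {M : ModuleCat.{u} Aᵐᵒᵖ} (hM : Gpi K A M) : W he ((cornerFunctor he).obj M) := by
  have h := isBiperpendicular_of_gpi p hM
  obtain ⟨i⟩ := nonempty_iso_G₁ (h.bij_Q.of_cogenerator isCogenerator_regularDual) (Iso.refl _)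
  obtain ⟨j⟩ := nonempty_iso_G₂ h.bij_A
  exact ⟨⟨(leftPerp_map_iff p h.fin h.bij_Q).2 h.ext_A, (rightPerp_map_iff p h.fin h.bij_A).2 h.ext_Q⟩,
    ⟨i ≪≫ j⟩⟩

/-- G₂(X) is always local, and being isomorphic to G₁(X) makes it colocal; the Ext conditions are
transferred along G₂(X)e ≅ X. -/
theorem gpi_G₂_of_W
    (p : ApproximableDualPair (cornerFunctor he) (regular A) (regularDual K A) (IsFinite A)
      (IsPowEA he)) (hE : Module.Finite Aᵐᵒᵖ (eA he)) {X : ModuleCat.{u} he.Cornerᵐᵒᵖ}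
    (hX : W he X) : Gpi K A (G₂ he X) := by
  obtain ⟨⟨hl, hr⟩, ⟨i⟩⟩ := hX
  have := hl.1
  have hf := finite_G₂ K he X
  have hA := homBijective_G₂ X
  have hQ := (homBijective_G₁ X (regularDual K A)).of_iso_left i
  exact gpi_of_isBiperpendicular p hE
    { fin := hf
      bij_A := hA
      bij_Q := hQ
      ext_A := (leftPerp_map_iff p hf hQ).1 (leftPerp_of_iso (evalG₂ X).symm hl)
      ext_Q := (rightPerp_map_iff p hf hA).1 (rightPerp_of_iso (evalG₂ X).symm hr) }

theorem restrictsToEquivalence_of_bijective {C D : Type*} [Category* C] [Category* D] {F : C ⥤ D}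
    {P : ObjectProperty C} {Q : ObjectProperty D} (h : ∀ M, P M → Q (F.obj M))
    (hb : ∀ M N, P M → P N → HomBijective F M N)
    (hs : ∀ X, Q X → ∃ M, P M ∧ Nonempty (F.obj M ≅ X)) : RestrictsToEquivalence F P Q := by
  refine ⟨fun M => h _ M.2, ?_⟩
  have : (Q.lift (P.ι ⋙ F) fun M => h _ M.2).Faithful :=
    ⟨fun {M N f g} hfg => by
      ext
      exact (hb _ _ M.2 N.2).1 (congrArg (fun k => k.hom) hfg)⟩
  have : (Q.lift (P.ι ⋙ F) fun M => h _ M.2).Full :=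
    ⟨fun {M N} f => by
      obtain ⟨g, hg⟩ := (hb _ _ M.2 N.2).2 f.hom
      exact ⟨ObjectProperty.homMk g, by ext; exact hg⟩⟩
  have : (Q.lift (P.ι ⋙ F) fun M => h _ M.2).EssSurj :=
    ⟨fun X => by
      obtain ⟨M, hM, ⟨i⟩⟩ := hs X.1 X.2
      exact ⟨⟨M, hM⟩, ⟨Q.isoMk i⟩⟩⟩
  exact { }

theorem restrictsToEquivalence_W
    (p : ApproximableDualPair (cornerFunctor he) (regular A) (regularDual K A) (IsFinite A)
      (IsPowEA he)) (hE : Module.Finite Aᵐᵒᵖ (eA he)) :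
    RestrictsToEquivalence (cornerFunctor he) (Gpi K A) (W he) :=
  restrictsToEquivalence_of_bijective (fun _ hM => W_map_of_gpi p hM)
    (fun _ _ _ hN => (isBiperpendicular_of_gpi p hN).bij_A.of_regular _)
    fun X hX => ⟨_, gpi_G₂_of_W p hE hX, ⟨evalG₂ X⟩⟩

/-- G₂(X) has no extensions from D(A), so the nearly Gorenstein property makes it Gorenstein
injective and therefore colocal. Hence G₁(X) ≅ G₂(X), and the syzygy argument yields the vanishing
of Ext into A. -/
theorem W_of_rightPerp
    (p : ApproximableDualPair (cornerFunctor he) (regular A) (regularDual K A) (IsFinite A)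
      (IsPowEA he)) (hN : IsNearlyGorenstein K A) {X : ModuleCat.{u} he.Cornerᵐᵒᵖ}
    (hX : rightPerp (AeCorner he) X) : W he X := by
  have := hX.1
  have hf := finite_G₂ K he X
  have hA := homBijective_G₂ X
  have hE := (rightPerp_map_iff p hf hA).1 (rightPerp_of_iso (evalG₂ X).symm hX)
  have key (M : ModuleCat.{u} Aᵐᵒᵖ) (hM : Module.Finite Aᵐᵒᵖ M)
      (hE : ExtVanish (regularDual K A) M) :
      HomBijective (cornerFunctor he) M (regularDual K A) :=
    homBijective_of_gi (p.bij_from _) (by rw [hN.right]; exact ⟨hM, hE⟩)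
  have hQ := key _ hf hE
  exact ⟨⟨leftPerp_of_iso (evalG₂ X)
    ((leftPerp_map_iff p hf hQ).2 (p.extVanish_of_extVanish_right key hf hA hE)), hX⟩,
    nonempty_iso_G₁ (hQ.of_cogenerator isCogenerator_regularDual) (evalG₂ X)⟩

/-- The dual argument starts from G₁(X), which is colocal; the nearly Gorenstein property makes it
Gorenstein projective, hence local. -/
theorem rightPerp_of_leftPerp
    (p : ApproximableDualPair (cornerFunctor he) (regular A) (regularDual K A) (IsFinite A)
      (IsPowEA he)) (hN : IsNearlyGorenstein K A) {X : ModuleCat.{u} he.Cornerᵐᵒᵖ}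
    (hX : leftPerp (AeCorner he) X) : rightPerp (AeCorner he) X := by
  have := hX.1
  have hf := finite_G₁ X
  have hQ := homBijective_G₁ X (regularDual K A)
  have hE := (leftPerp_map_iff p hf hQ).1 (leftPerp_of_iso (unitIsoG₁ X) hX)
  have key (M : ModuleCat.{u} Aᵐᵒᵖ) (hM : Module.Finite Aᵐᵒᵖ M)
      (hE : ExtVanish M (regular A)) : HomBijective (cornerFunctor he) (regular A) M :=
    homBijective_of_gp (p.bij_to _) (by rw [hN.left]; exact ⟨hM, hE⟩)
  exact rightPerp_of_iso (unitIsoG₁ X).symm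
    ((rightPerp_map_iff p hf (key _ hf hE)).2 (p.extVanish_of_extVanish_left key hf hQ hE))

end Equivalence

end GendoSym

theorem mainTheorem11 {K A : Type u} [Field K] [Ring A] [Algebra K A] [Module.Finite K A]
    (hA : GendoSym.IsGendoSymmetric K A) {e : A} (he : IsIdempotentElem e)
    (heA : GendoSym.IsMinimalFaithfulProjInj (ModuleCat.of Aᵐᵒᵖ (GendoSym.eA he))) :
    (¬ GendoSym.IsSelfinjective A →
      GendoSym.RestrictsToEquivalence (GendoSym.cornerFunctor he) (GendoSym.Gpi K A)
        (GendoSym.W he)) ∧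
    (GendoSym.IsNearlyGorenstein K A →
      GendoSym.RestrictsToEquivalence (GendoSym.cornerFunctor he) (GendoSym.Gpi K A)
        (GendoSym.rightPerp (GendoSym.AeCorner he)) ∧
      GendoSym.rightPerp (GendoSym.AeCorner he) = GendoSym.leftPerp (GendoSym.AeCorner he) ∧
      GendoSym.leftPerp (GendoSym.AeCorner he) =
        GendoSym.leftPerp (GendoSym.AeCorner he) ⊓ GendoSym.rightPerp (GendoSym.AeCorner he)) := by
  obtain ⟨t⟩ := GendoSym.exists_traceForm hA heA
  let p := GendoSym.gendoDualPair t heA hA.1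
  have hW := GendoSym.restrictsToEquivalence_W p heA.finite
  refine ⟨fun _ => hW, fun hN => ?_⟩
  have hlr (X : ModuleCat.{u} he.Cornerᵐᵒᵖ) := GendoSym.rightPerp_of_leftPerp p hN (X := X)
  have hrW (X : ModuleCat.{u} he.Cornerᵐᵒᵖ) := GendoSym.W_of_rightPerp p hN (X := X)
  -- In the nearly Gorenstein case W is all of (Ae)^⊥, so the second equivalence is the first one
  -- rewritten.
  have hWr : GendoSym.W he = GendoSym.rightPerp (GendoSym.AeCorner he) :=
    funext fun X => propext ⟨fun h => h.1.2, hrW X⟩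
  refine ⟨hWr ▸ hW, funext fun X => propext ⟨fun h => (hrW X h).1.1, hlr X⟩,
    funext fun X => propext ⟨fun h => ⟨h, hlr X h⟩, fun h => h.1⟩⟩
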